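/- Let $\mathcal V:(0,\infty)\setminus\{1\}\to\mathbb R$ be $\mathcal V=R+S$, where for $0<p<1$ $$R(p)=\frac{2\log p}{1+p^2}-\frac{2}{p\sqrt{1+p^2}}\,\mathrm{artanh}\frac{p}{\sqrt{1+p^2}},\qquad S(p)=-\frac{2\log p}{1-p^2}+\frac{2}{p\sqrt{1-p^2}}\arctan\frac{p}{\sqrt{1-p^2}},$$ and for $p>1$ $$R(p)=-\frac{2\log p}{p(1+p^2)}-\frac{2}{p\sqrt{1+p^2}}\,\mathrm{artanh}\frac{1}{\sqrt{1+p^2}},\qquad S(p)=\frac{2\log p}{p(p^2-1)}+\frac{2}{p\sqrt{p^2-1}}\arctan\frac{1}{\sqrt{p^2-1}}.$$ Let $n^0(p)=p^{-2}$ and $$\gamma_N=\iint_{p_3,p_4>0,\;p_3^2+p_4^2>1}\min\{1,p_2,p_3,p_4\}\big(n^0_3n^0_4-n^0_2n^0_3-n^0_2n^0_4\big)\,p_3p_4\,dp_3\,dp_4,\qquad p_2=\sqrt{p_3^2+p_4^2-1},$$ with $n^0_i=n^0(p_i)$. Consider the linearization around $n^0$ (with $n=n^0(1+A)$) of the isotropic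 wave kinetic equation of the three dimensional cubic Schrödinger equation, $$\partial_tA(t,p)=\gamma_NA(t,p)+\int_0^\infty\mathcal V\Big(\frac p{p'}\Big)A(t,p')\frac{dp'}{p'},\qquad A(0)=A_0.\tag{E}$$ For real $q\ge1$ and $\theta$, let $L^q_\theta$ be the space of measurable $f$ on $(0,\infty)$ with $\|f\|_{L^q_\theta}=\big(\int_0^\infty|f|^qp^{2\theta-1}dp\big)^{1/q}<\infty$, and for real $a,b$ let $\mathscr Y_{a,b}$ be the space of measurable $g$ on $(0,\infty)$ with $\|g\|_{a,b}=\operatorname{ess\,sup}_{0<p<1}p^{-2a}|g(p)|+\operatorname{ess\,sup}_{p>1}p^{-2b}|g(p)|<\infty$. A solution in a space $X$ is a function $A\in C([0,\infty);X)\cap C^1((0,\infty);X)$ with $A(0)=A_0$ that satisfies (E) in $X$ for all $t>0$. Equalities and inequalities of functions of $p$ hold almost everywhere. 1. (Well-posedness.) (i) Let $q\ge1$ and $\theta\in(-1,5/2)$. For every nonnegative $A_0\in L^q_\theta$ there is a unique solution $A$ in $L^q_\theta$, and $A(t)\ge0$ for all $t\ge 0$. For every $T>0$ there is a constant $C_T>0$,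 independent of $A_0$, with $\|A(t)\|_{L^q_\theta}\le C_T\|A_0\|_{L^q_\theta}$ for all $t\in[0,T]$. Moreover $\mathcal V\in L^1_0$ and, when $\theta=0$, $$\|A(t)\|_{L^q_0}\le e^{\gamma_Nt}\Big(1+\|\mathcal V\|_{L^1_0}\big(e^{\|\mathcal V\|_{L^1_0}t}-1\big)\Big)\|A_0\|_{L^q_0}\qquad\text{for all }t\ge0.$$ (ii) Let $-\frac52<b<-\frac34$ and $\frac12<a<1$. For every nonnegative $A_0\in\mathscr Y_{a,b}$ there is a unique solution $A$ in $\mathscr Y_{a,b}$, and $A(t)\ge0$ for all $t\ge0$. For every $T>0$ there is a constant $C_T>0$, independent of $A_0$, with $\|A(t)\|_{a,b}\le C_T\|A_0\|_{a,b}$ for all $t\in[0,T]$. 2. (Conservation of wave action.) If $A$ is a solution in one of the spaces of 1 and $A_0\in L^1(0,\infty)$, then for all $t\ge0$, $A(t)\in L^1(0,\infty)$ and $\int_0^\infty A(t,p)\,dp=\int_0^\infty A_0(p)\,dp$. 3. (Growth of energy.) There is $\kappa>0$ such that, if $A$ is a solution in one of the spaces of 1 and $A_0\in L^1((0,\infty);p^2dp)$,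 then for all $t\ge0$, $A(t)\in L^1((0,\infty);p^2dp)$ and $\int_0^\infty A(t,p)p^2\,dp=e^{\kappa t}\int_0^\infty A_0(p)p^2\,dp$. 4. (Long time behaviour.) Let $-\frac52<b<-\frac34$, $\frac12<a<1$, let $A_0\in\mathscr Y_{a,b}$ be nonnegative and $A$ its solution in $\mathscr Y_{a,b}$. Then $A_0\in L^1(0,\infty)$, and for every bounded continuous $\varphi:[0,\infty)\to\mathbb R$ the integrals $\int_0^\infty A(t,p)\varphi(p)\,dp$ converge absolutely and $$\lim_{t\to\infty}\int_0^\infty A(t,p)\varphi(p)\,dp=\varphi(0)\int_0^\infty A_0(p)\,dp.$$ -/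

import Mathlib

open MeasureTheory Filter Topology Set
open scoped ENNReal

namespace LinearWKE

noncomputable section

/-- Lebesgue measure on the half line `(0, ∞)`. -/
def halfLine : Measure ℝ := volume.restrict (Ioi 0)

/-! ### The equation -/

/-- The singular Rayleigh-Jeans equilibrium `n⁰(p) = p⁻²`. -/
def n0 (p : ℝ) : ℝ := 1 / p ^ 2

/-- The momentum `p₂` fixed by energy conservation `p₁² + p₂² = p₃² + p₄²`, for `p₁ = 1`. -/
def pTwo (p₃ p₄ : ℝ) : ℝ := √(p₃ ^ 2 + p₄ ^ 2 - 1)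

/-- The constant `γ_N`: the coefficient of `A(p₁)` in the linearization of the collision integral
around `n⁰`,
`∬ (min {p₁, p₂, p₃, p₄} / p₁) (n⁰₃ n⁰₄ - n⁰₂ n⁰₃ - n⁰₂ n⁰₄) p₃ p₄ dp₃ dp₄`,
over `p₃, p₄ > 0`, `p₃² + p₄² > p₁²`. By homogeneity it does not depend on `p₁`, which is set
to `1`. -/
def gammaN : ℝ :=
  ∫ z in {z : ℝ × ℝ | 0 < z.1 ∧ 0 < z.2 ∧ 1 < z.1 ^ 2 + z.2 ^ 2},
    min 1 (min (pTwo z.1 z.2) (min z.1 z.2)) *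
      (n0 z.1 * n0 z.2 - n0 (pTwo z.1 z.2) * n0 z.1 - n0 (pTwo z.1 z.2) * n0 z.2) *
      (z.1 * z.2)

/-- The part of the kernel produced by the `A(p₂)` term. -/
def kernelR (p : ℝ) : ℝ :=
  if p < 1 then
    2 * Real.log p / (1 + p ^ 2)
      - 2 / (p * √(1 + p ^ 2)) * Real.artanh (p / √(1 + p ^ 2))
  else
    -(2 * Real.log p / (p * (1 + p ^ 2))
      + 2 / (p * √(1 + p ^ 2)) * Real.artanh (1 / √(1 + p ^ 2)))

/-- The part of the kernel produced by the `A(p₃)` and `A(p₄)` terms. -/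
def kernelS (p : ℝ) : ℝ :=
  if p < 1 then
    -(2 * Real.log p) / (1 - p ^ 2)
      + 2 / (p * √(1 - p ^ 2)) * Real.arctan (p / √(1 - p ^ 2))
  else
    2 * Real.log p / (p * (p ^ 2 - 1))
      + 2 / (p * √(p ^ 2 - 1)) * Real.arctan (1 / √(p ^ 2 - 1))

/-- The kernel `𝒱 = R + S` (its value at the singular point `p = 1` is irrelevant). -/
def kernelV (p : ℝ) : ℝ := kernelR p + kernelS p

/-! ### The function spaces -/

/-- The norm `(∫₀^∞ |f|^q p^(2θ-1) dp)^(1/q)` of `L^q_θ(0, ∞)`, with values in `[0, ∞]`. -/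
def normLq (q θ : ℝ) (f : ℝ → ℝ) : ℝ≥0∞ :=
  eLpNorm f (ENNReal.ofReal q)
    (halfLine.withDensity fun p => ENNReal.ofReal (p ^ (2 * θ - 1)))

/-- The norm `ess sup_{0<p<1} p^(-2a) |g(p)| + ess sup_{p>1} p^(-2b) |g(p)|` of `𝒴_{a,b}`,
with values in `[0, ∞]`. -/
def normY (a b : ℝ) (g : ℝ → ℝ) : ℝ≥0∞ :=
  eLpNorm (fun p => p ^ (-2 * a) * g p) ∞ (volume.restrict (Ioo 0 1)) +
    eLpNorm (fun p => p ^ (-2 * b) * g p) ∞ (volume.restrict (Ioi 1))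

/-- Membership in the space of measurable functions on `(0, ∞)` with finite norm `N`. -/
def MemSpace (N : (ℝ → ℝ) → ℝ≥0∞) (f : ℝ → ℝ) : Prop :=
  AEStronglyMeasurable f halfLine ∧ N f < ∞

/-- The admissible exponents of the spaces `𝒴_{a,b}`. -/
def AdmissibleY (a b : ℝ) : Prop :=
  -(5 / 2) < b ∧ b < -(3 / 4) ∧ 1 / 2 < a ∧ a < 1

/-- Nonnegativity almost everywhere on `(0, ∞)`. -/
def Nonneg (f : ℝ → ℝ) : Prop := ∀ᵐ p ∂halfLine, 0 ≤ f p

/-! ### Solutions -/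

/-- `A ∈ C([0, ∞); X) ∩ C¹((0, ∞); X)`, where `X` is the space with norm `N`, has `A(0) = A₀` and
satisfies `∂ₜ A(t, p) = γ_N A(t, p) + ∫₀^∞ 𝒱(p / p') A(t, p') dp' / p'` in `X` for all `t > 0`,
the integral being absolutely convergent for almost every `p`. -/
structure IsSolution (N : (ℝ → ℝ) → ℝ≥0∞) (A₀ : ℝ → ℝ) (A : ℝ → ℝ → ℝ) : Prop where
  mem : ∀ t, 0 ≤ t → MemSpace N (A t)
  init : A 0 =ᵐ[halfLine] A₀
  continuous : ∀ t, 0 ≤ t → Tendsto (fun s => N (A s - A t)) (𝓝[Ici 0] t) (𝓝 0)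
  equation : ∃ D : ℝ → ℝ → ℝ, ∀ t, 0 < t →
    MemSpace N (D t) ∧
    Tendsto (fun s => N ((s - t)⁻¹ • (A s - A t) - D t)) (𝓝[≠] t) (𝓝 0) ∧
    Tendsto (fun s => N (D s - D t)) (𝓝 t) (𝓝 0) ∧
    ∀ᵐ p ∂halfLine,
      Integrable (fun p' => kernelV (p / p') * A t p' / p') halfLine ∧
      D t p = gammaN * A t p + ∫ p', kernelV (p / p') * A t p' / p' ∂halfLine

/-- A solution in one of the spaces `L^q_θ` or `𝒴_{a,b}`. -/
def IsSolutionInSomeSpace (A₀ : ℝ → ℝ) (A : ℝ → ℝ → ℝ) : Prop :=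
  (∃ q θ : ℝ, 1 ≤ q ∧ θ ∈ Ioo (-1 : ℝ) (5 / 2) ∧ IsSolution (normLq q θ) A₀ A) ∨
  (∃ a b : ℝ, AdmissibleY a b ∧ IsSolution (normY a b) A₀ A)

/-- For every nonnegative initial datum in the space with norm `N` there is a nonnegative solution,
it is the only solution in that space, and on bounded time intervals it is bounded by the datum. -/
def WellPosed (N : (ℝ → ℝ) → ℝ≥0∞) : Prop :=
  (∀ A₀ : ℝ → ℝ, MemSpace N A₀ → Nonneg A₀ →
    ∃ A : ℝ → ℝ → ℝ, IsSolution N A₀ A ∧ (∀ t, 0 ≤ t → Nonneg (A t)) ∧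
      ∀ B : ℝ → ℝ → ℝ, IsSolution N A₀ B → ∀ t, 0 ≤ t → B t =ᵐ[halfLine] A t) ∧
  (∀ T : ℝ, 0 < T → ∃ C : ℝ, 0 < C ∧
    ∀ (A₀ : ℝ → ℝ) (A : ℝ → ℝ → ℝ), Nonneg A₀ → IsSolution N A₀ A →
      ∀ t ∈ Icc 0 T, N (A t) ≤ ENNReal.ofReal C * N A₀)

end

end LinearWKE

open LinearWKE

/-!
The integral term `U f (p) = ∫ 𝒱(p / q) f(q) dq / q` is a multiplicative convolution with a positive
kernel, so it multiplies the moment `∫ f p^(c-1) dp` by the Mellin moment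
`m(c) = ∫ 𝒱(s) s^(c-1) ds`, which is finite for `-2 < c < 5`. Consequently `U` is bounded on all
spaces in question and the solution is `e^{t(γ_N + U)} A₀`; uniqueness follows from a Grönwall
estimate for the norm, and moments of solutions evolve by the factor `e^{t(γ_N + m(c))}`. By the
symmetry `𝒱(1 / p) = p³ 𝒱(p)` one has `m(3 - c) = m(c)`, and `m` is strictly convex. Moreover
`γ_N = -m(1)`, which amounts to the conservation of the wave action, so the energy grows at the rate
`κ = m(3) - m(1) > 0`, whereas the moment with `c = 3 / 2` decays at the rate `m(1) - m(3 / 2) > 0`.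
The latter forces the wave action to concentrate at the origin.
-/

namespace LinearWKE

noncomputable section

/-! ### Pointwise properties of the kernel -/

section InverseFunctions

variable {x : ℝ}

lemma measurable_artanh : Measurable Real.artanh := by
  unfold Real.artanh
  fun_prop

lemma artanh_div_sqrt_one_add_sq (x : ℝ) : Real.artanh (x / √(1 + x ^ 2)) = Real.arsinh x := by
  have htanh : Real.tanh (Real.arsinh x) = x / √(1 + x ^ 2) := by
    rw [Real.tanh_eq_sinh_div_cosh, Real.sinh_arsinh, Real.cosh_arsinh]
  rw [← htanh, Real.artanh_tanh]

lemma self_le_artanh (hx : 0 ≤ x) (hx1 : x < 1) : x ≤ Real.artanh x := by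
  have hseries := sum_le_hasSum {0} (fun i _ => by positivity)
    (Real.hasSum_log_sub_log_of_abs_lt_one (by rwa [abs_of_nonneg hx]))
  simp only [Finset.sum_singleton, Nat.cast_zero, mul_zero, zero_add, div_one, mul_one,
    pow_one] at hseries
  rw [Real.artanh_eq_half_log ⟨by linarith, hx1.le⟩, Real.log_div (by linarith) (by linarith)]
  linarith

lemma arsinh_le_self (hx : 0 ≤ x) : Real.arsinh x ≤ x := by
  rw [← Real.sinh_le_sinh, Real.sinh_arsinh]
  exact Real.self_le_sinh_iff.2 hx

lemma arctan_le_self (hx : 0 ≤ x) : Real.arctan x ≤ x := by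
  simpa only [Real.tan_arctan] using
    Real.le_tan (Real.arctan_nonneg.2 hx) (Real.arctan_lt_pi_div_two x)

lemma self_le_arcsin (hx : 0 ≤ x) (hx1 : x ≤ 1) : x ≤ Real.arcsin x := by
  simpa only [Real.sin_arcsin (by linarith) hx1] using Real.sin_le (Real.arcsin_nonneg.2 hx)

lemma div_one_add_sq_le_arsinh_div_sqrt (hx : 0 ≤ x) :
    x / (1 + x ^ 2) ≤ Real.arsinh x / √(1 + x ^ 2) := by
  have hdiv : x / √(1 + x ^ 2) ≤ Real.arsinh x := by
    rw [← artanh_div_sqrt_one_add_sq]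
    refine self_le_artanh (by positivity) ((div_lt_one (by positivity)).2 ?_)
    exact Real.lt_sqrt_of_sq_lt (by linarith)
  calc x / (1 + x ^ 2) = x / √(1 + x ^ 2) / √(1 + x ^ 2) := by
        rw [div_div, Real.mul_self_sqrt (by positivity)]
    _ ≤ _ := by gcongr

lemma arsinh_div_sqrt_le_self (hx : 0 ≤ x) : Real.arsinh x / √(1 + x ^ 2) ≤ x :=
  (div_le_self (Real.arsinh_nonneg_iff.2 hx)
    (Real.one_le_sqrt.2 (by linarith [sq_nonneg x]))).trans (arsinh_le_self hx)

lemma arcsin_div_sqrt_le (hx : 0 ≤ x) (hx1 : x < 1) :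
    Real.arcsin x / √(1 - x ^ 2) ≤ x / (1 - x ^ 2) := by
  have hpos : 0 < 1 - x ^ 2 := by nlinarith
  calc Real.arcsin x / √(1 - x ^ 2) ≤ x / √(1 - x ^ 2) / √(1 - x ^ 2) := by
        gcongr
        rw [Real.arcsin_eq_arctan ⟨by linarith, hx1⟩]
        exact arctan_le_self (by positivity)
    _ = x / (1 - x ^ 2) := by rw [div_div, Real.mul_self_sqrt hpos.le]

lemma one_add_half_sq_le_inv_sqrt (hx : x ^ 2 < 1) : 1 + x ^ 2 / 2 ≤ (√(1 - x ^ 2))⁻¹ := by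
  have hpos : 0 < 1 - x ^ 2 := by linarith
  rw [le_inv_comm₀ (by positivity) (by positivity)]
  refine Real.sqrt_le_sqrt_iff (by positivity) |>.2 ?_ |>.trans (Real.sqrt_sq (by positivity)).le
  rw [inv_pow, le_inv_comm₀ hpos (by positivity), ← one_div, le_div_iff₀ hpos]
  nlinarith [sq_nonneg x, pow_nonneg (sq_nonneg x) 2, pow_nonneg (sq_nonneg x) 3]

lemma neg_log_le_rpow_div {ε : ℝ} (hx : 0 ≤ x) (hε : 0 < ε) : -Real.log x ≤ x ^ (-ε) / ε := by
  simpa only [Real.log_inv, Real.inv_rpow hx, ← Real.rpow_neg hx] using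
    Real.log_le_rpow_div (inv_nonneg.2 hx) hε

end InverseFunctions

lemma measurable_kernelR : Measurable kernelR :=
  Measurable.ite measurableSet_Iio
    (Measurable.sub (by fun_prop)
      (Measurable.mul (by fun_prop) (measurable_artanh.comp (by fun_prop))))
    (Measurable.neg (Measurable.add (by fun_prop)
      (Measurable.mul (by fun_prop) (measurable_artanh.comp (by fun_prop)))))

lemma measurable_kernelS : Measurable kernelS :=
  Measurable.ite measurableSet_Iio (by fun_prop) (by fun_prop)

lemma measurable_kernelV : Measurable kernelV := measurable_kernelR.add measurable_kernelS

/-- The symmetry `f p = p⁻³ f (1 / p)` shared by the kernels `R`, `S` and `𝒱`; it exchanges the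
Mellin moments of orders `c` and `3 - c`. -/
def InversionSymmetric (f : ℝ → ℝ) : Prop := ∀ p, 1 < p → f p = p ^ (-3 : ℝ) * f p⁻¹

lemma inversionSymmetric_kernelR : InversionSymmetric kernelR := by
  intro p hp
  have hp0 : 0 < p := by linarith
  have hsqrt : √(1 + p⁻¹ ^ 2) = √(1 + p ^ 2) / p := by
    rw [← Real.sqrt_sq hp0.le, ← Real.sqrt_div (by positivity), Real.sqrt_sq hp0.le]
    congr 1
    field_simp
    ring
  rw [kernelR, kernelR, if_neg hp.le.not_gt, if_pos (inv_lt_one_of_one_lt₀ hp), hsqrt,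
    Real.log_inv, show p⁻¹ / (√(1 + p ^ 2) / p) = 1 / √(1 + p ^ 2) by field_simp,
    show 1 + p⁻¹ ^ 2 = (1 + p ^ 2) / p ^ 2 by field_simp; ring, Real.rpow_neg hp0.le,
    Real.rpow_ofNat]
  field_simp
  ring

lemma inversionSymmetric_kernelS : InversionSymmetric kernelS := by
  intro p hp
  have hp0 : 0 < p := by linarith
  have hpos : 0 < p ^ 2 - 1 := by nlinarith
  have hsqrt : √(1 - p⁻¹ ^ 2) = √(p ^ 2 - 1) / p := by
    rw [← Real.sqrt_sq hp0.le, ← Real.sqrt_div (by rw [Real.sqrt_sq hp0.le]; exact hpos.le),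
      Real.sqrt_sq hp0.le]
    congr 1
    field_simp
  rw [kernelS, kernelS, if_neg hp.le.not_gt, if_pos (inv_lt_one_of_one_lt₀ hp), hsqrt,
    Real.log_inv, show p⁻¹ / (√(p ^ 2 - 1) / p) = 1 / √(p ^ 2 - 1) by field_simp,
    show 1 - p⁻¹ ^ 2 = (p ^ 2 - 1) / p ^ 2 by field_simp, Real.rpow_neg hp0.le,
    Real.rpow_ofNat]
  field_simp

lemma inversionSymmetric_kernelV : InversionSymmetric kernelV := fun p hp => by
  rw [kernelV, kernelV, inversionSymmetric_kernelR p hp, inversionSymmetric_kernelS p hp, mul_add]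

section KernelBounds

variable {p : ℝ}

-- In this form both summands are nonnegative, whereas `R < 0 < S`.
lemma kernelV_eq_of_lt_one (hp : 0 < p) (hp1 : p < 1) :
    kernelV p = 4 * p ^ 2 * (-Real.log p / (1 - p ^ 4)) +
      2 / p * (Real.arcsin p / √(1 - p ^ 2) - Real.arsinh p / √(1 + p ^ 2)) := by
  have hpos : 0 < 1 - p ^ 2 := by nlinarith
  rw [kernelV, kernelR, kernelS, if_pos hp1, if_pos hp1, artanh_div_sqrt_one_add_sq,
    Real.arcsin_eq_arctan ⟨by linarith, hp1⟩,
    show 1 - p ^ 4 = (1 - p ^ 2) * (1 + p ^ 2) by ring]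
  field_simp
  ring

lemma quarter_le_neg_log_div (hp : 0 < p) (hp1 : p < 1) :
    1 / 4 ≤ -Real.log p / (1 - p ^ 4) := by
  have hfactor : 1 - p ^ 4 = (1 - p) * (1 + p + p ^ 2 + p ^ 3) := by ring
  have hsum : 1 + p + p ^ 2 + p ^ 3 ≤ 4 := by
    linarith [pow_le_one₀ (n := 2) hp.le hp1.le, pow_le_one₀ (n := 3) hp.le hp1.le]
  rw [le_div_iff₀ (by linarith [pow_lt_one₀ hp.le hp1 four_ne_zero]), hfactor]
  nlinarith [Real.log_le_sub_one_of_pos hp]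

lemma neg_log_div_le_two (hp : 1 / 2 ≤ p) (hp1 : p < 1) : -Real.log p / (1 - p ^ 4) ≤ 2 := by
  have hp0 : 0 < p := by linarith
  have hpow : p ^ 4 ≤ p := pow_le_of_le_one hp0.le hp1.le four_ne_zero
  have hlog : -Real.log p ≤ p⁻¹ - 1 := by
    rw [← Real.log_inv]
    exact Real.log_le_sub_one_of_pos (inv_pos.2 hp0)
  have hinv : p⁻¹ - 1 ≤ 2 * (1 - p) := by
    rw [sub_le_iff_le_add, inv_le_iff_one_le_mul₀ hp0]
    nlinarith
  rw [div_le_iff₀ (by linarith)]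
  linarith

lemma sq_le_arcsin_sub_arsinh (hp : 0 < p) (hp1 : p < 1) :
    p ^ 2 ≤ 2 / p * (Real.arcsin p / √(1 - p ^ 2) - Real.arsinh p / √(1 + p ^ 2)) := by
  have harcsin : p * (1 + p ^ 2 / 2) ≤ Real.arcsin p / √(1 - p ^ 2) := by
    rw [div_eq_mul_inv]
    exact mul_le_mul (self_le_arcsin hp.le hp1.le) (one_add_half_sq_le_inv_sqrt (by nlinarith))
      (by positivity) (Real.arcsin_nonneg.2 hp.le)
  have harsinh := arsinh_div_sqrt_le_self hp.le
  calc p ^ 2 = 2 / p * (p * (1 + p ^ 2 / 2) - p) := by field_simp; ring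
    _ ≤ _ := by gcongr

lemma arcsin_sub_arsinh_le (hp : 0 < p) (hp1 : p < 1) :
    2 / p * (Real.arcsin p / √(1 - p ^ 2) - Real.arsinh p / √(1 + p ^ 2))
      ≤ 4 * p ^ 2 / (1 - p ^ 4) := by
  have hpos : 0 < 1 - p ^ 2 := by nlinarith
  calc _ ≤ 2 / p * (p / (1 - p ^ 2) - p / (1 + p ^ 2)) :=
        mul_le_mul_of_nonneg_left (sub_le_sub (arcsin_div_sqrt_le hp.le hp1)
          (div_one_add_sq_le_arsinh_div_sqrt hp.le)) (by positivity)
    _ = 4 * p ^ 2 / (1 - p ^ 4) := by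
        rw [show 1 - p ^ 4 = (1 - p ^ 2) * (1 + p ^ 2) by ring]
        field_simp
        ring

lemma two_mul_sq_le_kernelV (hp : 0 < p) (hp1 : p < 1) : 2 * p ^ 2 ≤ kernelV p := by
  rw [kernelV_eq_of_lt_one hp hp1]
  nlinarith [mul_le_mul_of_nonneg_left (quarter_le_neg_log_div hp hp1)
    (show 0 ≤ 4 * p ^ 2 by positivity), sq_le_arcsin_sub_arsinh hp hp1]

lemma kernelV_pos (hp : 0 < p) (hp1 : p ≠ 1) : 0 < kernelV p := by
  have hlt {s : ℝ} (hs : 0 < s) (hs1 : s < 1) : 0 < kernelV s :=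
    lt_of_lt_of_le (by positivity) (two_mul_sq_le_kernelV hs hs1)
  rcases lt_or_gt_of_ne hp1 with h | h
  · exact hlt hp h
  · rw [inversionSymmetric_kernelV p h]
    exact mul_pos (by positivity) (hlt (inv_pos.2 hp) (inv_lt_one_of_one_lt₀ h))

lemma kernelV_le_of_le_half {ε : ℝ} (hp : 0 < p) (hp1 : p ≤ 1 / 2) (hε : 0 < ε) :
    kernelV p ≤ (8 / ε + 8) * p ^ (2 - ε) := by
  have h4 : 1 / 2 ≤ 1 - p ^ 4 := by
    linarith [pow_le_of_le_one hp.le (by linarith : p ≤ 1) four_ne_zero]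
  have hsq : p ^ 2 ≤ p ^ (2 - ε) := by
    rw [← Real.rpow_ofNat]
    exact Real.rpow_le_rpow_of_exponent_ge hp (by linarith) (by linarith)
  have hlog : 4 * p ^ 2 * (-Real.log p / (1 - p ^ 4)) ≤ 8 / ε * p ^ (2 - ε) := by
    calc 4 * p ^ 2 * (-Real.log p / (1 - p ^ 4)) ≤ 4 * p ^ 2 * (p ^ (-ε) / ε / (1 / 2)) := by
          gcongr
          exact neg_log_le_rpow_div hp.le hε
      _ = 8 / ε * p ^ (2 - ε) := by
          rw [sub_eq_add_neg, Real.rpow_add hp, Real.rpow_ofNat]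
          ring
  have harc : 2 / p * (Real.arcsin p / √(1 - p ^ 2) - Real.arsinh p / √(1 + p ^ 2))
      ≤ 8 * p ^ 2 := by
    calc _ ≤ 4 * p ^ 2 / (1 - p ^ 4) := arcsin_sub_arsinh_le hp (by linarith)
      _ ≤ 4 * p ^ 2 / (1 / 2) := by gcongr
      _ = 8 * p ^ 2 := by ring
  rw [kernelV_eq_of_lt_one hp (by linarith)]
  linarith

lemma kernelV_le_of_half_le (hp : 1 / 2 ≤ p) (hp1 : p < 1) :
    kernelV p ≤ 16 * (1 - p) ^ (-(1 / 2) : ℝ) := by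
  have hp0 : 0 < p := by linarith
  have hp' : 0 < 1 - p := by linarith
  have hone : 1 ≤ (1 - p) ^ (-(1 / 2) : ℝ) :=
    Real.one_le_rpow_of_pos_of_le_one_of_nonpos hp' (by linarith) (by norm_num)
  have hlog : 4 * p ^ 2 * (-Real.log p / (1 - p ^ 4)) ≤ 8 := by
    calc _ ≤ 4 * p ^ 2 * 2 := by gcongr; exact neg_log_div_le_two hp hp1
      _ ≤ 8 := by nlinarith
  have harcsin : Real.arcsin p / √(1 - p ^ 2) ≤ 2 / √(1 - p) := by
    gcongr
    · linarith [Real.arcsin_le_pi_div_two p, Real.pi_le_four]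
    · nlinarith
  have harsinh : 0 ≤ Real.arsinh p / √(1 + p ^ 2) :=
    div_nonneg (Real.arsinh_nonneg_iff.2 hp0.le) (by positivity)
  have harc : 2 / p * (Real.arcsin p / √(1 - p ^ 2) - Real.arsinh p / √(1 + p ^ 2))
      ≤ 8 * (1 - p) ^ (-(1 / 2) : ℝ) := by
    calc _ ≤ 2 / p * (2 / √(1 - p)) := by gcongr; linarith
      _ ≤ 2 / (1 / 2) * (2 / √(1 - p)) := by gcongr
      _ = _ := by rw [Real.rpow_neg hp'.le, ← Real.sqrt_eq_rpow]; ring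
  rw [kernelV_eq_of_lt_one hp0 hp1]
  linarith

lemma kernelR_nonpos (hp : 0 < p) : kernelR p ≤ 0 := by
  rw [kernelR]
  split_ifs with h
  · have hlog : 2 * Real.log p / (1 + p ^ 2) ≤ 0 :=
      div_nonpos_of_nonpos_of_nonneg (by linarith [Real.log_nonpos hp.le h.le]) (by positivity)
    have hartanh : 0 ≤ 2 / (p * √(1 + p ^ 2)) * Real.artanh (p / √(1 + p ^ 2)) :=
      mul_nonneg (by positivity) (Real.artanh_nonneg (by positivity))
    linarith
  · have hlog : 0 ≤ Real.log p := Real.log_nonneg (not_lt.1 h)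
    have hartanh : 0 ≤ Real.artanh (1 / √(1 + p ^ 2)) := Real.artanh_nonneg (by positivity)
    rw [Left.neg_nonpos_iff]
    positivity

lemma neg_kernelR_le (hp : 0 < p) (hp1 : p < 1) : -kernelR p ≤ 6 * p ^ (-(1 / 2) : ℝ) := by
  have hone : 1 ≤ p ^ (-(1 / 2) : ℝ) :=
    Real.one_le_rpow_of_pos_of_le_one_of_nonpos hp hp1.le (by norm_num)
  have hlog : -(2 * Real.log p / (1 + p ^ 2)) ≤ 4 * p ^ (-(1 / 2) : ℝ) := by
    have hdiv : -(2 * Real.log p) / (1 + p ^ 2) ≤ -(2 * Real.log p) :=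
      div_le_self (by linarith [Real.log_nonpos hp.le hp1.le]) (by linarith [sq_nonneg p])
    rw [neg_div] at hdiv
    linarith [neg_log_le_rpow_div hp.le (one_half_pos (α := ℝ))]
  have harsinh : 2 / (p * √(1 + p ^ 2)) * Real.arsinh p ≤ 2 := by
    calc _ = 2 / p * (Real.arsinh p / √(1 + p ^ 2)) := by ring
      _ ≤ 2 / p * p := by gcongr; exact arsinh_div_sqrt_le_self hp.le
      _ = 2 := div_mul_cancel₀ _ hp.ne'
  rw [kernelR, if_pos hp1, artanh_div_sqrt_one_add_sq]
  linarith

end KernelBounds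

/-! ### Integrability and symmetry of the kernel -/

section ChangeOfVariables

lemma lintegral_halfLine_div {a : ℝ} (ha : 0 < a) (f : ℝ → ℝ≥0∞) :
    ∫⁻ x, f (x / a) ∂halfLine = ENNReal.ofReal a * ∫⁻ x, f x ∂halfLine := by
  have hcov := lintegral_image_eq_lintegral_abs_deriv_mul (f := fun x => a * x) (f' := fun _ => a)
    (s := Ioi 0) measurableSet_Ioi (fun x _ => (hasDerivAt_const_mul a).hasDerivWithinAt)
    (fun x _ y _ hxy => mul_left_cancel₀ ha.ne' hxy) (fun x => f (x / a))
  simpa only [halfLine, image_mul_left_Ioi ha, mul_zero, abs_of_pos ha,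
    mul_div_cancel_left₀ _ ha.ne', lintegral_const_mul' _ _ ENNReal.ofReal_ne_top] using hcov

lemma lintegral_halfLine_const_div {p : ℝ} (hp : 0 < p) (f : ℝ → ℝ≥0∞) :
    ∫⁻ x, ENNReal.ofReal x⁻¹ * f (p / x) ∂halfLine
      = ∫⁻ x, ENNReal.ofReal x⁻¹ * f x ∂halfLine := by
  have himage : (fun x : ℝ => p / x) '' Ioi 0 = Ioi 0 := by
    refine Subset.antisymm (image_subset_iff.2 fun x hx => div_pos hp hx) fun y hy => ?_
    exact ⟨p / y, div_pos hp hy, div_div_cancel₀ hp.ne'⟩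
  have hcov := lintegral_image_eq_lintegral_abs_deriv_mul (f := fun x => p / x)
    (f' := fun x => -p / x ^ 2) (s := Ioi 0) measurableSet_Ioi
    (fun x hx => by
      simpa [div_eq_mul_inv] using
        ((hasDerivAt_inv (ne_of_gt hx)).const_mul p).hasDerivWithinAt (s := Ioi 0))
    (fun x _ y _ hxy => by simpa [div_eq_mul_inv, hp.ne'] using hxy)
    (fun x => ENNReal.ofReal x⁻¹ * f x)
  rw [himage] at hcov
  rw [halfLine, hcov]
  refine setLIntegral_congr_fun measurableSet_Ioi fun x (hx : 0 < x) => ?_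
  rw [← mul_assoc, ← ENNReal.ofReal_mul (abs_nonneg _), abs_div, abs_neg, abs_of_pos hp,
    abs_of_pos (by positivity)]
  congr 2
  field_simp

lemma setLIntegral_inv {s : Set ℝ} (hs : MeasurableSet s) (hpos : s ⊆ Ioi 0) (f : ℝ → ℝ≥0∞) :
    ∫⁻ x in s⁻¹, f x = ∫⁻ x in s, ENNReal.ofReal (x ^ (-2 : ℝ)) * f x⁻¹ := by
  rw [← image_inv_eq_inv, lintegral_image_eq_lintegral_abs_deriv_mul hs
    (fun x hx => (hasDerivAt_inv (ne_of_gt (hpos hx))).hasDerivWithinAt) inv_injective.injOn f]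
  refine setLIntegral_congr_fun hs fun x hx => ?_
  have hx0 : 0 < x := hpos hx
  rw [abs_neg, abs_of_pos (by positivity), Real.rpow_neg hx0.le, Real.rpow_ofNat]

lemma setLIntegral_Ioi_eq_add {a b : ℝ} (hab : a ≤ b) (f : ℝ → ℝ≥0∞) :
    ∫⁻ s in Ioi a, f s = (∫⁻ s in Ioo a b, f s) + ∫⁻ s in Ioi b, f s := by
  rw [← Ioc_union_Ioi_eq_Ioi hab, lintegral_union measurableSet_Ioi (Ioc_disjoint_Ioi le_rfl),
    setLIntegral_congr Ioo_ae_eq_Ioc.symm]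

lemma setLIntegral_Ioo_eq_add {a b c : ℝ} (hab : a ≤ b) (hbc : b < c) (f : ℝ → ℝ≥0∞) :
    ∫⁻ s in Ioo a c, f s = (∫⁻ s in Ioo a b, f s) + ∫⁻ s in Ioo b c, f s := by
  rw [← Ioc_union_Ioo_eq_Ioo hab hbc, lintegral_union measurableSet_Ioo
    ((Ioc_disjoint_Ioi le_rfl).mono_right Ioo_subset_Ioi_self),
    setLIntegral_congr Ioo_ae_eq_Ioc.symm]

lemma lintegral_halfLine_eq_add (f : ℝ → ℝ≥0∞) :
    ∫⁻ s, f s ∂halfLine = (∫⁻ s in Ioo 0 1, f s) + ∫⁻ s in Ioi 1, f s :=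
  setLIntegral_Ioi_eq_add zero_le_one f

end ChangeOfVariables

section InversionSymmetric

variable {f : ℝ → ℝ}

lemma InversionSymmetric.setLIntegral_Ioi_one (hf : InversionSymmetric f) (c : ℝ) :
    ∫⁻ s in Ioi 1, ‖f s * s ^ (c - 1)‖ₑ = ∫⁻ s in Ioo 0 1, ‖f s * s ^ (3 - c - 1)‖ₑ := by
  have hinv : (Ioi 1 : Set ℝ) = (Ioo 0 1)⁻¹ := by rw [inv_Ioo_0_left zero_lt_one, inv_one]
  rw [hinv, setLIntegral_inv measurableSet_Ioo fun x hx => hx.1]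
  refine setLIntegral_congr_fun measurableSet_Ioo fun x ⟨hx0, hx1⟩ => ?_
  rw [hf x⁻¹ ((one_lt_inv₀ hx0).2 hx1), inv_inv, ← Real.enorm_of_nonneg (by positivity),
    ← enorm_mul, Real.inv_rpow hx0.le, Real.inv_rpow hx0.le, ← Real.rpow_neg hx0.le,
    ← Real.rpow_neg hx0.le, show 3 - c - 1 = -2 + - -3 + -(c - 1) by ring, Real.rpow_add hx0,
    Real.rpow_add hx0]
  congr 1
  ring

lemma InversionSymmetric.lintegral_halfLine (hf : InversionSymmetric f) (c : ℝ) :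
    ∫⁻ s, ‖f s * s ^ (c - 1)‖ₑ ∂halfLine = (∫⁻ s in Ioo 0 1, ‖f s * s ^ (c - 1)‖ₑ) +
      ∫⁻ s in Ioo 0 1, ‖f s * s ^ (3 - c - 1)‖ₑ := by
  rw [lintegral_halfLine_eq_add, hf.setLIntegral_Ioi_one]

lemma InversionSymmetric.integrable_mul_rpow (hf : InversionSymmetric f) (hfm : Measurable f)
    {c : ℝ} (hc : IntegrableOn (fun s => f s * s ^ (c - 1)) (Ioo 0 1))
    (hc' : IntegrableOn (fun s => f s * s ^ (3 - c - 1)) (Ioo 0 1)) :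
    Integrable (fun s => f s * s ^ (c - 1)) halfLine := by
  have hm : Measurable fun s => f s * s ^ (c - 1) := hfm.mul (by fun_prop)
  refine ⟨hm.aestronglyMeasurable, ?_⟩
  rw [HasFiniteIntegral, hf.lintegral_halfLine]
  exact ENNReal.add_lt_top.2 ⟨hc.2, hc'.2⟩

end InversionSymmetric

lemma integrableOn_one_sub_rpow {r : ℝ} (hr : -1 < r) :
    IntegrableOn (fun s : ℝ => (1 - s) ^ r) (Ioo 0 1) := by
  have hreflect := ((intervalIntegral.intervalIntegrable_rpow' (a := 0) (b := 1) hr).comp_sub_left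
    1).symm
  simpa [intervalIntegrable_iff_integrableOn_Ioo_of_le] using hreflect

lemma integrableOn_kernelV_mul_rpow_near_zero {c : ℝ} (hc : -2 < c) :
    IntegrableOn (fun s => kernelV s * s ^ (c - 1)) (Ioc 0 (1 / 2)) := by
  have hm : Measurable fun s => kernelV s * s ^ (c - 1) := measurable_kernelV.mul (by fun_prop)
  set ε := (c + 2) / 2 with hε
  have hdom : IntegrableOn (fun s : ℝ => (8 / ε + 8) * s ^ (2 - ε + (c - 1))) (Ioc 0 (1 / 2)) := by
    rw [integrableOn_Ioc_iff_integrableOn_Ioo]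
    exact ((intervalIntegral.integrableOn_Ioo_rpow_iff one_half_pos).2
      (by rw [hε]; linarith)).const_mul _
  refine hdom.mono' hm.aestronglyMeasurable ?_
  refine (ae_restrict_mem measurableSet_Ioc).mono fun s ⟨hs0, hs⟩ => ?_
  have hV := kernelV_pos hs0 (by linarith)
  rw [Real.norm_of_nonneg (by positivity), Real.rpow_add hs0, ← mul_assoc]
  gcongr
  exact kernelV_le_of_le_half hs0 hs (by rw [hε]; linarith)

lemma integrableOn_kernelV_mul_rpow_near_one (c : ℝ) :
    IntegrableOn (fun s => kernelV s * s ^ (c - 1)) (Ioo (1 / 2) 1) := by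
  have hm : Measurable fun s => kernelV s * s ^ (c - 1) := measurable_kernelV.mul (by fun_prop)
  set K := max ((1 / 2 : ℝ) ^ (c - 1)) 1
  have hdom : IntegrableOn (fun s : ℝ => 16 * (1 - s) ^ (-(1 / 2) : ℝ) * K) (Ioo (1 / 2) 1) :=
    (((integrableOn_one_sub_rpow (by norm_num)).mono_set
      (Ioo_subset_Ioo_left one_half_pos.le)).const_mul _).mul_const _
  refine hdom.mono' hm.aestronglyMeasurable ?_
  refine (ae_restrict_mem measurableSet_Ioo).mono fun s ⟨hs, hs1⟩ => ?_
  have hs0 : 0 < s := by linarith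
  have hV := kernelV_pos hs0 hs1.ne
  have hK : s ^ (c - 1) ≤ K := by
    rcases le_total 0 (c - 1) with h | h
    · exact (Real.rpow_le_one hs0.le hs1.le h).trans (le_max_right _ _)
    · exact (Real.rpow_le_rpow_of_nonpos (by norm_num) hs.le h).trans (le_max_left _ _)
  rw [Real.norm_of_nonneg (by positivity)]
  exact mul_le_mul (kernelV_le_of_half_le hs.le hs1) hK (by positivity)
    (hV.le.trans (kernelV_le_of_half_le hs.le hs1))

lemma integrableOn_kernelV_mul_rpow {c : ℝ} (hc : -2 < c) :
    IntegrableOn (fun s => kernelV s * s ^ (c - 1)) (Ioo 0 1) := by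
  rw [← Ioc_union_Ioo_eq_Ioo (one_half_pos (α := ℝ)).le one_half_lt_one]
  exact (integrableOn_kernelV_mul_rpow_near_zero hc).union
    (integrableOn_kernelV_mul_rpow_near_one c)

lemma integrable_kernelV_mul_rpow {c : ℝ} (hc : -2 < c) (hc' : c < 5) :
    Integrable (fun s => kernelV s * s ^ (c - 1)) halfLine :=
  inversionSymmetric_kernelV.integrable_mul_rpow measurable_kernelV
    (integrableOn_kernelV_mul_rpow hc) (integrableOn_kernelV_mul_rpow (by linarith))

lemma integrableOn_kernelR_mul_rpow {c : ℝ} (hc : 1 / 2 < c) :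
    IntegrableOn (fun s => kernelR s * s ^ (c - 1)) (Ioo 0 1) := by
  have hm : Measurable fun s => kernelR s * s ^ (c - 1) := measurable_kernelR.mul (by fun_prop)
  have hdom : IntegrableOn (fun s : ℝ => 6 * s ^ (-(1 / 2) + (c - 1))) (Ioo 0 1) :=
    ((intervalIntegral.integrableOn_Ioo_rpow_iff zero_lt_one).2 (by linarith)).const_mul _
  refine hdom.mono' hm.aestronglyMeasurable ?_
  refine (ae_restrict_mem measurableSet_Ioo).mono fun s ⟨hs0, hs1⟩ => ?_
  rw [norm_mul, ← norm_neg, Real.norm_of_nonneg (neg_nonneg.2 (kernelR_nonpos hs0)),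
    Real.norm_of_nonneg (by positivity), Real.rpow_add hs0, ← mul_assoc]
  gcongr
  exact neg_kernelR_le hs0 hs1

lemma integrable_kernelR : Integrable kernelR halfLine := by
  simpa using inversionSymmetric_kernelR.integrable_mul_rpow measurable_kernelR (c := 1)
    (integrableOn_kernelR_mul_rpow (by norm_num)) (integrableOn_kernelR_mul_rpow (by norm_num))

lemma integrable_kernelV : Integrable kernelV halfLine := by
  simpa using integrable_kernelV_mul_rpow (c := 1) (by norm_num) (by norm_num)

lemma integrable_kernelS : Integrable kernelS halfLine := by
  refine (integrable_kernelV.sub integrable_kernelR).congr (ae_of_all _ fun s => ?_)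
  exact add_sub_cancel_left _ _

/-! ### Evaluation of `γ_N` -/

section Antiderivatives

variable {F f : ℝ → ℝ} {a b l : ℝ}

lemma lintegral_Ioo_of_hasDerivAt (hab : a ≤ b) (hcont : ContinuousOn F (Icc a b))
    (hderiv : ∀ x ∈ Ioo a b, HasDerivAt F (f x) x) (hf : ∀ x ∈ Ioo a b, 0 ≤ f x) :
    ∫⁻ x in Ioo a b, ENNReal.ofReal (f x) = ENNReal.ofReal (F b - F a) := by
  have hint : IntegrableOn f (Ioc a b) :=
    intervalIntegral.integrableOn_deriv_of_nonneg hcont hderiv hf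
  rw [← intervalIntegral.integral_eq_sub_of_hasDerivAt_of_le hab hcont hderiv
      ((intervalIntegrable_iff_integrableOn_Ioc_of_le hab).2 hint),
    intervalIntegral.integral_of_le hab, integral_Ioc_eq_integral_Ioo,
    ofReal_integral_eq_lintegral_ofReal (hint.mono_set Ioo_subset_Ioc_self)]
  exact (ae_restrict_mem measurableSet_Ioo).mono hf

lemma lintegral_Ioi_of_hasDerivAt (hcont : ContinuousWithinAt F (Ici a) a)
    (hderiv : ∀ x ∈ Ioi a, HasDerivAt F (f x) x) (hf : ∀ x ∈ Ioi a, 0 ≤ f x)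
    (hl : Tendsto F atTop (𝓝 l)) :
    ∫⁻ x in Ioi a, ENNReal.ofReal (f x) = ENNReal.ofReal (l - F a) := by
  rw [← integral_Ioi_of_hasDerivAt_of_nonneg hcont hderiv hf hl,
    ofReal_integral_eq_lintegral_ofReal (integrableOn_Ioi_deriv_of_nonneg hcont hderiv hf hl)]
  exact (ae_restrict_mem measurableSet_Ioi).mono hf

end Antiderivatives

section ElementaryDerivatives

variable {x c k : ℝ}

lemma hasDerivAt_artanh (hx : x ∈ Ioo (-1 : ℝ) 1) :
    HasDerivAt Real.artanh (1 / (1 - x ^ 2)) x := by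
  have hplus : 1 + x ≠ 0 := by linarith [hx.1]
  have hminus : 1 - x ≠ 0 := by linarith [hx.2]
  have hlog : HasDerivAt (fun x : ℝ => 1 / 2 * (Real.log (1 + x) - Real.log (1 - x)))
      (1 / 2 * (1 / (1 + x) - -1 / (1 - x))) x :=
    ((((hasDerivAt_id x).const_add 1).log hplus).sub
      (((hasDerivAt_id x).const_sub 1).log hminus)).const_mul _
  refine (hlog.congr_of_eventuallyEq ?_).congr_deriv ?_
  · filter_upwards [isOpen_Ioo.mem_nhds hx] with y hy
    rw [Real.artanh_eq_half_log ⟨hy.1.le, hy.2.le⟩,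
      Real.log_div (by linarith [hy.1]) (by linarith [hy.2])]
  · rw [show 1 - x ^ 2 = (1 + x) * (1 - x) by ring]
    field_simp
    ring

lemma hasDerivAt_artanh_div (hx : 0 ≤ x) (hxc : x < c) :
    HasDerivAt (fun x => 1 / c * Real.artanh (x / c)) (1 / (c ^ 2 - x ^ 2)) x := by
  have hc : 0 < c := by linarith
  have hxc1 : x / c < 1 := (div_lt_one hc).2 hxc
  have hxc0 : 0 ≤ x / c := by positivity
  have hpos : 0 < c ^ 2 - x ^ 2 := by nlinarith
  refine HasDerivAt.congr_deriv (((hasDerivAt_artanh ⟨by linarith, hxc1⟩).comp x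
    ((hasDerivAt_id x).div_const c)).const_mul (1 / c)) ?_
  have hdiv : 1 - (x / c) ^ 2 = (c ^ 2 - x ^ 2) / c ^ 2 := by field_simp
  simp only [hdiv]
  field_simp

lemma hasDerivAt_sqrt_sq_add (h : 0 < x ^ 2 + k) :
    HasDerivAt (fun x : ℝ => √(x ^ 2 + k)) (x / √(x ^ 2 + k)) x := by
  refine HasDerivAt.congr_deriv (((hasDerivAt_pow 2 x).add_const k).sqrt h.ne') ?_
  push_cast
  ring

lemma hasDerivAt_sqrt_sub_sq (h : 0 < k - x ^ 2) :
    HasDerivAt (fun x : ℝ => √(k - x ^ 2)) (-x / √(k - x ^ 2)) x := by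
  refine HasDerivAt.congr_deriv (((hasDerivAt_pow 2 x).const_sub k).sqrt h.ne') ?_
  push_cast
  ring

lemma hasDerivAt_log_sub_half_log (hx : x ≠ 0) (hk : k ≠ 0) (h : x ^ 2 + k ≠ 0) :
    HasDerivAt (fun x => 1 / k * (Real.log x - 1 / 2 * Real.log (x ^ 2 + k)))
      (1 / (x * (x ^ 2 + k))) x := by
  refine HasDerivAt.congr_deriv (((Real.hasDerivAt_log hx).sub
    ((((hasDerivAt_pow 2 x).add_const k).log h).const_mul (1 / 2))).const_mul (1 / k)) ?_
  field_simp
  ring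

lemma tendsto_log_sub_half_log (k : ℝ) :
    Tendsto (fun x : ℝ => 1 / k * (Real.log x - 1 / 2 * Real.log (x ^ 2 + k))) atTop (𝓝 0) := by
  have hratio : Tendsto (fun x : ℝ => 1 + k / x ^ 2) atTop (𝓝 (1 + 0)) :=
    tendsto_const_nhds.add (tendsto_const_nhds.div_atTop (tendsto_pow_atTop two_ne_zero))
  have hlog := ((hratio.log (by norm_num)).const_mul (-(1 / 2))).const_mul (1 / k)
  simp only [add_zero, Real.log_one, mul_zero] at hlog
  refine hlog.congr' ?_
  filter_upwards [eventually_gt_atTop 0, eventually_gt_atTop (|k| + 1)] with x hx hxk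
  have hpos : 0 < x ^ 2 + k := by nlinarith [neg_abs_le k, abs_nonneg k]
  have hsplit : 1 + k / x ^ 2 = (x ^ 2 + k) / x ^ 2 := by field_simp
  rw [hsplit, Real.log_div hpos.ne' (by positivity), Real.log_pow]
  push_cast
  ring

end ElementaryDerivatives

section GammaIntegrand

/-- The absolute value of the integrand of `γ_N`, as a function of `x = p₃` and `y = p₄`. -/
def gammaIntegrand (x y : ℝ) : ℝ :=
  min 1 (min (pTwo x y) (min x y)) / (pTwo x y ^ 2 * (x * y))

variable {x y : ℝ}

lemma measurable_gammaIntegrand : Measurable (Function.uncurry gammaIntegrand) := by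
  unfold gammaIntegrand Function.uncurry pTwo
  fun_prop

lemma gammaIntegrand_nonneg (hx : 0 ≤ x) (hy : 0 ≤ y) : 0 ≤ gammaIntegrand x y := by
  have hp : 0 ≤ pTwo x y := Real.sqrt_nonneg _
  unfold gammaIntegrand
  positivity

lemma pTwo_eq_sqrt_sq_add (x y : ℝ) : pTwo x y = √(y ^ 2 + (x ^ 2 - 1)) := by
  rw [pTwo]
  ring_nf

lemma gammaIntegrand_of_le_one (hx : 0 < x) (hx1 : x ≤ 1) (hy : 0 < y) (hy1 : y ≤ 1)
    (hxy : 0 < y ^ 2 + (x ^ 2 - 1)) :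
    gammaIntegrand x y = 1 / (x * (√(y ^ 2 + (x ^ 2 - 1)) * y)) := by
  have hpos : 0 < √(y ^ 2 + (x ^ 2 - 1)) := by positivity
  have hpx : √(y ^ 2 + (x ^ 2 - 1)) ≤ x := (Real.sqrt_le_left hx.le).2 (by nlinarith)
  have hpy : √(y ^ 2 + (x ^ 2 - 1)) ≤ y := (Real.sqrt_le_left hy.le).2 (by nlinarith)
  rw [gammaIntegrand, pTwo_eq_sqrt_sq_add, min_eq_left (le_min hpx hpy),
    min_eq_right (hpx.trans hx1)]
  field_simp [hpos.ne']

lemma gammaIntegrand_of_le_one_of_one_le (hx : 0 < x) (hx1 : x ≤ 1) (hy1 : 1 ≤ y) :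
    gammaIntegrand x y = 1 / (y * (y ^ 2 + (x ^ 2 - 1))) := by
  have hpos : 0 < y ^ 2 + (x ^ 2 - 1) := by nlinarith
  have hxp : x ≤ √(y ^ 2 + (x ^ 2 - 1)) := Real.le_sqrt_of_sq_le (by nlinarith)
  rw [gammaIntegrand, pTwo_eq_sqrt_sq_add, Real.sq_sqrt hpos.le, min_eq_left (hx1.trans hy1),
    min_eq_right hxp, min_eq_right hx1]
  field_simp

lemma lintegral_gammaIntegrand_Ioo_one (hx : 0 < x) (hx1 : x < 1) :
    ∫⁻ y in Ioo √(1 - x ^ 2) 1, ENNReal.ofReal (gammaIntegrand x y)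
      = ENNReal.ofReal (1 / (x * √(1 - x ^ 2)) * Real.arctan (x / √(1 - x ^ 2))) := by
  set d := √(1 - x ^ 2) with hd
  have hd0 : 0 < d := Real.sqrt_pos.2 (by nlinarith)
  have hd2 : x ^ 2 - 1 = -d ^ 2 := by rw [hd, Real.sq_sqrt (by nlinarith)]; ring
  have hd1 : d < 1 := by nlinarith
  have hderiv : ∀ y ∈ Ioo d 1, HasDerivAt
      (fun y => 1 / (x * d) * Real.arctan (√(y ^ 2 + -d ^ 2) / d)) (gammaIntegrand x y) y := by
    rintro y ⟨hdy, hy1⟩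
    have hy : 0 < y := hd0.trans hdy
    have hpos : 0 < y ^ 2 + -d ^ 2 := by nlinarith
    have hsqrt : 0 < √(y ^ 2 + -d ^ 2) := by positivity
    refine HasDerivAt.congr_deriv
      ((((hasDerivAt_sqrt_sq_add hpos).div_const d).arctan).const_mul (1 / (x * d))) ?_
    have hsec : 1 + (√(y ^ 2 + -d ^ 2) / d) ^ 2 = y ^ 2 / d ^ 2 := by
      rw [div_pow, Real.sq_sqrt hpos.le]
      field_simp
      ring
    rw [gammaIntegrand_of_le_one hx hx1.le hy hy1.le (by rwa [hd2]), hsec, hd2]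
    field_simp [hsqrt.ne']
  have hsqrt_one : √(1 ^ 2 + -d ^ 2) = x := by
    rw [← hd2, one_pow, add_sub_cancel, Real.sqrt_sq hx.le]
  rw [lintegral_Ioo_of_hasDerivAt hd1.le (Continuous.continuousOn (by fun_prop)) hderiv
    fun y hy => gammaIntegrand_nonneg hx.le (hd0.trans hy.1).le, hsqrt_one, add_neg_cancel,
    Real.sqrt_zero, zero_div, Real.arctan_zero, mul_zero, sub_zero]

lemma lintegral_gammaIntegrand_Ioi_one (hx : 0 < x) (hx1 : x < 1) :
    ∫⁻ y in Ioi 1, ENNReal.ofReal (gammaIntegrand x y)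
      = ENNReal.ofReal (-Real.log x / (1 - x ^ 2)) := by
  have hk : x ^ 2 - 1 ≠ 0 := by nlinarith
  have hpos : ∀ y : ℝ, 1 ≤ y → 0 < y ^ 2 + (x ^ 2 - 1) := fun y hy => by nlinarith
  rw [lintegral_Ioi_of_hasDerivAt
    (hasDerivAt_log_sub_half_log one_ne_zero hk
      (hpos 1 le_rfl).ne').continuousAt.continuousWithinAt
    (fun y (hy : 1 < y) => ?_) (fun y (hy : 1 < y) => gammaIntegrand_nonneg hx.le (by linarith))
    (tendsto_log_sub_half_log (x ^ 2 - 1))]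
  · have hk' : 1 - x ^ 2 ≠ 0 := by nlinarith
    rw [Real.log_one, one_pow, add_sub_cancel, Real.log_pow]
    congr 1
    push_cast
    field_simp
    ring
  · rw [gammaIntegrand_of_le_one_of_one_le hx hx1.le hy.le]
    exact hasDerivAt_log_sub_half_log (by linarith) hk (hpos y hy.le).ne'

lemma lintegral_gammaIntegrand_of_lt_one (hx : 0 < x) (hx1 : x < 1) :
    ∫⁻ y in Ioi √(1 - x ^ 2), ENNReal.ofReal (gammaIntegrand x y)
      = ENNReal.ofReal (kernelS x / 2) := by
  have hd1 : √(1 - x ^ 2) ≤ 1 := Real.sqrt_le_one.2 (by nlinarith)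
  have hpos : 0 ≤ 1 - x ^ 2 := by nlinarith
  have hlog : Real.log x ≤ 0 := Real.log_nonpos hx.le hx1.le
  rw [setLIntegral_Ioi_eq_add hd1, lintegral_gammaIntegrand_Ioo_one hx hx1,
    lintegral_gammaIntegrand_Ioi_one hx hx1, ← ENNReal.ofReal_add
      (mul_nonneg (by positivity) (Real.arctan_nonneg.2 (by positivity)))
      (div_nonneg (by linarith) hpos), kernelS, if_pos hx1]
  congr 1
  ring

/-- The integrand of `γ_N` as a function of `x = p₃` and `s = p₂` instead of `p₃` and `p₄`; the
Jacobian `dp₄ = (p₂ / p₄) dp₂` is included. -/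
def gammaIntegrandTwo (x s : ℝ) : ℝ :=
  min 1 (min s (min x √(1 + s ^ 2 - x ^ 2))) / (s * (x * (1 + s ^ 2 - x ^ 2)))

lemma measurable_gammaIntegrandTwo : Measurable (Function.uncurry gammaIntegrandTwo) := by
  unfold gammaIntegrandTwo Function.uncurry
  fun_prop

lemma sqrt_neg_lt_iff {k s : ℝ} : √(-k) < s ↔ 0 < s ∧ 0 < s ^ 2 + k := by
  refine ⟨fun h => ?_, fun ⟨hs, h⟩ => (Real.sqrt_lt' hs).2 (neg_lt_iff_pos_add.2 h)⟩
  have hs : 0 < s := (Real.sqrt_nonneg _).trans_lt h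
  exact ⟨hs, by linarith [(Real.sqrt_lt' hs).1 h]⟩

lemma sqrt_sq_add_add_neg {k s : ℝ} (hs : √(-k) < s) : √(√(s ^ 2 + k) ^ 2 + -k) = s := by
  obtain ⟨hs0, hpos⟩ := sqrt_neg_lt_iff.1 hs
  rw [Real.sq_sqrt hpos.le, add_neg_cancel_right, Real.sqrt_sq hs0.le]

lemma image_sqrt_sq_add_Ioi (k : ℝ) :
    (fun s : ℝ => √(s ^ 2 + k)) '' Ioi √(-k) = Ioi √k := by
  have hmaps : ∀ k s : ℝ, √(-k) < s → √k < √(s ^ 2 + k) := fun k s hs => by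
    obtain ⟨hs0, hpos⟩ := sqrt_neg_lt_iff.1 hs
    exact (Real.sqrt_lt_sqrt_iff_of_pos hpos).2 (by nlinarith)
  refine Subset.antisymm (image_subset_iff.2 fun s hs => hmaps k s hs) fun y (hy : √k < y) => ?_
  rw [← neg_neg k] at hy
  exact ⟨√(y ^ 2 + -k), hmaps (-k) y hy, by simpa using sqrt_sq_add_add_neg hy⟩

lemma lintegral_gammaIntegrand_eq_gammaIntegrandTwo (hx : 0 < x) :
    ∫⁻ y in Ioi √(1 - x ^ 2), ENNReal.ofReal (gammaIntegrand x y)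
      = ∫⁻ s in Ioi √(x ^ 2 - 1), ENNReal.ofReal (gammaIntegrandTwo x s) := by
  have hk : x ^ 2 - 1 = -(1 - x ^ 2) := (neg_sub _ _).symm
  rw [hk, ← image_sqrt_sq_add_Ioi, lintegral_image_eq_lintegral_abs_deriv_mul measurableSet_Ioi
    (fun s hs => (hasDerivAt_sqrt_sq_add (sqrt_neg_lt_iff.1 hs).2).hasDerivWithinAt)
    (LeftInvOn.injOn (f₁' := fun y => √(y ^ 2 + -(1 - x ^ 2))) fun s hs =>
      sqrt_sq_add_add_neg hs)]
  refine setLIntegral_congr_fun measurableSet_Ioi fun s hs => ?_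
  obtain ⟨hs0, hpos⟩ := sqrt_neg_lt_iff.1 hs
  have hp : pTwo x √(s ^ 2 + (1 - x ^ 2)) = s := by
    rw [pTwo_eq_sqrt_sq_add, hk, sqrt_sq_add_add_neg hs]
  have hsqrt : 0 < √(s ^ 2 + (1 - x ^ 2)) := by positivity
  have hsq := Real.sq_sqrt hpos.le
  rw [abs_of_nonneg (by positivity), ← ENNReal.ofReal_mul (by positivity), gammaIntegrand, hp,
    gammaIntegrandTwo, show 1 + s ^ 2 - x ^ 2 = s ^ 2 + (1 - x ^ 2) by ring]
  congr 1
  nth_rw 5 [← hsq]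
  field_simp [hsqrt.ne']

-- Dilation by `1 / x` maps the momenta `(1, p₂, x, p₄)` to `(1 / x, p₂ / x, 1, p₄ / x)`, which
-- exchanges the roles of the incoming and the outgoing pair.
lemma gammaIntegrandTwo_mul_self (hx : 0 < x) (hy : √(1 - x⁻¹ ^ 2) < y) :
    x * gammaIntegrandTwo x (x * y) = x ^ (-3 : ℝ) * gammaIntegrand x⁻¹ y := by
  obtain ⟨hy0, hpos⟩ := sqrt_neg_lt_iff (k := x⁻¹ ^ 2 - 1).1 (by rwa [neg_sub])
  have hp : 0 < √(y ^ 2 + (x⁻¹ ^ 2 - 1)) := by positivity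
  have hscale : 1 + (x * y) ^ 2 - x ^ 2 = x ^ 2 * (y ^ 2 + (x⁻¹ ^ 2 - 1)) := by
    field_simp
    ring
  have hmin : min 1 (min (x * y) (min x (x * √(y ^ 2 + (x⁻¹ ^ 2 - 1)))))
      = x * min 1 (min √(y ^ 2 + (x⁻¹ ^ 2 - 1)) (min x⁻¹ y)) := by
    rw [mul_min_of_nonneg _ _ hx.le, mul_min_of_nonneg _ _ hx.le, mul_min_of_nonneg _ _ hx.le,
      mul_inv_cancel₀ hx.ne', mul_one]
    ac_rfl
  rw [gammaIntegrandTwo, hscale, Real.sqrt_mul (sq_nonneg x), Real.sqrt_sq hx.le, hmin,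
    gammaIntegrand, pTwo_eq_sqrt_sq_add, Real.sq_sqrt hpos.le, Real.rpow_neg hx.le,
    Real.rpow_ofNat]
  field_simp [hp.ne']

lemma lintegral_gammaIntegrand_inv (hx : 0 < x) :
    ∫⁻ y in Ioi √(1 - x ^ 2), ENNReal.ofReal (gammaIntegrand x y)
      = ENNReal.ofReal (x ^ (-3 : ℝ)) *
        ∫⁻ y in Ioi √(1 - x⁻¹ ^ 2), ENNReal.ofReal (gammaIntegrand x⁻¹ y) := by
  have himage : Ioi √(x ^ 2 - 1) = (fun y => x * y) '' Ioi √(1 - x⁻¹ ^ 2) := by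
    rw [image_mul_left_Ioi hx]
    nth_rw 2 [← Real.sqrt_sq hx.le]
    rw [← Real.sqrt_mul (sq_nonneg x), mul_sub, mul_one, inv_pow, mul_inv_cancel₀ (by positivity)]
  rw [lintegral_gammaIntegrand_eq_gammaIntegrandTwo hx, himage,
    lintegral_image_eq_lintegral_abs_deriv_mul measurableSet_Ioi
      (fun y _ => (hasDerivAt_const_mul x).hasDerivWithinAt) (mul_right_injective₀ hx.ne').injOn,
    ← lintegral_const_mul' _ _ ENNReal.ofReal_ne_top]
  refine setLIntegral_congr_fun measurableSet_Ioi fun y hy => ?_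
  rw [abs_of_pos hx, ← ENNReal.ofReal_mul hx.le, ← ENNReal.ofReal_mul (by positivity),
    gammaIntegrandTwo_mul_self hx hy]

lemma lintegral_gammaIntegrand (hx : 0 < x) (hx1 : x ≠ 1) :
    ∫⁻ y in Ioi √(1 - x ^ 2), ENNReal.ofReal (gammaIntegrand x y)
      = ENNReal.ofReal (kernelS x / 2) := by
  rcases lt_or_gt_of_ne hx1 with hlt | hgt
  · exact lintegral_gammaIntegrand_of_lt_one hx hlt
  · rw [lintegral_gammaIntegrand_inv hx,
      lintegral_gammaIntegrand_of_lt_one (inv_pos.2 hx) (inv_lt_one_of_one_lt₀ hgt),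
      ← ENNReal.ofReal_mul (by positivity), inversionSymmetric_kernelS x hgt, mul_div_assoc]

end GammaIntegrand

section MinIntegral

variable {m M c : ℝ}

lemma lintegral_Ioo_inv_sq_sub_sq (hm : 0 ≤ m) (hmc : m < c) :
    ∫⁻ x in Ioo 0 m, ENNReal.ofReal (1 / (c ^ 2 - x ^ 2))
      = ENNReal.ofReal (1 / c * Real.artanh (m / c)) := by
  have hderiv : ∀ x ∈ Icc 0 m,
      HasDerivAt (fun x => 1 / c * Real.artanh (x / c)) (1 / (c ^ 2 - x ^ 2)) x :=
    fun x hx => hasDerivAt_artanh_div hx.1 (hx.2.trans_lt hmc)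
  rw [lintegral_Ioo_of_hasDerivAt hm (fun x hx => (hderiv x hx).continuousAt.continuousWithinAt)
    (fun x hx => hderiv x (Ioo_subset_Icc_self hx)) fun x hx => ?_, zero_div, Real.artanh_zero,
    mul_zero, sub_zero]
  have hpos : 0 < c ^ 2 - x ^ 2 := by nlinarith [hx.1, hx.2]
  positivity

lemma lintegral_Ioo_inv_mul_sq_sub_sq (hm : 0 < m) (hmM : m ≤ M) (hc : c ^ 2 = m ^ 2 + M ^ 2) :
    ∫⁻ x in Ioo m M, ENNReal.ofReal (1 / (x * (c ^ 2 - x ^ 2)))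
      = ENNReal.ofReal (2 / c ^ 2 * (Real.log M - Real.log m)) := by
  have hc0 : c ≠ 0 := by
    rintro rfl
    nlinarith [hm.trans_le hmM]
  have hpos : ∀ x ∈ Icc m M, 0 < c ^ 2 - x ^ 2 := fun x hx => by
    nlinarith [hx.1, hx.2, hm.trans_le hmM]
  have hderiv : ∀ x ∈ Icc m M, HasDerivAt
      (fun x => -(1 / -c ^ 2 * (Real.log x - 1 / 2 * Real.log (x ^ 2 + -c ^ 2))))
      (1 / (x * (c ^ 2 - x ^ 2))) x := fun x hx => by
    have hx0 : x ≠ 0 := (hm.trans_le hx.1).ne'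
    have hne : x ^ 2 + -c ^ 2 ≠ 0 := by linarith [hpos x hx]
    refine (hasDerivAt_log_sub_half_log hx0 (by simpa) hne).neg.congr_deriv ?_
    rw [← neg_sub (x ^ 2), mul_neg, div_neg, sub_eq_add_neg]
  rw [lintegral_Ioo_of_hasDerivAt hmM (fun x hx => (hderiv x hx).continuousAt.continuousWithinAt)
    (fun x hx => hderiv x (Ioo_subset_Icc_self hx)) fun x hx => ?_]
  · have hlogM : Real.log (M ^ 2 + -c ^ 2) = 2 * Real.log m := by
      rw [hc, neg_add, add_neg_cancel_comm_assoc, Real.log_neg_eq_log, Real.log_pow, Nat.cast_ofNat]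
    have hlogm : Real.log (m ^ 2 + -c ^ 2) = 2 * Real.log M := by
      rw [hc, neg_add, add_neg_cancel_left, Real.log_neg_eq_log, Real.log_pow, Nat.cast_ofNat]
    rw [hlogM, hlogm]
    congr 1
    field_simp
    ring
  · have hx0 : 0 < x := hm.trans hx.1
    have hsub := hpos x (Ioo_subset_Icc_self hx)
    positivity

lemma lintegral_Ioo_inv_mul_sqrt_sq_sub_sq (hM : 0 < M) (hMc : M < c) :
    ∫⁻ x in Ioo M c, ENNReal.ofReal (1 / (x * √(c ^ 2 - x ^ 2)))
      = ENNReal.ofReal (1 / c * Real.artanh (√(c ^ 2 - M ^ 2) / c)) := by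
  have hsqrt_lt : ∀ x, M ≤ x → √(c ^ 2 - x ^ 2) < c := fun x hx =>
    (Real.sqrt_lt' (hM.trans hMc)).2 (by nlinarith)
  have hartanh : ∀ x, M ≤ x → HasDerivAt (fun y => 1 / c * Real.artanh (y / c))
      (1 / (c ^ 2 - √(c ^ 2 - x ^ 2) ^ 2)) √(c ^ 2 - x ^ 2) := fun x hx =>
    hasDerivAt_artanh_div (Real.sqrt_nonneg _) (hsqrt_lt x hx)
  rw [lintegral_Ioo_of_hasDerivAt (F := fun x => -(1 / c * Real.artanh (√(c ^ 2 - x ^ 2) / c)))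
    hMc.le ?cont ?deriv fun x hx => ?nonneg, sub_self, Real.sqrt_zero, zero_div, Real.artanh_zero,
    mul_zero, neg_zero, zero_sub, neg_neg]
  case cont =>
    intro x hx
    have hsqrt : ContinuousAt (fun x => √(c ^ 2 - x ^ 2)) x := by fun_prop
    exact (ContinuousAt.comp (f := fun x => √(c ^ 2 - x ^ 2))
      (hartanh x hx.1).continuousAt hsqrt).neg.continuousWithinAt
  case deriv =>
    rintro x ⟨hMx, hxc⟩
    have hx0 : 0 < x := hM.trans hMx
    have hpos : 0 < c ^ 2 - x ^ 2 := by nlinarith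
    have hsqrt : 0 < √(c ^ 2 - x ^ 2) := by positivity
    refine (((hartanh x hMx.le).comp x (hasDerivAt_sqrt_sub_sq hpos)).neg).congr_deriv ?_
    rw [Real.sq_sqrt hpos.le, sub_sub_cancel]
    field_simp [hsqrt.ne']
  case nonneg =>
    have hx0 : 0 < x := hM.trans hx.1
    positivity

lemma lintegral_Ioo_min_div_of_le (hm : 0 < m) (hmM : m < M) (hmc : m < c)
    (hc2 : c ^ 2 = m ^ 2 + M ^ 2) :
    ∫⁻ x in Ioo 0 m, ENNReal.ofReal (min m (min x √(c ^ 2 - x ^ 2)) / (x * (c ^ 2 - x ^ 2)))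
      = ENNReal.ofReal (1 / c * Real.artanh (m / c)) := by
  rw [← lintegral_Ioo_inv_sq_sub_sq hm.le hmc]
  refine setLIntegral_congr_fun measurableSet_Ioo fun x ⟨hx0, hxm⟩ => ?_
  rw [min_eq_left (Real.le_sqrt_of_sq_le (by nlinarith)), min_eq_right hxm.le]
  congr 1
  field_simp

lemma lintegral_Ioo_min_div_of_le_of_le (hm : 0 < m) (hmM : m < M)
    (hc2 : c ^ 2 = m ^ 2 + M ^ 2) :
    ∫⁻ x in Ioo m M, ENNReal.ofReal (min m (min x √(c ^ 2 - x ^ 2)) / (x * (c ^ 2 - x ^ 2)))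
      = ENNReal.ofReal (m * (2 / c ^ 2 * (Real.log M - Real.log m))) := by
  rw [ENNReal.ofReal_mul hm.le, ← lintegral_Ioo_inv_mul_sq_sub_sq hm hmM.le hc2,
    ← lintegral_const_mul' _ _ ENNReal.ofReal_ne_top]
  refine setLIntegral_congr_fun measurableSet_Ioo fun x ⟨hmx, hxM⟩ => ?_
  rw [← ENNReal.ofReal_mul hm.le,
    min_eq_left (le_min hmx.le (Real.le_sqrt_of_sq_le (by nlinarith)))]
  congr 1
  ring

lemma lintegral_Ioo_min_div_of_ge (hm : 0 < m) (hmM : m < M) (hMc : M < c)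
    (hc2 : c ^ 2 = m ^ 2 + M ^ 2) :
    ∫⁻ x in Ioo M c, ENNReal.ofReal (min m (min x √(c ^ 2 - x ^ 2)) / (x * (c ^ 2 - x ^ 2)))
      = ENNReal.ofReal (1 / c * Real.artanh (m / c)) := by
  have hM : 0 < M := hm.trans hmM
  have hsqrtM : √(c ^ 2 - M ^ 2) = m := by rw [hc2, add_sub_cancel_right, Real.sqrt_sq hm.le]
  nth_rw 2 [← hsqrtM]
  rw [← lintegral_Ioo_inv_mul_sqrt_sq_sub_sq hM hMc]
  refine setLIntegral_congr_fun measurableSet_Ioo fun x ⟨hMx, hxc⟩ => ?_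
  have hx0 : 0 < x := hM.trans hMx
  have hpos : 0 < c ^ 2 - x ^ 2 := by nlinarith
  have hroot : 0 < √(c ^ 2 - x ^ 2) := Real.sqrt_pos.2 hpos
  have hroot_le : √(c ^ 2 - x ^ 2) ≤ m := (Real.sqrt_le_left hm.le).2 (by nlinarith)
  rw [min_eq_right (by linarith : √(c ^ 2 - x ^ 2) ≤ x), min_eq_right hroot_le]
  congr 1
  nth_rw 2 [← Real.sq_sqrt hpos.le]
  field_simp [hroot.ne']

lemma lintegral_min_div (hm : 0 < m) (hmM : m < M) (hc : 0 < c) (hc2 : c ^ 2 = m ^ 2 + M ^ 2) :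
    ∫⁻ x in Ioo 0 c, ENNReal.ofReal (min m (min x √(c ^ 2 - x ^ 2)) / (x * (c ^ 2 - x ^ 2)))
      = ENNReal.ofReal (2 / c * Real.artanh (m / c)
        + m * (2 / c ^ 2 * (Real.log M - Real.log m))) := by
  have hMc : M < c := by nlinarith
  have hartanh : 0 ≤ Real.artanh (m / c) := Real.artanh_nonneg (by positivity)
  have hlog : 0 ≤ Real.log M - Real.log m := sub_nonneg.2 (Real.log_le_log hm hmM.le)
  rw [setLIntegral_Ioo_eq_add hm.le (hmM.trans hMc), setLIntegral_Ioo_eq_add hmM.le hMc,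
    lintegral_Ioo_min_div_of_le hm hmM (hmM.trans hMc) hc2,
    lintegral_Ioo_min_div_of_le_of_le hm hmM hc2, lintegral_Ioo_min_div_of_ge hm hmM hMc hc2,
    ← ENNReal.ofReal_add (by positivity) (by positivity),
    ← ENNReal.ofReal_add (by positivity) (by positivity)]
  congr 1
  ring

lemma lintegral_gammaIntegrandTwo {s : ℝ} (hs : 0 < s) (hs1 : s ≠ 1) :
    ∫⁻ x in Ioo 0 √(1 + s ^ 2), ENNReal.ofReal (gammaIntegrandTwo x s)
      = ENNReal.ofReal (-kernelR s) := by
  have hc2 : √(1 + s ^ 2) ^ 2 = 1 + s ^ 2 := Real.sq_sqrt (by positivity)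
  have hfactor : ∀ x, ENNReal.ofReal (gammaIntegrandTwo x s) = ENNReal.ofReal s⁻¹ *
      ENNReal.ofReal (min (min 1 s) (min x √(√(1 + s ^ 2) ^ 2 - x ^ 2)) /
        (x * (√(1 + s ^ 2) ^ 2 - x ^ 2))) := fun x => by
    rw [← ENNReal.ofReal_mul (by positivity), hc2, gammaIntegrandTwo, ← min_assoc 1]
    rw [inv_mul_eq_div, div_div, mul_comm _ s]
  simp only [hfactor]
  rw [lintegral_const_mul' _ _ ENNReal.ofReal_ne_top]
  rcases lt_or_gt_of_ne hs1 with hlt | hgt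
  · rw [min_eq_right hlt.le,
      lintegral_min_div hs hlt (by positivity) (by rw [hc2, one_pow, add_comm]),
      ← ENNReal.ofReal_mul (by positivity), kernelR, if_pos hlt, hc2, Real.log_one]
    congr 1
    field_simp
    ring
  · rw [min_eq_left hgt.le, lintegral_min_div one_pos hgt (by positivity) (by rw [hc2, one_pow]),
      ← ENNReal.ofReal_mul (by positivity), kernelR, if_neg hgt.not_gt, hc2, Real.log_one]
    congr 1
    field_simp
    ring

end MinIntegral

section Tonelli

variable {α β : Type*} [MeasurableSpace α] [MeasurableSpace β] {μ : Measure α} {ν : Measure β}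
  [SFinite ν] {E : Set (α × β)} {f : α × β → ℝ≥0∞}

lemma setLIntegral_prod_eq_lintegral_preimage (hE : MeasurableSet E) (hf : Measurable f) :
    ∫⁻ z in E, f z ∂μ.prod ν = ∫⁻ x, ∫⁻ y in Prod.mk x ⁻¹' E, f (x, y) ∂ν ∂μ := by
  rw [← lintegral_indicator hE, lintegral_prod _ (hf.indicator hE).aemeasurable]
  exact lintegral_congr fun x => lintegral_indicator (measurable_prodMk_left hE) _

lemma setLIntegral_prod_eq_lintegral_preimage_symm [SFinite μ] (hE : MeasurableSet E)
    (hf : Measurable f) :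
    ∫⁻ z in E, f z ∂μ.prod ν = ∫⁻ y, ∫⁻ x in (·, y) ⁻¹' E, f (x, y) ∂μ ∂ν := by
  rw [← lintegral_indicator hE, lintegral_prod_symm' _ (hf.indicator hE)]
  exact lintegral_congr fun y => lintegral_indicator (measurable_prodMk_right hE) _

end Tonelli

lemma ae_halfLine_pos : ∀ᵐ x ∂halfLine, 0 < x := ae_restrict_mem measurableSet_Ioi

lemma ae_halfLine_ne (a : ℝ) : ∀ᵐ x ∂halfLine, x ≠ a :=
  ae_restrict_of_ae (Measure.ae_ne volume a)

instance : SFinite halfLine := inferInstanceAs (SFinite (volume.restrict (Ioi 0)))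

lemma halfLine_restrict_Ioi {a : ℝ} (ha : 0 ≤ a) :
    halfLine.restrict (Ioi a) = volume.restrict (Ioi a) :=
  Measure.restrict_restrict_of_subset (Ioi_subset_Ioi ha)

/-- The domain of integration of `γ_N`. -/
def gammaDomain : Set (ℝ × ℝ) := {z | 0 < z.1 ∧ 0 < z.2 ∧ 1 < z.1 ^ 2 + z.2 ^ 2}

lemma measurableSet_gammaDomain : MeasurableSet gammaDomain := by
  unfold gammaDomain
  measurability

lemma volume_restrict_gammaDomain :
    volume.restrict gammaDomain
      = (halfLine.prod halfLine).restrict {z | √(1 - z.1 ^ 2) < z.2} := by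
  rw [halfLine, Measure.prod_restrict, Measure.restrict_restrict
    (measurableSet_lt (by fun_prop) (by fun_prop)), ← Measure.volume_eq_prod]
  congr 1
  ext ⟨x, y⟩
  have hiff := sqrt_neg_lt_iff (k := x ^ 2 - 1) (s := y)
  rw [neg_sub] at hiff
  simp only [gammaDomain, mem_inter_iff, mem_ofPred_eq, mem_prod, mem_Ioi, hiff]
  grind

lemma lintegral_gammaDomain :
    ∫⁻ z in gammaDomain, ENNReal.ofReal (gammaIntegrand z.1 z.2)
      = ∫⁻ x, (∫⁻ y in Ioi √(1 - x ^ 2), ENNReal.ofReal (gammaIntegrand x y)) ∂halfLine := by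
  have hE : MeasurableSet {z : ℝ × ℝ | √(1 - z.1 ^ 2) < z.2} :=
    measurableSet_lt (by fun_prop) (by fun_prop)
  simp only [volume_restrict_gammaDomain, ← halfLine_restrict_Ioi (Real.sqrt_nonneg _)]
  exact setLIntegral_prod_eq_lintegral_preimage hE measurable_gammaIntegrand.ennreal_ofReal

lemma lintegral_gammaDomain_eq_kernelS :
    ∫⁻ z in gammaDomain, ENNReal.ofReal (gammaIntegrand z.1 z.2)
      = ∫⁻ x, ENNReal.ofReal (kernelS x / 2) ∂halfLine := by
  rw [lintegral_gammaDomain]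
  refine lintegral_congr_ae ?_
  filter_upwards [ae_halfLine_pos, ae_halfLine_ne 1] with x hx hx1
  exact lintegral_gammaIntegrand hx hx1

lemma lintegral_gammaDomain_eq_kernelR :
    ∫⁻ z in gammaDomain, ENNReal.ofReal (gammaIntegrand z.1 z.2)
      = ∫⁻ s, ENNReal.ofReal (-kernelR s) ∂halfLine := by
  have hE : MeasurableSet {z : ℝ × ℝ | √(z.1 ^ 2 - 1) < z.2} :=
    measurableSet_lt (by fun_prop) (by fun_prop)
  have hf := measurable_gammaIntegrandTwo.ennreal_ofReal
  calc ∫⁻ z in gammaDomain, ENNReal.ofReal (gammaIntegrand z.1 z.2)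
      = ∫⁻ x, (∫⁻ s in Ioi √(x ^ 2 - 1), ENNReal.ofReal (gammaIntegrandTwo x s)) ∂halfLine := by
        rw [lintegral_gammaDomain]
        refine lintegral_congr_ae (ae_halfLine_pos.mono fun x hx => ?_)
        exact lintegral_gammaIntegrand_eq_gammaIntegrandTwo hx
    _ = ∫⁻ x, (∫⁻ s in Ioi √(x ^ 2 - 1),
          ENNReal.ofReal (gammaIntegrandTwo x s) ∂halfLine) ∂halfLine := by
        simp only [halfLine_restrict_Ioi (Real.sqrt_nonneg _)]
    _ = ∫⁻ s, (∫⁻ x in {x | √(x ^ 2 - 1) < s},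
          ENNReal.ofReal (gammaIntegrandTwo x s) ∂halfLine) ∂halfLine :=
        (setLIntegral_prod_eq_lintegral_preimage hE hf).symm.trans
          (setLIntegral_prod_eq_lintegral_preimage_symm hE hf)
    _ = ∫⁻ s, ENNReal.ofReal (-kernelR s) ∂halfLine := by
        refine lintegral_congr_ae ?_
        filter_upwards [ae_halfLine_pos, ae_halfLine_ne 1] with s hs hs1
        rw [← lintegral_gammaIntegrandTwo hs hs1, halfLine, Measure.restrict_restrict
          (measurableSet_lt (by fun_prop) measurable_const)]
        congr 2
        ext x
        simp only [mem_inter_iff, mem_ofPred_eq, mem_Ioi, mem_Ioo, Real.sqrt_lt' hs,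
          sub_lt_iff_lt_add']
        rw [and_comm]
        exact and_congr_right fun hx => (Real.lt_sqrt hx.le).symm

lemma gammaN_eq_neg_toReal :
    gammaN = -(∫⁻ z in gammaDomain, ENNReal.ofReal (gammaIntegrand z.1 z.2)).toReal := by
  rw [← integral_toReal
    (by simpa only using! measurable_gammaIntegrand.ennreal_ofReal.aemeasurable)
    (ae_of_all _ fun _ => ENNReal.ofReal_lt_top), gammaN, ← integral_neg]
  refine setIntegral_congr_fun measurableSet_gammaDomain fun ⟨x, y⟩ ⟨hx, hy, hxy⟩ => ?_
  have hpos : 0 < x ^ 2 + y ^ 2 - 1 := by linarith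
  have hp : 0 < pTwo x y := Real.sqrt_pos.2 hpos
  have hsq : pTwo x y ^ 2 = x ^ 2 + y ^ 2 - 1 := Real.sq_sqrt hpos.le
  have hn0 : n0 x * n0 y - n0 (pTwo x y) * n0 x - n0 (pTwo x y) * n0 y
      = -1 / (pTwo x y ^ 2 * x ^ 2 * y ^ 2) := by
    simp only [n0]
    field_simp
    rw [hsq]
    ring
  have hnonneg : 0 ≤ gammaIntegrand x y := gammaIntegrand_nonneg hx.le hy.le
  simp only [ENNReal.toReal_ofReal hnonneg]
  simp only [hn0, gammaIntegrand]
  field_simp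

lemma kernelS_nonneg {x : ℝ} (hx : 0 < x) (hx1 : x ≠ 1) : 0 ≤ kernelS x := by
  have hV := kernelV_pos hx hx1
  have hR := kernelR_nonpos hx
  unfold kernelV at hV
  linarith

-- Equivalently, the equation conserves the wave action.
lemma gammaN_eq_neg_integral_kernelV : gammaN = -∫ s, kernelV s ∂halfLine := by
  have hR : (∫⁻ z in gammaDomain, ENNReal.ofReal (gammaIntegrand z.1 z.2)).toReal
      = -∫ s, kernelR s ∂halfLine := by
    rw [lintegral_gammaDomain_eq_kernelR, ← integral_neg, integral_eq_lintegral_of_nonneg_ae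
      (ae_halfLine_pos.mono fun s hs => neg_nonneg.2 (kernelR_nonpos hs))
      measurable_kernelR.neg.aestronglyMeasurable]
  have hS : (∫⁻ z in gammaDomain, ENNReal.ofReal (gammaIntegrand z.1 z.2)).toReal
      = (∫ s, kernelS s ∂halfLine) / 2 := by
    rw [lintegral_gammaDomain_eq_kernelS, ← integral_div, integral_eq_lintegral_of_nonneg_ae ?_
      (measurable_kernelS.div_const 2).aestronglyMeasurable]
    filter_upwards [ae_halfLine_pos, ae_halfLine_ne 1] with s hs hs1
    exact div_nonneg (kernelS_nonneg hs hs1) two_pos.le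
  have hV : ∫ s, kernelV s ∂halfLine = ∫ s, kernelR s ∂halfLine + ∫ s, kernelS s ∂halfLine :=
    integral_add integrable_kernelR integrable_kernelS
  rw [gammaN_eq_neg_toReal]
  linarith

/-! ### Moments of the kernel -/

/-- The Mellin moment `∫₀^∞ 𝒱(s) s^(c-1) ds`. -/
def kernelMoment (c : ℝ) : ℝ := ∫ s, kernelV s * s ^ (c - 1) ∂halfLine

lemma ae_kernelV_pos : ∀ᵐ s ∂halfLine, 0 < kernelV s := by
  filter_upwards [ae_halfLine_pos, ae_halfLine_ne 1] with s hs hs1 using kernelV_pos hs hs1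

lemma ae_kernelV_mul_rpow_nonneg (c : ℝ) : ∀ᵐ s ∂halfLine, 0 ≤ kernelV s * s ^ (c - 1) := by
  filter_upwards [ae_halfLine_pos, ae_kernelV_pos] with s hs hV
  positivity

lemma kernelMoment_nonneg (c : ℝ) : 0 ≤ kernelMoment c :=
  integral_nonneg_of_ae (ae_kernelV_mul_rpow_nonneg c)

lemma lintegral_enorm_kernelV_mul_rpow {c : ℝ} (hc : -2 < c) (hc' : c < 5) :
    ∫⁻ s, ‖kernelV s * s ^ (c - 1)‖ₑ ∂halfLine = ENNReal.ofReal (kernelMoment c) := by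
  rw [kernelMoment, ofReal_integral_eq_lintegral_ofReal (integrable_kernelV_mul_rpow hc hc')
    (ae_kernelV_mul_rpow_nonneg c)]
  exact lintegral_congr_ae
    ((ae_kernelV_mul_rpow_nonneg c).mono fun s hs => Real.enorm_of_nonneg hs)

lemma kernelMoment_symm {c : ℝ} (hc : -2 < c) (hc' : c < 5) :
    kernelMoment (3 - c) = kernelMoment c := by
  rw [← ENNReal.ofReal_eq_ofReal_iff (kernelMoment_nonneg _) (kernelMoment_nonneg _),
    ← lintegral_enorm_kernelV_mul_rpow hc hc',
    ← lintegral_enorm_kernelV_mul_rpow (by linarith) (by linarith),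
    inversionSymmetric_kernelV.lintegral_halfLine, inversionSymmetric_kernelV.lintegral_halfLine,
    sub_sub_cancel, add_comm]

lemma gammaN_eq_neg_kernelMoment : gammaN = -kernelMoment 1 := by
  simp only [gammaN_eq_neg_integral_kernelV, kernelMoment, sub_self, Real.rpow_zero, mul_one]

lemma integral_halfLine_pos {f : ℝ → ℝ} (hint : Integrable f halfLine)
    (hf : ∀ᵐ s ∂halfLine, 0 < f s) : 0 < ∫ s, f s ∂halfLine := by
  have hsupp : Function.support f =ᵐ[halfLine] univ :=
    eventuallyEq_univ.2 (hf.mono fun _ hs => hs.ne')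
  rw [integral_pos_iff_support_of_nonneg_ae (hf.mono fun _ hs => hs.le) hint,
    measure_congr hsupp, halfLine, Measure.restrict_apply_univ, Real.volume_Ioi]
  exact ENNReal.zero_lt_top

lemma strictConvexOn_rpow_left {s : ℝ} (hs : 0 < s) (hs1 : s ≠ 1) :
    StrictConvexOn ℝ univ fun c : ℝ => s ^ c := by
  have hlog : Real.log s ≠ 0 := Real.log_ne_zero_of_pos_of_ne_one hs hs1
  refine ⟨convex_univ, fun x _ y _ hxy u v hu hv huv => ?_⟩
  simp only [Real.rpow_def_of_pos hs]
  convert strictConvexOn_exp.2 (mem_univ (Real.log s * x)) (mem_univ (Real.log s * y))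
    (mul_right_injective₀ hlog |>.ne hxy) hu hv huv using 2
  simp only [smul_eq_mul]
  ring

lemma strictConvexOn_kernelMoment : StrictConvexOn ℝ (Ioo (-2) 5) kernelMoment := by
  refine ⟨convex_Ioo _ _, fun x hx y hy hxy u v hu hv huv => ?_⟩
  have hz : u • x + v • y ∈ Ioo (-2 : ℝ) 5 := convex_Ioo _ _ hx hy hu.le hv.le huv
  have hix := (integrable_kernelV_mul_rpow hx.1 hx.2).const_mul u
  have hiy := (integrable_kernelV_mul_rpow hy.1 hy.2).const_mul v
  have hiz := integrable_kernelV_mul_rpow hz.1 hz.2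
  have hpos : 0 < ∫ s, (u * (kernelV s * s ^ (x - 1)) + v * (kernelV s * s ^ (y - 1))
      - kernelV s * s ^ (u • x + v • y - 1)) ∂halfLine := by
    refine integral_halfLine_pos ((hix.add hiy).sub hiz) ?_
    filter_upwards [ae_halfLine_pos, ae_halfLine_ne 1, ae_kernelV_pos] with s hs hs1 hV
    have hconv := (strictConvexOn_rpow_left hs hs1).2 (mem_univ (x - 1)) (mem_univ (y - 1))
      (sub_left_injective.ne hxy) hu hv huv
    have hexp : u • (x - 1) + v • (y - 1) = u • x + v • y - 1 := by
      simp only [smul_eq_mul]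
      linear_combination -huv
    rw [hexp] at hconv
    have hmul := mul_lt_mul_of_pos_left hconv hV
    simp only [smul_eq_mul] at hmul ⊢
    linarith
  rw [integral_sub (by exact hix.add hiy) hiz, integral_add hix hiy, integral_const_mul,
    integral_const_mul] at hpos
  exact sub_pos.1 hpos

lemma kernelMoment_one_lt_three : kernelMoment 1 < kernelMoment 3 := by
  have hsymm := kernelMoment_symm (c := 0) (by norm_num) (by norm_num)
  rw [sub_zero] at hsymm
  have hmem : (1 : ℝ) ∈ openSegment ℝ 0 3 := by
    rw [openSegment_eq_Ioo (by norm_num)]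
    norm_num
  simpa only [hsymm, max_self] using strictConvexOn_kernelMoment.lt_on_openSegment
    (x := 0) (y := 3) (by norm_num) (by norm_num) (by norm_num) hmem

lemma kernelMoment_three_halves_lt_one : kernelMoment (3 / 2) < kernelMoment 1 := by
  have hsymm := kernelMoment_symm (c := 1) (by norm_num) (by norm_num)
  have hmem : (3 / 2 : ℝ) ∈ openSegment ℝ 1 (3 - 1) := by
    rw [openSegment_eq_Ioo (by norm_num)]
    norm_num
  simpa only [hsymm, max_self] using strictConvexOn_kernelMoment.lt_on_openSegment
    (x := 1) (y := 3 - 1) (by norm_num) (by norm_num) (by norm_num) hmem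

lemma one_le_kernelMoment_zero : 1 ≤ kernelMoment 0 := by
  have hint := integrable_kernelV_mul_rpow (c := 0) (by norm_num) (by norm_num)
  have hsub : Ioo (0 : ℝ) 1 ⊆ Ioi 0 := Ioo_subset_Ioi_self
  calc (1 : ℝ) = ∫ s in Ioo (0 : ℝ) 1, 2 * s := by
        rw [← integral_Ioc_eq_integral_Ioo, ← intervalIntegral.integral_of_le zero_le_one,
          intervalIntegral.integral_const_mul, integral_id]
        norm_num
    _ ≤ ∫ s in Ioo 0 1, kernelV s * s ^ ((0 : ℝ) - 1) := by
        refine setIntegral_mono_on ?_ (IntegrableOn.mono_set hint hsub) measurableSet_Ioo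
          fun s hs => ?_
        · exact (Continuous.integrableOn_Icc (by fun_prop)).mono_set Ioo_subset_Icc_self
        · rw [zero_sub, Real.rpow_neg_one, ← div_eq_mul_inv, le_div_iff₀ hs.1, mul_assoc, ← sq]
          exact two_mul_sq_le_kernelV hs.1 hs.2
    _ ≤ kernelMoment 0 :=
        setIntegral_mono_set hint (ae_kernelV_mul_rpow_nonneg 0) hsub.eventuallyLE

/-! ### The integral operator -/

/-- The integral operator with kernel `|𝒱(p / q)| / q` on nonnegative extended functions. -/
def absOp (f : ℝ → ℝ≥0∞) (p : ℝ) : ℝ≥0∞ := ∫⁻ q, ‖kernelV (p / q) / q‖ₑ * f q ∂halfLine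

/-- The integral operator of the linearized equation. -/
def kernelOp (f : ℝ → ℝ) (p : ℝ) : ℝ := ∫ q, kernelV (p / q) * f q / q ∂halfLine

lemma measurable_kernelV_div : Measurable fun z : ℝ × ℝ => kernelV (z.1 / z.2) / z.2 :=
  (measurable_kernelV.comp (by fun_prop)).div (by fun_prop)

lemma ae_kernelV_div_pos {p : ℝ} (hp : 0 < p) : ∀ᵐ q ∂halfLine, 0 < kernelV (p / q) := by
  filter_upwards [ae_halfLine_pos, ae_halfLine_ne p] with q hq hqp
  exact kernelV_pos (div_pos hp hq) fun h => hqp ((div_eq_one_iff_eq hq.ne').1 h).symm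

lemma enorm_kernelV_div (f : ℝ → ℝ) (p q : ℝ) :
    ‖kernelV (p / q) * f q / q‖ₑ = ‖kernelV (p / q) / q‖ₑ * ‖f q‖ₑ := by
  rw [← enorm_mul, div_mul_eq_mul_div]

lemma enorm_kernelOp_le (f : ℝ → ℝ) (p : ℝ) : ‖kernelOp f p‖ₑ ≤ absOp (fun q => ‖f q‖ₑ) p :=
  (enorm_integral_le_lintegral_enorm _).trans_eq (lintegral_congr (enorm_kernelV_div f p))

lemma absOp_congr {f g : ℝ → ℝ≥0∞} (h : f =ᵐ[halfLine] g) : absOp f = absOp g := by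
  ext p
  refine lintegral_congr_ae ?_
  filter_upwards [h] with q hq
  rw [hq]

lemma kernelOp_congr {f g : ℝ → ℝ} (h : f =ᵐ[halfLine] g) : kernelOp f = kernelOp g := by
  ext p
  refine integral_congr_ae ?_
  filter_upwards [h] with q hq
  rw [hq]

lemma measurable_absOp {f : ℝ → ℝ≥0∞} (hf : AEMeasurable f halfLine) : Measurable (absOp f) := by
  rw [absOp_congr hf.ae_eq_mk]
  exact Measurable.lintegral_prod_right' (f := fun z => ‖kernelV (z.1 / z.2) / z.2‖ₑ * hf.mk f z.2)
    (measurable_kernelV_div.enorm.mul (hf.measurable_mk.comp measurable_snd))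

lemma stronglyMeasurable_kernelOp {f : ℝ → ℝ} (hf : AEStronglyMeasurable f halfLine) :
    StronglyMeasurable (kernelOp f) := by
  rw [kernelOp_congr hf.ae_eq_mk]
  refine StronglyMeasurable.integral_prod_right'
    (f := fun z : ℝ × ℝ => kernelV (z.1 / z.2) * hf.mk f z.2 / z.2) ?_
  have hV : Measurable fun z : ℝ × ℝ => kernelV (z.1 / z.2) := measurable_kernelV.comp (by fun_prop)
  have hmk : Measurable fun z : ℝ × ℝ => hf.mk f z.2 :=
    hf.stronglyMeasurable_mk.measurable.comp measurable_snd
  exact ((hV.mul hmk).div measurable_snd).stronglyMeasurable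

lemma aestronglyMeasurable_kernelV_div_mul {f : ℝ → ℝ} (hf : AEStronglyMeasurable f halfLine)
    (p : ℝ) : AEStronglyMeasurable (fun q => kernelV (p / q) * f q / q) halfLine := by
  have hV : Measurable fun q : ℝ => kernelV (p / q) := measurable_kernelV.comp (by fun_prop)
  exact (hV.aestronglyMeasurable.mul hf).div₀ measurable_id.aestronglyMeasurable

lemma integrable_kernelV_div_mul {f : ℝ → ℝ} (hf : AEStronglyMeasurable f halfLine) {p : ℝ}
    (h : absOp (fun q => ‖f q‖ₑ) p < ∞) :
    Integrable (fun q => kernelV (p / q) * f q / q) halfLine := by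
  refine ⟨aestronglyMeasurable_kernelV_div_mul hf p, ?_⟩
  simpa only [HasFiniteIntegral, enorm_kernelV_div] using! h

lemma kernelOp_nonneg {f : ℝ → ℝ} (hf : Nonneg f) {p : ℝ} (hp : 0 < p) : 0 ≤ kernelOp f p := by
  refine integral_nonneg_of_ae ?_
  filter_upwards [hf, ae_halfLine_pos, ae_kernelV_div_pos hp] with q hq hq0 hV
  exact div_nonneg (mul_nonneg hV.le hq) hq0.le

section Moments

variable {c : ℝ}

lemma enorm_mul_rpow {p : ℝ} (hp : 0 < p) (x c : ℝ) :
    ‖x * p ^ c‖ₑ = ‖x‖ₑ * ENNReal.ofReal (p ^ c) := by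
  rw [enorm_mul, Real.enorm_of_nonneg (Real.rpow_nonneg hp.le c)]

-- Powers are eigenfunctions because the kernel is homogeneous of degree zero.
lemma absOp_rpow {p r : ℝ} (hp : 0 < p) (hr : -5 < r) (hr' : r < 2) :
    absOp (fun q => ENNReal.ofReal (q ^ r)) p = ENNReal.ofReal (p ^ r * kernelMoment (-r)) := by
  calc absOp (fun q => ENNReal.ofReal (q ^ r)) p
      = ∫⁻ q, ENNReal.ofReal q⁻¹ * (ENNReal.ofReal (p ^ r) *
          ‖kernelV (p / q) * (p / q) ^ (-r)‖ₑ) ∂halfLine := by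
        refine lintegral_congr_ae (ae_halfLine_pos.mono fun q hq => ?_)
        have hq_rpow : q ^ r = p ^ r * (p / q) ^ (-r) := by
          rw [Real.div_rpow hp.le hq.le, Real.rpow_neg hp.le, Real.rpow_neg hq.le]
          field_simp
        simp only [enorm_mul_rpow (div_pos hp hq)]
        rw [hq_rpow, ENNReal.ofReal_mul (by positivity), div_eq_mul_inv (kernelV (p / q)),
          enorm_mul, Real.enorm_of_nonneg (inv_nonneg.2 hq.le)]
        ring
    _ = ∫⁻ s, ENNReal.ofReal s⁻¹ * (ENNReal.ofReal (p ^ r) *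
          ‖kernelV s * s ^ (-r)‖ₑ) ∂halfLine :=
        lintegral_halfLine_const_div hp fun s =>
          ENNReal.ofReal (p ^ r) * ‖kernelV s * s ^ (-r)‖ₑ
    _ = ∫⁻ s, ENNReal.ofReal (p ^ r) * ‖kernelV s * s ^ (-r - 1)‖ₑ ∂halfLine := by
        refine lintegral_congr_ae (ae_halfLine_pos.mono fun s hs => ?_)
        simp only [enorm_mul_rpow hs]
        rw [Real.rpow_sub_one hs.ne', div_eq_mul_inv, ENNReal.ofReal_mul (by positivity)]
        ring
    _ = ENNReal.ofReal (p ^ r * kernelMoment (-r)) := by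
        rw [lintegral_const_mul' _ _ ENNReal.ofReal_ne_top,
          lintegral_enorm_kernelV_mul_rpow (by linarith) (by linarith),
          ENNReal.ofReal_mul (by positivity)]

lemma lintegral_kernelV_div_mul_rpow {q : ℝ} (hq : 0 < q) (hc : -2 < c) (hc' : c < 5) :
    ∫⁻ p, ‖kernelV (p / q) / q‖ₑ * ENNReal.ofReal (p ^ (c - 1)) ∂halfLine
      = ENNReal.ofReal (kernelMoment c) * ENNReal.ofReal (q ^ (c - 1)) := by
  calc ∫⁻ p, ‖kernelV (p / q) / q‖ₑ * ENNReal.ofReal (p ^ (c - 1)) ∂halfLine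
      = ∫⁻ p, ‖kernelV (p / q) * (p / q) ^ (c - 1)‖ₑ * ENNReal.ofReal (q ^ (c - 1) * q⁻¹)
          ∂halfLine := by
        refine lintegral_congr_ae (ae_halfLine_pos.mono fun p hp => ?_)
        simp only [enorm_mul_rpow (div_pos hp hq)]
        rw [div_eq_mul_inv, enorm_mul, Real.enorm_of_nonneg (inv_nonneg.2 hq.le), mul_assoc,
          mul_assoc, ← ENNReal.ofReal_mul (by positivity), ← ENNReal.ofReal_mul (by positivity),
          Real.div_rpow hp.le hq.le]
        congr 2
        have hrpow : 0 < q ^ (c - 1) := by positivity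
        field_simp [hrpow.ne']
    _ = ENNReal.ofReal q *
          (ENNReal.ofReal (kernelMoment c) * ENNReal.ofReal (q ^ (c - 1) * q⁻¹)) := by
        rw [← lintegral_enorm_kernelV_mul_rpow hc hc',
          ← lintegral_mul_const' _ _ ENNReal.ofReal_ne_top]
        exact lintegral_halfLine_div hq fun s =>
          ‖kernelV s * s ^ (c - 1)‖ₑ * ENNReal.ofReal (q ^ (c - 1) * q⁻¹)
    _ = ENNReal.ofReal (kernelMoment c) * ENNReal.ofReal (q ^ (c - 1)) := by
        rw [mul_left_comm, ← ENNReal.ofReal_mul hq.le]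
        congr 2
        field_simp

lemma lintegral_absOp_mul_rpow {f : ℝ → ℝ≥0∞} (hf : AEMeasurable f halfLine) (hc : -2 < c)
    (hc' : c < 5) :
    ∫⁻ p, absOp f p * ENNReal.ofReal (p ^ (c - 1)) ∂halfLine
      = ENNReal.ofReal (kernelMoment c) * ∫⁻ q, f q * ENNReal.ofReal (q ^ (c - 1)) ∂halfLine := by
  have hm : AEMeasurable (Function.uncurry fun p q : ℝ =>
      ‖kernelV (p / q) / q‖ₑ * f q * ENNReal.ofReal (p ^ (c - 1))) (halfLine.prod halfLine) :=
    (measurable_kernelV_div.enorm.aemeasurable.mul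
      (hf.comp_quasiMeasurePreserving Measure.quasiMeasurePreserving_snd)).mul
      (Measurable.aemeasurable (by fun_prop))
  calc ∫⁻ p, absOp f p * ENNReal.ofReal (p ^ (c - 1)) ∂halfLine
      = ∫⁻ p, ∫⁻ q, ‖kernelV (p / q) / q‖ₑ * f q * ENNReal.ofReal (p ^ (c - 1)) ∂halfLine
          ∂halfLine :=
        lintegral_congr fun p => (lintegral_mul_const' _ _ ENNReal.ofReal_ne_top).symm
    _ = ∫⁻ q, ∫⁻ p, ‖kernelV (p / q) / q‖ₑ * f q * ENNReal.ofReal (p ^ (c - 1)) ∂halfLine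
          ∂halfLine := lintegral_lintegral_swap hm
    _ = ∫⁻ q, ENNReal.ofReal (kernelMoment c) * (f q * ENNReal.ofReal (q ^ (c - 1)))
          ∂halfLine := by
        refine lintegral_congr_ae (ae_halfLine_pos.mono fun q hq => ?_)
        have hmq : Measurable fun p : ℝ => ‖kernelV (p / q) / q‖ₑ * ENNReal.ofReal (p ^ (c - 1)) :=
          ((measurable_kernelV.comp (by fun_prop)).div_const q).enorm.mul (by fun_prop)
        simp only
        rw [mul_left_comm, ← lintegral_kernelV_div_mul_rpow hq hc hc', ← lintegral_const_mul _ hmq]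
        exact lintegral_congr fun p => by ring
    _ = ENNReal.ofReal (kernelMoment c) * ∫⁻ q, f q * ENNReal.ofReal (q ^ (c - 1)) ∂halfLine :=
        lintegral_const_mul' _ _ ENNReal.ofReal_ne_top

variable {f : ℝ → ℝ}

lemma integrable_mul_rpow_iff (hf : AEStronglyMeasurable f halfLine) (c : ℝ) :
    Integrable (fun p => f p * p ^ c) halfLine ↔
      ∫⁻ p, ‖f p‖ₑ * ENNReal.ofReal (p ^ c) ∂halfLine < ∞ := by
  have hm : AEStronglyMeasurable (fun p => f p * p ^ c) halfLine :=
    hf.mul (Measurable.aestronglyMeasurable (by fun_prop))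
  rw [← lintegral_congr_ae (ae_halfLine_pos.mono fun p hp => enorm_mul_rpow hp (f p) c)]
  exact ⟨fun h => h.2, fun h => ⟨hm, h⟩⟩

lemma integrable_kernelOp_mul_rpow (hf : AEStronglyMeasurable f halfLine) (hc : -2 < c)
    (hc' : c < 5) (hi : Integrable (fun p => f p * p ^ (c - 1)) halfLine) :
    Integrable (fun p => kernelOp f p * p ^ (c - 1)) halfLine := by
  rw [integrable_mul_rpow_iff (stronglyMeasurable_kernelOp hf).aestronglyMeasurable]
  rw [integrable_mul_rpow_iff hf] at hi
  calc ∫⁻ p, ‖kernelOp f p‖ₑ * ENNReal.ofReal (p ^ (c - 1)) ∂halfLine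
      ≤ ∫⁻ p, absOp (fun q => ‖f q‖ₑ) p * ENNReal.ofReal (p ^ (c - 1)) ∂halfLine :=
        lintegral_mono fun p => mul_le_mul_left (enorm_kernelOp_le f p) _
    _ < ∞ := by
        rw [lintegral_absOp_mul_rpow hf.enorm hc hc']
        exact ENNReal.mul_lt_top ENNReal.ofReal_lt_top hi

lemma integrable_prod_kernelV_div_mul_mul_rpow (hf : AEStronglyMeasurable f halfLine)
    (hc : -2 < c) (hc' : c < 5) (hi : Integrable (fun p => f p * p ^ (c - 1)) halfLine) :
    Integrable (Function.uncurry fun p q : ℝ => kernelV (p / q) / q * f q * p ^ (c - 1))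
      (halfLine.prod halfLine) := by
  have hm : AEStronglyMeasurable (Function.uncurry fun p q : ℝ =>
      kernelV (p / q) / q * f q * p ^ (c - 1)) (halfLine.prod halfLine) :=
    (measurable_kernelV_div.aestronglyMeasurable.mul
      (hf.comp_quasiMeasurePreserving Measure.quasiMeasurePreserving_snd)).mul
      (Measurable.aestronglyMeasurable (by fun_prop))
  have hiter : ∫⁻ p, ∫⁻ q, ‖kernelV (p / q) / q * f q * p ^ (c - 1)‖ₑ ∂halfLine ∂halfLine
      = ∫⁻ p, absOp (fun q => ‖f q‖ₑ) p * ENNReal.ofReal (p ^ (c - 1)) ∂halfLine := by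
    refine lintegral_congr_ae (ae_halfLine_pos.mono fun p hp => ?_)
    simp only [absOp, enorm_mul_rpow hp, enorm_mul]
    exact lintegral_mul_const' _ _ ENNReal.ofReal_ne_top
  refine ⟨hm, ?_⟩
  rw [HasFiniteIntegral, lintegral_prod _ hm.enorm]
  simp only [Function.uncurry]
  rw [hiter, lintegral_absOp_mul_rpow hf.enorm hc hc']
  exact ENNReal.mul_lt_top ENNReal.ofReal_lt_top ((integrable_mul_rpow_iff hf _).1 hi)

lemma integral_kernelV_div_mul_rpow {q : ℝ} (hq : 0 < q) (hc : -2 < c) (hc' : c < 5) :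
    ∫ p, kernelV (p / q) / q * p ^ (c - 1) ∂halfLine = kernelMoment c * q ^ (c - 1) := by
  have hnonneg : ∀ᵐ p ∂halfLine, 0 ≤ kernelV (p / q) / q * p ^ (c - 1) := by
    filter_upwards [ae_halfLine_pos, ae_halfLine_ne q] with p hp hpq
    have hV := kernelV_pos (div_pos hp hq) fun h => hpq ((div_eq_one_iff_eq hq.ne').1 h)
    positivity
  have hm : Measurable fun p : ℝ => kernelV (p / q) / q * p ^ (c - 1) :=
    ((measurable_kernelV.comp (by fun_prop)).div_const q).mul (by fun_prop)
  rw [integral_eq_lintegral_of_nonneg_ae hnonneg hm.aestronglyMeasurable,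
    ← ENNReal.toReal_ofReal (mul_nonneg (kernelMoment_nonneg c) (Real.rpow_nonneg hq.le _)),
    ENNReal.ofReal_mul (kernelMoment_nonneg c), ← lintegral_kernelV_div_mul_rpow hq hc hc']
  congr 1
  refine lintegral_congr_ae ?_
  filter_upwards [ae_halfLine_pos, hnonneg] with p hp hn
  rw [← Real.enorm_of_nonneg hn, enorm_mul_rpow hp]

lemma integral_kernelOp_mul_rpow (hf : AEStronglyMeasurable f halfLine) (hc : -2 < c)
    (hc' : c < 5) (hi : Integrable (fun p => f p * p ^ (c - 1)) halfLine) :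
    ∫ p, kernelOp f p * p ^ (c - 1) ∂halfLine
      = kernelMoment c * ∫ p, f p * p ^ (c - 1) ∂halfLine := by
  calc ∫ p, kernelOp f p * p ^ (c - 1) ∂halfLine
      = ∫ p, ∫ q, kernelV (p / q) / q * f q * p ^ (c - 1) ∂halfLine ∂halfLine := by
        simp only [kernelOp, ← integral_mul_const, div_mul_eq_mul_div]
    _ = ∫ q, ∫ p, kernelV (p / q) / q * f q * p ^ (c - 1) ∂halfLine ∂halfLine :=
        integral_integral_swap (integrable_prod_kernelV_div_mul_mul_rpow hf hc hc' hi)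
    _ = ∫ q, kernelMoment c * (f q * q ^ (c - 1)) ∂halfLine := by
        refine integral_congr_ae (ae_halfLine_pos.mono fun q hq => ?_)
        simp only
        rw [mul_left_comm, ← integral_kernelV_div_mul_rpow hq hc hc', ← integral_const_mul]
        exact integral_congr_ae (ae_of_all _ fun p => by ring)
    _ = kernelMoment c * ∫ p, f p * p ^ (c - 1) ∂halfLine := integral_const_mul _ _

end Moments

/-! ### Norms bounding the integral operator -/

/-- A function norm on `(0, ∞)` with the countable triangle inequality, for which the integral
operator `absOp` is bounded by `C`. This is all that the theory of the equation uses of the spaces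
`L^q_θ` and `𝒴_{a,b}`. -/
structure IsKernelBounded (Φ : (ℝ → ℝ≥0∞) → ℝ≥0∞) (C : ℝ) : Prop where
  nonneg : 0 ≤ C
  mono : ∀ {f g : ℝ → ℝ≥0∞}, f ≤ᵐ[halfLine] g → Φ f ≤ Φ g
  const_mul_le : ∀ (c : NNReal) (f : ℝ → ℝ≥0∞), Φ (fun p => c * f p) ≤ c * Φ f
  tsum_le : ∀ {ι : Type} [Countable ι] (f : ι → ℝ → ℝ≥0∞), (∀ i, AEMeasurable (f i) halfLine) →
    Φ (fun p => ∑' i, f i p) ≤ ∑' i, Φ (f i)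
  ae_eq_zero : ∀ {f : ℝ → ℝ≥0∞}, AEMeasurable f halfLine → Φ f = 0 → f =ᵐ[halfLine] 0
  absOp_le : ∀ {f : ℝ → ℝ≥0∞}, AEMeasurable f halfLine → Φ (absOp f) ≤ ENNReal.ofReal C * Φ f

/-- The norm of real valued functions induced by a norm of extended nonnegative functions. -/
def inducedNorm (Φ : (ℝ → ℝ≥0∞) → ℝ≥0∞) (f : ℝ → ℝ) : ℝ≥0∞ := Φ fun p => ‖f p‖ₑ

lemma inducedNorm_neg (Φ : (ℝ → ℝ≥0∞) → ℝ≥0∞) (f : ℝ → ℝ) :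
    inducedNorm Φ (-f) = inducedNorm Φ f := by
  simp only [inducedNorm, Pi.neg_apply, enorm_neg]

lemma kernelOp_sub {f g : ℝ → ℝ} {p : ℝ}
    (hf : Integrable (fun q => kernelV (p / q) * f q / q) halfLine)
    (hg : Integrable (fun q => kernelV (p / q) * g q / q) halfLine) :
    kernelOp (f - g) p = kernelOp f p - kernelOp g p := by
  simp only [kernelOp, Pi.sub_apply, mul_sub, sub_div]
  exact integral_sub hf hg

namespace IsKernelBounded

variable {Φ : (ℝ → ℝ≥0∞) → ℝ≥0∞} {C : ℝ} {f g : ℝ → ℝ}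

lemma add_le (h : IsKernelBounded Φ C) {u v : ℝ → ℝ≥0∞} (hu : AEMeasurable u halfLine)
    (hv : AEMeasurable v halfLine) : Φ (fun p => u p + v p) ≤ Φ u + Φ v := by
  simpa only [tsum_bool, cond_true, cond_false] using
    h.tsum_le (fun b : Bool => cond b v u) (Bool.rec hu hv)

lemma ae_lt_top (h : IsKernelBounded Φ C) {u : ℝ → ℝ≥0∞} (hu : AEMeasurable u halfLine)
    (hfin : Φ u < ∞) : ∀ᵐ p ∂halfLine, u p < ∞ := by
  set v : ℝ → ℝ≥0∞ := fun p => ({∞} : Set ℝ≥0∞).indicator (fun _ => ∞) (u p)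
  have hv : AEMeasurable v halfLine :=
    (measurable_const.indicator (measurableSet_singleton ∞)).comp_aemeasurable hu
  have hle : ∀ c : NNReal, 0 < c → Φ v ≤ c * Φ u := fun c hc => by
    refine (h.mono (ae_of_all _ fun p => ?_)).trans (h.const_mul_le _ u)
    refine indicator_apply_le' (fun hp => ?_) fun _ => zero_le
    rw [mem_singleton_iff.1 hp, ENNReal.mul_top (ENNReal.coe_ne_zero.2 hc.ne')]
  have hzero : Φ v = 0 := by
    by_contra hne
    obtain ⟨c, hc, hlt⟩ := ENNReal.exists_nnreal_pos_mul_lt hfin.ne hne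
    exact hlt.not_ge (hle c hc)
  filter_upwards [h.ae_eq_zero hv hzero] with p hp
  refine lt_top_iff_ne_top.2 fun htop => ?_
  simp [v, htop] at hp

lemma norm_mono (h : IsKernelBounded Φ C) (hfg : ∀ᵐ p ∂halfLine, ‖f p‖ₑ ≤ ‖g p‖ₑ) :
    inducedNorm Φ f ≤ inducedNorm Φ g := h.mono hfg

lemma norm_congr (h : IsKernelBounded Φ C) (hfg : f =ᵐ[halfLine] g) :
    inducedNorm Φ f = inducedNorm Φ g :=
  le_antisymm (h.norm_mono (hfg.mono fun p hp => by rw [hp]))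
    (h.norm_mono (hfg.mono fun p hp => by rw [hp]))

lemma norm_zero (h : IsKernelBounded Φ C) : inducedNorm Φ 0 = 0 := by
  simpa [inducedNorm] using! h.const_mul_le 0 0

lemma norm_add_le (h : IsKernelBounded Φ C) (hf : AEStronglyMeasurable f halfLine)
    (hg : AEStronglyMeasurable g halfLine) :
    inducedNorm Φ (f + g) ≤ inducedNorm Φ f + inducedNorm Φ g :=
  (h.mono (ae_of_all _ fun p => enorm_add_le (f p) (g p))).trans (h.add_le hf.enorm hg.enorm)

lemma norm_smul_le (h : IsKernelBounded Φ C) (c : ℝ) (f : ℝ → ℝ) :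
    inducedNorm Φ (c • f) ≤ ‖c‖ₑ * inducedNorm Φ f := by
  simpa only [inducedNorm, Pi.smul_apply, smul_eq_mul, enorm_mul] using! h.const_mul_le ‖c‖₊ _

lemma norm_sub_le (h : IsKernelBounded Φ C) (hf : AEStronglyMeasurable f halfLine)
    (hg : AEStronglyMeasurable g halfLine) :
    inducedNorm Φ (f - g) ≤ inducedNorm Φ f + inducedNorm Φ g := by
  rw [sub_eq_add_neg, ← inducedNorm_neg Φ g]
  exact h.norm_add_le hf hg.neg

lemma norm_kernelOp_le (h : IsKernelBounded Φ C) (hf : AEStronglyMeasurable f halfLine) :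
    inducedNorm Φ (kernelOp f) ≤ ENNReal.ofReal C * inducedNorm Φ f :=
  (h.mono (ae_of_all _ fun p => enorm_kernelOp_le f p)).trans (h.absOp_le hf.enorm)

lemma memSpace_add (h : IsKernelBounded Φ C) (hf : MemSpace (inducedNorm Φ) f)
    (hg : MemSpace (inducedNorm Φ) g) : MemSpace (inducedNorm Φ) (f + g) :=
  ⟨hf.1.add hg.1, (h.norm_add_le hf.1 hg.1).trans_lt (ENNReal.add_lt_top.2 ⟨hf.2, hg.2⟩)⟩

lemma memSpace_smul (h : IsKernelBounded Φ C) (c : ℝ) (hf : MemSpace (inducedNorm Φ) f) :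
    MemSpace (inducedNorm Φ) (c • f) :=
  ⟨hf.1.const_smul c, (h.norm_smul_le c f).trans_lt (ENNReal.mul_lt_top enorm_lt_top hf.2)⟩

lemma memSpace_sub (h : IsKernelBounded Φ C) (hf : MemSpace (inducedNorm Φ) f)
    (hg : MemSpace (inducedNorm Φ) g) : MemSpace (inducedNorm Φ) (f - g) :=
  ⟨hf.1.sub hg.1, (h.norm_sub_le hf.1 hg.1).trans_lt (ENNReal.add_lt_top.2 ⟨hf.2, hg.2⟩)⟩

lemma memSpace_kernelOp (h : IsKernelBounded Φ C) (hf : MemSpace (inducedNorm Φ) f) :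
    MemSpace (inducedNorm Φ) (kernelOp f) :=
  ⟨(stronglyMeasurable_kernelOp hf.1).aestronglyMeasurable,
    (h.norm_kernelOp_le hf.1).trans_lt (ENNReal.mul_lt_top ENNReal.ofReal_lt_top hf.2)⟩

lemma ae_integrable (h : IsKernelBounded Φ C) (hf : MemSpace (inducedNorm Φ) f) :
    ∀ᵐ p ∂halfLine, Integrable (fun q => kernelV (p / q) * f q / q) halfLine := by
  have hlt : Φ (absOp fun q => ‖f q‖ₑ) < ∞ :=
    (h.absOp_le hf.1.enorm).trans_lt (ENNReal.mul_lt_top ENNReal.ofReal_lt_top hf.2)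
  filter_upwards [h.ae_lt_top (measurable_absOp hf.1.enorm).aemeasurable hlt] with p hp
  exact integrable_kernelV_div_mul hf.1 hp

end IsKernelBounded

/-- The generator `γ_N + U` of the linearized equation, `U` being the integral operator. -/
def generator (f : ℝ → ℝ) : ℝ → ℝ := gammaN • f + kernelOp f

namespace IsKernelBounded

variable {Φ : (ℝ → ℝ≥0∞) → ℝ≥0∞} {C : ℝ} {f g : ℝ → ℝ}

lemma memSpace_generator (h : IsKernelBounded Φ C) (hf : MemSpace (inducedNorm Φ) f) :
    MemSpace (inducedNorm Φ) (generator f) :=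
  h.memSpace_add (h.memSpace_smul gammaN hf) (h.memSpace_kernelOp hf)

lemma norm_generator_le (h : IsKernelBounded Φ C) (hf : AEStronglyMeasurable f halfLine) :
    inducedNorm Φ (generator f) ≤ (‖gammaN‖ₑ + ENNReal.ofReal C) * inducedNorm Φ f := by
  rw [add_mul]
  have hU : AEStronglyMeasurable (kernelOp f) halfLine :=
    (stronglyMeasurable_kernelOp hf).aestronglyMeasurable
  exact (h.norm_add_le (hf.const_smul _) hU).trans
    (add_le_add (h.norm_smul_le _ _) (h.norm_kernelOp_le hf))

lemma generator_sub_ae_eq (h : IsKernelBounded Φ C) (hf : MemSpace (inducedNorm Φ) f)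
    (hg : MemSpace (inducedNorm Φ) g) :
    generator (f - g) =ᵐ[halfLine] generator f - generator g := by
  filter_upwards [h.ae_integrable hf, h.ae_integrable hg] with p hfp hgp
  simp only [generator, Pi.add_apply, Pi.sub_apply, Pi.smul_apply, smul_eq_mul,
    kernelOp_sub hfp hgp]
  ring

end IsKernelBounded

/-! ### Power series in the integral operator -/

/-- The power series `∑ₙ dₙ Uⁿ f` in the integral operator `U`, summed pointwise. -/
def opSeries (d : ℕ → ℝ) (f : ℝ → ℝ) (p : ℝ) : ℝ := ∑' n, d n * kernelOp^[n] f p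

lemma opSeries_smul (c : ℝ) (d : ℕ → ℝ) (f : ℝ → ℝ) : opSeries (c • d) f = c • opSeries d f := by
  ext p
  simp only [opSeries, Pi.smul_apply, smul_eq_mul, mul_assoc, tsum_mul_left]

lemma summable_of_tsum_enorm_lt_top {x : ℕ → ℝ} (hx : ∑' n, ‖x n‖ₑ < ∞) : Summable x :=
  Summable.of_nnnorm (ENNReal.tsum_coe_ne_top_iff_summable.1 hx.ne)

section

variable {f : ℝ → ℝ} (hf : AEStronglyMeasurable f halfLine)
include hf

lemma aestronglyMeasurable_iterate (n : ℕ) : AEStronglyMeasurable (kernelOp^[n] f) halfLine := by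
  induction n with
  | zero => exact hf
  | succ n ih =>
    rw [Function.iterate_succ_apply']
    exact (stronglyMeasurable_kernelOp ih).aestronglyMeasurable

lemma aemeasurable_enorm_mul_iterate (d : ℕ → ℝ) (n : ℕ) :
    AEMeasurable (fun p => ‖d n * kernelOp^[n] f p‖ₑ) halfLine :=
  ((aestronglyMeasurable_iterate hf n).const_mul (d n)).enorm

lemma aemeasurable_tsum_enorm (d : ℕ → ℝ) :
    AEMeasurable (fun p => ∑' n, ‖d n * kernelOp^[n] f p‖ₑ) halfLine :=
  AEMeasurable.tsum fun n => aemeasurable_enorm_mul_iterate hf d n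

lemma aestronglyMeasurable_opSeries (d : ℕ → ℝ) :
    AEStronglyMeasurable (opSeries d f) halfLine :=
  (AEMeasurable.tsum fun n =>
    (aestronglyMeasurable_iterate hf n).aemeasurable.const_mul (d n)).aestronglyMeasurable

lemma kernelOp_opSeries_apply {d : ℕ → ℝ} {p : ℝ}
    (hp : absOp (fun q => ∑' n, ‖d n * kernelOp^[n] f q‖ₑ) p < ∞) :
    kernelOp (opSeries d f) p = ∑' n, d n * kernelOp^[n + 1] f p := by
  have hm : ∀ n, AEStronglyMeasurable
      (fun q => kernelV (p / q) * (d n * kernelOp^[n] f q) / q) halfLine := fun n =>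
    aestronglyMeasurable_kernelV_div_mul ((aestronglyMeasurable_iterate hf n).const_mul (d n)) p
  have hsum : ∑' n, ∫⁻ q, ‖kernelV (p / q) * (d n * kernelOp^[n] f q) / q‖ₑ ∂halfLine ≠ ∞ := by
    rw [← lintegral_tsum fun n => (hm n).enorm]
    convert hp.ne using 1
    refine lintegral_congr fun q => ?_
    rw [← ENNReal.tsum_mul_left]
    exact tsum_congr fun n => enorm_kernelV_div (fun q => d n * kernelOp^[n] f q) p q
  calc kernelOp (opSeries d f) p
      = ∫ q, ∑' n, kernelV (p / q) * (d n * kernelOp^[n] f q) / q ∂halfLine := by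
        simp only [kernelOp, opSeries, ← tsum_mul_left, ← tsum_div_const]
    _ = ∑' n, ∫ q, kernelV (p / q) * (d n * kernelOp^[n] f q) / q ∂halfLine :=
        integral_tsum hm hsum
    _ = ∑' n, d n * kernelOp^[n + 1] f p := by
        simp only [Function.iterate_succ_apply', kernelOp, ← integral_const_mul]
        exact tsum_congr fun n => integral_congr_ae (ae_of_all _ fun q => by ring)

end

namespace IsKernelBounded

variable {Φ : (ℝ → ℝ≥0∞) → ℝ≥0∞} {C : ℝ} {f : ℝ → ℝ} {d e : ℕ → ℝ}

lemma norm_iterate_le (h : IsKernelBounded Φ C) (hf : AEStronglyMeasurable f halfLine) (n : ℕ) :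
    inducedNorm Φ (kernelOp^[n] f) ≤ ENNReal.ofReal (C ^ n) * inducedNorm Φ f := by
  induction n with
  | zero => simp
  | succ n ih =>
    rw [Function.iterate_succ_apply', pow_succ', ENNReal.ofReal_mul h.nonneg, mul_assoc]
    exact (h.norm_kernelOp_le (aestronglyMeasurable_iterate hf n)).trans (by gcongr)

lemma tsum_enorm_le (h : IsKernelBounded Φ C) (hf : AEStronglyMeasurable f halfLine)
    (hd : Summable fun n => |d n| * C ^ n) :
    Φ (fun p => ∑' n, ‖d n * kernelOp^[n] f p‖ₑ)
      ≤ ENNReal.ofReal (∑' n, |d n| * C ^ n) * inducedNorm Φ f := by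
  have hC := h.nonneg
  refine (h.tsum_le _ fun n => aemeasurable_enorm_mul_iterate hf d n).trans ?_
  rw [ENNReal.ofReal_tsum_of_nonneg (fun n => by positivity) hd, ← ENNReal.tsum_mul_right]
  refine ENNReal.tsum_le_tsum fun n => ?_
  rw [ENNReal.ofReal_mul (abs_nonneg _), mul_assoc, ← Real.norm_eq_abs, ofReal_norm]
  exact (h.norm_smul_le (d n) (kernelOp^[n] f)).trans (by gcongr; exact h.norm_iterate_le hf n)

lemma tsum_enorm_lt_top (h : IsKernelBounded Φ C) (hf : MemSpace (inducedNorm Φ) f)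
    (hd : Summable fun n => |d n| * C ^ n) :
    Φ (fun p => ∑' n, ‖d n * kernelOp^[n] f p‖ₑ) < ∞ :=
  (h.tsum_enorm_le hf.1 hd).trans_lt (ENNReal.mul_lt_top ENNReal.ofReal_lt_top hf.2)

lemma norm_opSeries_le (h : IsKernelBounded Φ C) (hf : AEStronglyMeasurable f halfLine)
    (hd : Summable fun n => |d n| * C ^ n) :
    inducedNorm Φ (opSeries d f) ≤ ENNReal.ofReal (∑' n, |d n| * C ^ n) * inducedNorm Φ f :=
  (h.mono (ae_of_all _ fun _ => enorm_tsum_le_tsum_enorm)).trans (h.tsum_enorm_le hf hd)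

lemma memSpace_opSeries (h : IsKernelBounded Φ C) (hf : MemSpace (inducedNorm Φ) f)
    (hd : Summable fun n => |d n| * C ^ n) : MemSpace (inducedNorm Φ) (opSeries d f) :=
  ⟨aestronglyMeasurable_opSeries hf.1 d,
    (h.norm_opSeries_le hf.1 hd).trans_lt (ENNReal.mul_lt_top ENNReal.ofReal_lt_top hf.2)⟩

lemma ae_summable (h : IsKernelBounded Φ C) (hf : MemSpace (inducedNorm Φ) f)
    (hd : Summable fun n => |d n| * C ^ n) :
    ∀ᵐ p ∂halfLine, Summable fun n => d n * kernelOp^[n] f p := by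
  filter_upwards [h.ae_lt_top (aemeasurable_tsum_enorm hf.1 d) (h.tsum_enorm_lt_top hf hd)]
    with p hp using summable_of_tsum_enorm_lt_top hp

lemma opSeries_sub_ae_eq (h : IsKernelBounded Φ C) (hf : MemSpace (inducedNorm Φ) f)
    (hd : Summable fun n => |d n| * C ^ n) (he : Summable fun n => |e n| * C ^ n) :
    opSeries (d - e) f =ᵐ[halfLine] opSeries d f - opSeries e f := by
  filter_upwards [h.ae_summable hf hd, h.ae_summable hf he] with p hdp hep
  simp only [opSeries, Pi.sub_apply, sub_mul]
  exact hdp.tsum_sub hep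

lemma kernelOp_opSeries (h : IsKernelBounded Φ C) (hf : MemSpace (inducedNorm Φ) f)
    (hd : Summable fun n => |d n| * C ^ n) :
    ∀ᵐ p ∂halfLine, kernelOp (opSeries d f) p = ∑' n, d n * kernelOp^[n + 1] f p := by
  have hm := aemeasurable_tsum_enorm hf.1 d
  have hlt := (h.absOp_le hm).trans_lt
    (ENNReal.mul_lt_top ENNReal.ofReal_lt_top (h.tsum_enorm_lt_top hf hd))
  filter_upwards [h.ae_lt_top (measurable_absOp hm).aemeasurable hlt] with p hp
    using kernelOp_opSeries_apply hf.1 hp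

end IsKernelBounded

/-! ### The exponential series -/

/-- The coefficients `e^{γ_N t} tⁿ / n!` of the solution semigroup as a power series in the
integral operator. -/
def solCoef (t : ℝ) (n : ℕ) : ℝ := Real.exp (gammaN * t) * (t ^ n / n.factorial)

/-- The time derivative of `solCoef`. -/
def solCoefDeriv (t : ℝ) (n : ℕ) : ℝ :=
  gammaN * solCoef t n + Real.exp (gammaN * t) * (n * t ^ (n - 1) / n.factorial)

lemma solCoef_nonneg {t : ℝ} (ht : 0 ≤ t) (n : ℕ) : 0 ≤ solCoef t n := by
  unfold solCoef
  positivity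

lemma hasDerivAt_solCoef (t : ℝ) (n : ℕ) :
    HasDerivAt (fun t => solCoef t n) (solCoefDeriv t n) t := by
  have hexp : HasDerivAt (fun t => Real.exp (gammaN * t))
      (Real.exp (gammaN * t) * (gammaN * 1)) t := ((hasDerivAt_id t).const_mul gammaN).exp
  refine (hexp.mul ((hasDerivAt_pow n t).div_const (n.factorial : ℝ))).congr_deriv ?_
  rw [solCoefDeriv, solCoef]
  ring

lemma solCoefDeriv_zero (t : ℝ) : solCoefDeriv t 0 = gammaN * solCoef t 0 := by
  simp [solCoefDeriv]

lemma solCoefDeriv_succ (t : ℝ) (n : ℕ) :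
    solCoefDeriv t (n + 1) = gammaN * solCoef t (n + 1) + solCoef t n := by
  have hn : (n : ℝ) + 1 ≠ 0 := by positivity
  rw [solCoefDeriv, add_right_inj, solCoef, Nat.factorial_succ, Nat.add_sub_cancel, Nat.cast_mul,
    Nat.cast_succ, mul_div_mul_left _ _ hn]

lemma hasSum_solCoef (t m : ℝ) :
    HasSum (fun n => solCoef t n * m ^ n) (Real.exp ((gammaN + m) * t)) := by
  have hexp : HasSum (fun n : ℕ => (m * t) ^ n / n.factorial) (Real.exp (m * t)) := by
    rw [Real.exp_eq_exp_ℝ]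
    exact NormedSpace.expSeries_div_hasSum_exp (m * t)
  rw [add_mul, Real.exp_add]
  refine (hexp.mul_left (Real.exp (gammaN * t))).congr_fun fun n => ?_
  rw [solCoef, mul_pow]
  ring

lemma summable_abs_solCoef_mul_pow (t C : ℝ) : Summable fun n => |solCoef t n| * C ^ n := by
  refine ((Real.summable_pow_div_factorial (|t| * C)).mul_left
    (Real.exp (gammaN * t))).congr fun n => ?_
  rw [solCoef, abs_mul, Real.abs_exp, abs_div, abs_pow, Nat.abs_cast, mul_pow]
  ring

lemma abs_solCoef_le {t M : ℝ} (ht : |t| ≤ M) (n : ℕ) :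
    |solCoef t n| ≤ Real.exp (|gammaN| * M) * (M ^ n / n.factorial) := by
  have hexp : Real.exp (gammaN * t) ≤ Real.exp (|gammaN| * M) :=
    Real.exp_le_exp.2 ((le_abs_self _).trans (by rw [abs_mul]; gcongr))
  rw [solCoef, abs_mul, Real.abs_exp, abs_div, abs_pow, Nat.abs_cast]
  gcongr

lemma exists_abs_solCoefDeriv_le_summable (M C : ℝ) :
    ∃ B : ℕ → ℝ, (∀ t, |t| ≤ M → ∀ n, |solCoefDeriv t n| ≤ B n) ∧
      Summable fun n => B n * C ^ n := by
  set E := Real.exp (|gammaN| * M)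
  set c : ℕ → ℝ := fun n => E * (M ^ n / n.factorial)
  have hc : Summable fun n => c n * C ^ n :=
    ((Real.summable_pow_div_factorial (M * C)).mul_left E).congr fun n => by
      simp only [c, mul_pow]
      ring
  refine ⟨fun n => |gammaN| * c n + Nat.casesOn n 0 c, fun t ht n => ?_, ?_⟩
  · cases n with
    | zero =>
      rw [solCoefDeriv_zero, abs_mul]
      exact (mul_le_mul_of_nonneg_left (abs_solCoef_le ht 0) (abs_nonneg _)).trans_eq
        (add_zero _).symm
    | succ n =>
      rw [solCoefDeriv_succ]
      refine (abs_add_le _ _).trans (add_le_add ?_ (abs_solCoef_le ht n))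
      rw [abs_mul]
      gcongr
      exact abs_solCoef_le ht (n + 1)
  · rw [← summable_nat_add_iff 1]
    refine ((((summable_nat_add_iff 1).2 hc).mul_left |gammaN|).add (hc.mul_right C)).congr
      fun n => ?_
    rw [pow_succ]
    ring

lemma summable_abs_solCoefDeriv_mul_pow (t : ℝ) {C : ℝ} (hC : 0 ≤ C) :
    Summable fun n => |solCoefDeriv t n| * C ^ n := by
  obtain ⟨B, hB, hsum⟩ := exists_abs_solCoefDeriv_le_summable |t| C
  exact .of_nonneg_of_le (fun n => by positivity)
    (fun n => mul_le_mul_of_nonneg_right (hB t le_rfl n) (by positivity)) hsum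

lemma summable_abs_sub_mul {d e w : ℕ → ℝ} (hw : 0 ≤ w) (hd : Summable fun n => |d n| * w n)
    (he : Summable fun n => |e n| * w n) : Summable fun n => |(d - e) n| * w n :=
  .of_nonneg_of_le (fun n => mul_nonneg (abs_nonneg _) (hw n))
    (fun n => (mul_le_mul_of_nonneg_right (abs_sub (d n) (e n)) (hw n)).trans_eq (add_mul _ _ _))
    (hd.add he)

lemma summable_abs_smul_mul {d w : ℕ → ℝ} (c : ℝ) (hd : Summable fun n => |d n| * w n) :
    Summable fun n => |(c • d) n| * w n :=
  (hd.mul_left |c|).congr fun n => by rw [Pi.smul_apply, smul_eq_mul, abs_mul, mul_assoc]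

lemma norm_slope_le_of_hasDerivAt {f f' : ℝ → ℝ} {t r b s : ℝ}
    (hf : ∀ x ∈ Metric.ball t r, HasDerivAt f (f' x) x) (hb : ∀ x ∈ Metric.ball t r, |f' x| ≤ b)
    (hs : s ∈ Metric.ball t r) : |slope f t s| ≤ b := by
  have hmv := (convex_ball t r).norm_image_sub_le_of_norm_hasDerivWithin_le
    (fun x hx => (hf x hx).hasDerivWithinAt) hb
    (Metric.mem_ball_self (dist_nonneg.trans_lt hs)) hs
  rw [slope_def_field, abs_div]
  exact div_le_of_le_mul₀ (abs_nonneg _) ((abs_nonneg _).trans (hb s hs)) hmv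

lemma tendsto_tsum_abs_slope_sub {e e' : ℝ → ℕ → ℝ} {w B : ℕ → ℝ} {t r : ℝ} (hr : 0 < r)
    (he : ∀ n, ∀ x ∈ Metric.ball t r, HasDerivAt (fun x => e x n) (e' x n) x)
    (hB : ∀ n, ∀ x ∈ Metric.ball t r, |e' x n| ≤ B n) (hw : 0 ≤ w)
    (hsum : Summable fun n => B n * w n) :
    Tendsto (fun s => ∑' n, |(slope e t s - e' t) n| * w n) (𝓝[≠] t) (𝓝 0) := by
  have happly : ∀ s n, (slope e t s - e' t) n = slope (fun x => e x n) t s - e' t n := fun s n => by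
    simp only [slope_def_module, Pi.sub_apply, Pi.smul_apply]
  have ht : t ∈ Metric.ball t r := Metric.mem_ball_self hr
  simp only [happly]
  rw [← tsum_zero (L := .unconditional ℕ)]
  refine tendsto_tsum_of_dominated_convergence (hsum.mul_left 2) (fun n => ?_) ?_
  · have hlim := (((he n t ht).tendsto_slope.sub_const (e' t n)).abs.mul_const (w n))
    rwa [sub_self, abs_zero, zero_mul] at hlim
  · filter_upwards [mem_nhdsWithin_of_mem_nhds (Metric.ball_mem_nhds t hr), self_mem_nhdsWithin]
      with s hs _ n
    rw [Real.norm_of_nonneg (mul_nonneg (abs_nonneg _) (hw n)), ← mul_assoc]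
    refine mul_le_mul_of_nonneg_right ((abs_sub _ _).trans ?_) (hw n)
    linarith [norm_slope_le_of_hasDerivAt (he n) (hB n) hs, hB n t ht]

lemma tendsto_tsum_abs_slope_solCoef_sub (t : ℝ) {C : ℝ} (hC : 0 ≤ C) :
    Tendsto (fun s => ∑' n, |(slope solCoef t s - solCoefDeriv t) n| * C ^ n) (𝓝[≠] t) (𝓝 0) := by
  obtain ⟨B, hB, hsum⟩ := exists_abs_solCoefDeriv_le_summable (|t| + 1) C
  refine tendsto_tsum_abs_slope_sub one_pos (fun n x _ => hasDerivAt_solCoef x n)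
    (fun n x hx => hB x ?_ n) (fun n => pow_nonneg hC n) hsum
  have hxt : |x - t| < 1 := hx
  linarith [abs_sub_abs_le_abs_sub x t]

/-! ### Existence -/

/-- The solution `e^{t(γ_N + U)} A₀` with initial datum `A₀`, `U` being the integral operator. -/
def solution (A₀ : ℝ → ℝ) (t : ℝ) : ℝ → ℝ := opSeries (solCoef t) A₀

lemma solution_zero (A₀ : ℝ → ℝ) : solution A₀ 0 = A₀ := by
  ext p
  rw [solution, opSeries, tsum_eq_single 0 fun n hn => by simp [solCoef, hn]]
  simp [solCoef]

lemma nonneg_iterate {A₀ : ℝ → ℝ} (h : Nonneg A₀) (n : ℕ) : Nonneg (kernelOp^[n] A₀) := by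
  induction n with
  | zero => exact h
  | succ n ih =>
    rw [Function.iterate_succ_apply']
    filter_upwards [ae_halfLine_pos] with p hp using kernelOp_nonneg ih hp

lemma nonneg_solution {A₀ : ℝ → ℝ} (h : Nonneg A₀) {t : ℝ} (ht : 0 ≤ t) :
    Nonneg (solution A₀ t) := by
  filter_upwards [ae_all_iff.2 fun n => nonneg_iterate h n] with p hp
  exact tsum_nonneg fun n => mul_nonneg (solCoef_nonneg ht n) (hp n)

lemma tendsto_zero_of_le_ofReal_mul {α : Type*} {l : Filter α} {F : α → ℝ≥0∞} {G : α → ℝ}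
    {c : ℝ≥0∞} (hc : c ≠ ∞) (hFG : ∀ᶠ s in l, F s ≤ ENNReal.ofReal (G s) * c)
    (hG : Tendsto G l (𝓝 0)) : Tendsto F l (𝓝 0) := by
  have hlim := ENNReal.Tendsto.mul_const (ENNReal.tendsto_ofReal hG) (.inr hc)
  rw [ENNReal.ofReal_zero, zero_mul] at hlim
  exact tendsto_of_tendsto_of_tendsto_of_le_of_le' tendsto_const_nhds hlim
    (Eventually.of_forall fun _ => zero_le) hFG

namespace IsKernelBounded

variable {Φ : (ℝ → ℝ≥0∞) → ℝ≥0∞} {C : ℝ} {A₀ : ℝ → ℝ}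

lemma memSpace_solution (h : IsKernelBounded Φ C) (hA : MemSpace (inducedNorm Φ) A₀) (t : ℝ) :
    MemSpace (inducedNorm Φ) (solution A₀ t) :=
  h.memSpace_opSeries hA (summable_abs_solCoef_mul_pow t C)

lemma generator_solution_ae_eq (h : IsKernelBounded Φ C) (hA : MemSpace (inducedNorm Φ) A₀)
    (t : ℝ) : generator (solution A₀ t) =ᵐ[halfLine] opSeries (solCoefDeriv t) A₀ := by
  have hU := h.kernelOp_opSeries hA (summable_abs_solCoef_mul_pow t C)
  filter_upwards [h.ae_summable hA (summable_abs_solCoef_mul_pow t C),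
    h.ae_summable hA (summable_abs_solCoefDeriv_mul_pow t h.nonneg), hU] with p hs hs' hUp
  have htail := ((summable_nat_add_iff 1).2 hs).mul_left gammaN
  have hsucc : ∀ n, solCoefDeriv t (n + 1) * kernelOp^[n + 1] A₀ p =
      gammaN * (solCoef t (n + 1) * kernelOp^[n + 1] A₀ p) +
        solCoef t n * kernelOp^[n + 1] A₀ p := fun n => by rw [solCoefDeriv_succ]; ring
  have hshift : Summable fun n => solCoef t n * kernelOp^[n + 1] A₀ p :=
    (((summable_nat_add_iff 1).2 hs').sub htail).congr fun n => by rw [hsucc]; ring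
  simp only [generator, Pi.add_apply, Pi.smul_apply, smul_eq_mul, solution, hUp]
  rw [opSeries, opSeries, hs.tsum_eq_zero_add, hs'.tsum_eq_zero_add, tsum_congr hsucc,
    htail.tsum_add hshift, tsum_mul_left, solCoefDeriv_zero]
  ring

lemma slope_solution_sub_ae_eq (h : IsKernelBounded Φ C) (hA : MemSpace (inducedNorm Φ) A₀)
    (s t : ℝ) :
    (s - t)⁻¹ • (solution A₀ s - solution A₀ t) - generator (solution A₀ t) =ᵐ[halfLine]
      opSeries (slope solCoef t s - solCoefDeriv t) A₀ := by
  have hw : 0 ≤ fun n => C ^ n := fun n => pow_nonneg h.nonneg n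
  have hsub := summable_abs_sub_mul hw (summable_abs_solCoef_mul_pow s C)
    (summable_abs_solCoef_mul_pow t C)
  have hslope := h.opSeries_sub_ae_eq hA (summable_abs_smul_mul (s - t)⁻¹ hsub)
    (summable_abs_solCoefDeriv_mul_pow t h.nonneg)
  filter_upwards [hslope, h.generator_solution_ae_eq hA t,
    h.opSeries_sub_ae_eq hA (summable_abs_solCoef_mul_pow s C)
      (summable_abs_solCoef_mul_pow t C)] with p hp hgen hdiff
  simp only [slope_def_module, hp, Pi.sub_apply, opSeries_smul, Pi.smul_apply] at hdiff ⊢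
  rw [hgen, hdiff, solution, solution]

lemma tendsto_norm_slope_solution_sub (h : IsKernelBounded Φ C)
    (hA : MemSpace (inducedNorm Φ) A₀) (t : ℝ) :
    Tendsto (fun s => inducedNorm Φ
      ((s - t)⁻¹ • (solution A₀ s - solution A₀ t) - generator (solution A₀ t)))
      (𝓝[≠] t) (𝓝 0) := by
  have hw : 0 ≤ fun n => C ^ n := fun n => pow_nonneg h.nonneg n
  refine tendsto_zero_of_le_ofReal_mul hA.2.ne (Eventually.of_forall fun s => ?_)
    (tendsto_tsum_abs_slope_solCoef_sub t h.nonneg)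
  rw [h.norm_congr (h.slope_solution_sub_ae_eq hA s t)]
  refine h.norm_opSeries_le hA.1 (summable_abs_sub_mul hw ?_
    (summable_abs_solCoefDeriv_mul_pow t h.nonneg))
  rw [slope_def_module]
  exact summable_abs_smul_mul _ (summable_abs_sub_mul hw (summable_abs_solCoef_mul_pow s C)
    (summable_abs_solCoef_mul_pow t C))

lemma tendsto_norm_sub_of_slope (h : IsKernelBounded Φ C) {A : ℝ → ℝ → ℝ} {D : ℝ → ℝ} {t : ℝ}
    (hA : ∀ s, AEStronglyMeasurable (A s) halfLine) (hD : MemSpace (inducedNorm Φ) D)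
    (hslope : Tendsto (fun s => inducedNorm Φ ((s - t)⁻¹ • (A s - A t) - D)) (𝓝[≠] t) (𝓝 0)) :
    Tendsto (fun s => inducedNorm Φ (A s - A t)) (𝓝 t) (𝓝 0) := by
  have hle : ∀ s, s ≠ t → inducedNorm Φ (A s - A t) ≤
      ‖s - t‖ₑ * (inducedNorm Φ ((s - t)⁻¹ • (A s - A t) - D) + inducedNorm Φ D) := by
    intro s hs
    have hm : AEStronglyMeasurable ((s - t)⁻¹ • (A s - A t) - D) halfLine :=
      (((hA s).sub (hA t)).const_smul _).sub hD.1
    calc inducedNorm Φ (A s - A t)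
        = inducedNorm Φ ((s - t) • (((s - t)⁻¹ • (A s - A t) - D) + D)) := by
          rw [sub_add_cancel, smul_inv_smul₀ (sub_ne_zero.2 hs)]
      _ ≤ _ := (h.norm_smul_le _ _).trans (by gcongr; exact h.norm_add_le hm hD.1)
  have hzero : inducedNorm Φ (A t - A t) = 0 := by rw [sub_self, h.norm_zero]
  have hdist : Tendsto (fun s => ‖s - t‖ₑ) (𝓝[≠] t) (𝓝 0) := by
    have hcont : Continuous fun s : ℝ => ‖s - t‖ₑ := by fun_prop
    simpa using (hcont.tendsto t).mono_left nhdsWithin_le_nhds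
  have hlim := ENNReal.Tendsto.mul hdist (.inr (by simp [hD.2.ne]))
    (hslope.add_const (inducedNorm Φ D)) (.inr (by simp))
  rw [zero_mul] at hlim
  rw [← nhdsNE_sup_pure t, tendsto_sup]
  refine ⟨tendsto_of_tendsto_of_tendsto_of_le_of_le' tendsto_const_nhds hlim
    (Eventually.of_forall fun _ => zero_le) ?_, ?_⟩
  · filter_upwards [self_mem_nhdsWithin] with s hs using hle s hs
  · exact tendsto_pure_left.2 fun u hu => hzero ▸ mem_of_mem_nhds hu

lemma tendsto_norm_generator_sub (h : IsKernelBounded Φ C) {A : ℝ → ℝ → ℝ} {f : ℝ → ℝ}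
    {l : Filter ℝ} (hA : ∀ᶠ s in l, MemSpace (inducedNorm Φ) (A s))
    (hf : MemSpace (inducedNorm Φ) f)
    (hlim : Tendsto (fun s => inducedNorm Φ (A s - f)) l (𝓝 0)) :
    Tendsto (fun s => inducedNorm Φ (generator (A s) - generator f)) l (𝓝 0) := by
  have hbound := ENNReal.Tendsto.const_mul (a := ‖gammaN‖ₑ + ENNReal.ofReal C) hlim
    (.inr (ENNReal.add_ne_top.2 ⟨enorm_ne_top, ENNReal.ofReal_ne_top⟩))
  rw [mul_zero] at hbound
  refine tendsto_of_tendsto_of_tendsto_of_le_of_le' tendsto_const_nhds hbound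
    (Eventually.of_forall fun _ => zero_le) ?_
  filter_upwards [hA] with s hs
  rw [← h.norm_congr (h.generator_sub_ae_eq hs hf)]
  exact h.norm_generator_le (hs.1.sub hf.1)

lemma isSolution_of_slope (h : IsKernelBounded Φ C) {A : ℝ → ℝ → ℝ}
    (hmem : ∀ t, 0 ≤ t → MemSpace (inducedNorm Φ) (A t)) (hinit : A 0 =ᵐ[halfLine] A₀)
    (hcont : ∀ t, 0 ≤ t → Tendsto (fun s => inducedNorm Φ (A s - A t)) (𝓝[Ici 0] t) (𝓝 0))
    (hslope : ∀ t, 0 < t → Tendsto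
      (fun s => inducedNorm Φ ((s - t)⁻¹ • (A s - A t) - generator (A t))) (𝓝[≠] t) (𝓝 0)) :
    IsSolution (inducedNorm Φ) A₀ A where
  mem := hmem
  init := hinit
  continuous := hcont
  equation := by
    refine ⟨fun t => generator (A t), fun t ht => ⟨h.memSpace_generator (hmem t ht.le),
      hslope t ht, ?_, (h.ae_integrable (hmem t ht.le)).mono fun _ hp => ⟨hp, rfl⟩⟩⟩
    have hlim := hcont t ht.le
    rw [nhdsWithin_eq_nhds.2 (Ici_mem_nhds ht)] at hlim
    exact h.tendsto_norm_generator_sub (mem_of_superset (Ici_mem_nhds ht) hmem) (hmem t ht.le) hlim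

lemma isSolution_solution (h : IsKernelBounded Φ C) (hA : MemSpace (inducedNorm Φ) A₀) :
    IsSolution (inducedNorm Φ) A₀ (solution A₀) := by
  have hmem := h.memSpace_solution hA
  have hslope := h.tendsto_norm_slope_solution_sub hA
  have hcont := fun t => h.tendsto_norm_sub_of_slope (fun s => (hmem s).1)
    (h.memSpace_generator (hmem t)) (hslope t)
  exact h.isSolution_of_slope (fun t _ => hmem t) (by rw [solution_zero])
    (fun t _ => (hcont t).mono_left nhdsWithin_le_nhds) fun t _ => hslope t

end IsKernelBounded

/-! ### Growth bound and uniqueness -/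

namespace IsKernelBounded

variable {Φ : (ℝ → ℝ≥0∞) → ℝ≥0∞} {C : ℝ} {A₀ B₀ : ℝ → ℝ} {A B : ℝ → ℝ → ℝ}

lemma toReal_norm_le_add_norm_sub (h : IsKernelBounded Φ C) {f g : ℝ → ℝ}
    (hf : MemSpace (inducedNorm Φ) f) (hg : MemSpace (inducedNorm Φ) g) :
    (inducedNorm Φ f).toReal ≤ (inducedNorm Φ g).toReal + (inducedNorm Φ (f - g)).toReal := by
  have hs := h.memSpace_sub hf hg
  rw [← ENNReal.toReal_add hg.2.ne hs.2.ne]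
  refine ENNReal.toReal_mono (ENNReal.add_ne_top.2 ⟨hg.2.ne, hs.2.ne⟩) ?_
  simpa only [add_sub_cancel] using h.norm_add_le hg.1 hs.1

lemma abs_toReal_norm_sub_le (h : IsKernelBounded Φ C) {f g : ℝ → ℝ}
    (hf : MemSpace (inducedNorm Φ) f) (hg : MemSpace (inducedNorm Φ) g) :
    |(inducedNorm Φ f).toReal - (inducedNorm Φ g).toReal| ≤ (inducedNorm Φ (f - g)).toReal := by
  have hgf := h.toReal_norm_le_add_norm_sub hg hf
  rw [← neg_sub f g, inducedNorm_neg] at hgf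
  exact abs_sub_le_iff.2 ⟨sub_le_iff_le_add'.2 (h.toReal_norm_le_add_norm_sub hf hg),
    sub_le_iff_le_add'.2 hgf⟩

lemma continuousOn_toReal_norm (h : IsKernelBounded Φ C)
    (hA : IsSolution (inducedNorm Φ) A₀ A) :
    ContinuousOn (fun t => (inducedNorm Φ (A t)).toReal) (Ici 0) := by
  intro t ht
  rw [ContinuousWithinAt, tendsto_iff_dist_tendsto_zero]
  refine squeeze_zero' (Eventually.of_forall fun _ => dist_nonneg) ?_
    ((ENNReal.tendsto_toReal ENNReal.zero_ne_top).comp (hA.continuous t ht))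
  filter_upwards [self_mem_nhdsWithin] with s hs
  exact h.abs_toReal_norm_sub_le (hA.mem s hs) (hA.mem t ht)

-- The rate is `γ_N + C`, not `|γ_N| + C`: a small multiple of the term `γ_N f` is absorbed in `f`.
lemma norm_euler_le (h : IsKernelBounded Φ C) {f e : ℝ → ℝ} {τ : ℝ} (hτ : 0 ≤ τ)
    (hτγ : 0 ≤ 1 + τ * gammaN) (hf : MemSpace (inducedNorm Φ) f)
    (he : AEStronglyMeasurable e halfLine) :
    inducedNorm Φ (f + τ • (generator f + e)) ≤
      ENNReal.ofReal (1 + τ * (gammaN + C)) * inducedNorm Φ f +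
        ENNReal.ofReal τ * inducedNorm Φ e := by
  have hU := (h.memSpace_kernelOp hf).1
  have hsplit : f + τ • (generator f + e) = (1 + τ * gammaN) • f + τ • kernelOp f + τ • e := by
    simp only [generator, smul_add, add_smul, one_smul, mul_smul, add_assoc]
  rw [hsplit, show 1 + τ * (gammaN + C) = (1 + τ * gammaN) + τ * C by ring,
    ENNReal.ofReal_add hτγ (mul_nonneg hτ h.nonneg), ENNReal.ofReal_mul hτ, add_mul, mul_assoc,
    ← Real.enorm_of_nonneg hτ, ← Real.enorm_of_nonneg hτγ]
  calc inducedNorm Φ ((1 + τ * gammaN) • f + τ • kernelOp f + τ • e)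
      ≤ inducedNorm Φ ((1 + τ * gammaN) • f) + inducedNorm Φ (τ • kernelOp f) +
          inducedNorm Φ (τ • e) :=
        (h.norm_add_le ((hf.1.const_smul _).add (hU.const_smul _)) (he.const_smul _)).trans
          (by gcongr; exact h.norm_add_le (hf.1.const_smul _) (hU.const_smul _))
    _ ≤ _ := by
        gcongr
        · exact h.norm_smul_le _ _
        · exact (h.norm_smul_le _ _).trans (by gcongr; exact h.norm_kernelOp_le hf.1)
        · exact h.norm_smul_le _ _

lemma tendsto_norm_slope_isSolution_sub (h : IsKernelBounded Φ C)
    (hA : IsSolution (inducedNorm Φ) A₀ A) {t : ℝ} (ht : 0 < t) :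
    Tendsto (fun s => inducedNorm Φ ((s - t)⁻¹ • (A s - A t) - generator (A t)))
      (𝓝[≠] t) (𝓝 0) := by
  obtain ⟨D, hD⟩ := hA.equation
  obtain ⟨-, hslope, -, heq⟩ := hD t ht
  refine hslope.congr fun s => h.norm_congr ?_
  filter_upwards [heq] with p hp
  exact congrArg (_ - ·) hp.2

lemma slope_toReal_norm_le (h : IsKernelBounded Φ C) {f g : ℝ → ℝ} {τ : ℝ} (hτ : 0 < τ)
    (hτγ : 0 ≤ 1 + τ * gammaN) (hf : MemSpace (inducedNorm Φ) f)
    (hg : MemSpace (inducedNorm Φ) g) :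
    τ⁻¹ * ((inducedNorm Φ g).toReal - (inducedNorm Φ f).toReal) ≤
      (gammaN + C) * (inducedNorm Φ f).toReal +
        (inducedNorm Φ (τ⁻¹ • (g - f) - generator f)).toReal := by
  set e := τ⁻¹ • (g - f) - generator f with he
  have hme : MemSpace (inducedNorm Φ) e :=
    h.memSpace_sub (h.memSpace_smul _ (h.memSpace_sub hg hf)) (h.memSpace_generator hf)
  have hstep : f + τ • (generator f + e) = g := by
    rw [he, add_sub_cancel, smul_inv_smul₀ hτ.ne', add_sub_cancel]
  have hle := h.norm_euler_le hτ.le hτγ hf hme.1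
  rw [hstep] at hle
  have hfin := ENNReal.mul_ne_top (a := ENNReal.ofReal (1 + τ * (gammaN + C)))
    ENNReal.ofReal_ne_top hf.2.ne
  have hfin' := ENNReal.mul_ne_top (a := ENNReal.ofReal τ) ENNReal.ofReal_ne_top hme.2.ne
  have hreal := ENNReal.toReal_mono (ENNReal.add_ne_top.2 ⟨hfin, hfin'⟩) hle
  have hrate : 0 ≤ 1 + τ * (gammaN + C) := by nlinarith [h.nonneg]
  rw [ENNReal.toReal_add hfin hfin', ENNReal.toReal_mul, ENNReal.toReal_mul,
    ENNReal.toReal_ofReal hrate, ENNReal.toReal_ofReal hτ.le] at hreal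
  rw [inv_mul_le_iff₀ hτ]
  linarith

lemma eventually_slope_toReal_norm_lt (h : IsKernelBounded Φ C)
    (hA : IsSolution (inducedNorm Φ) A₀ A) {t r : ℝ} (ht : 0 < t)
    (hr : (gammaN + C) * (inducedNorm Φ (A t)).toReal < r) :
    ∀ᶠ z in 𝓝[>] t,
      (z - t)⁻¹ * ((inducedNorm Φ (A z)).toReal - (inducedNorm Φ (A t)).toReal) < r := by
  have herror := (ENNReal.tendsto_toReal ENNReal.zero_ne_top).comp
    ((h.tendsto_norm_slope_isSolution_sub hA ht).mono_left (nhdsGT_le_nhdsNE t))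
  have hcoef : Tendsto (fun z => 1 + (z - t) * gammaN) (𝓝[>] t) (𝓝 1) := by
    have hcont : Continuous fun z => 1 + (z - t) * gammaN := by fun_prop
    simpa using (hcont.tendsto t).mono_left nhdsWithin_le_nhds
  filter_upwards [herror.eventually_lt_const (sub_pos.2 hr),
    hcoef.eventually_const_lt one_pos, self_mem_nhdsWithin] with z hz hzγ htz
  refine (h.slope_toReal_norm_le (sub_pos.2 htz) hzγ.le (hA.mem t ht.le)
    (hA.mem z (ht.trans htz).le)).trans_lt ?_
  exact lt_sub_iff_add_lt'.1 hz

lemma toReal_norm_isSolution_le_of_pos (h : IsKernelBounded Φ C)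
    (hA : IsSolution (inducedNorm Φ) A₀ A) {a b : ℝ} (ha : 0 < a) (hab : a ≤ b) :
    (inducedNorm Φ (A b)).toReal ≤
      (inducedNorm Φ (A a)).toReal * Real.exp ((gammaN + C) * (b - a)) := by
  have hgronwall := le_gronwallBound_of_liminf_deriv_right_le
    (f := fun t => (inducedNorm Φ (A t)).toReal) (δ := (inducedNorm Φ (A a)).toReal) (ε := 0)
    ((h.continuousOn_toReal_norm hA).mono fun t ht => ha.le.trans ht.1)
    (fun t ht _ hr => (h.eventually_slope_toReal_norm_lt hA (ha.trans_le ht.1) hr).frequently)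
    le_rfl (fun _ _ => (add_zero _).ge) b ⟨hab, le_rfl⟩
  rwa [gronwallBound_ε0] at hgronwall

lemma norm_isSolution_le (h : IsKernelBounded Φ C) (hA : IsSolution (inducedNorm Φ) A₀ A) {t : ℝ}
    (ht : 0 ≤ t) :
    inducedNorm Φ (A t) ≤ ENNReal.ofReal (Real.exp ((gammaN + C) * t)) * inducedNorm Φ A₀ := by
  rw [← h.norm_congr hA.init]
  rcases ht.eq_or_lt with rfl | htpos
  · simp
  have hcont := (h.continuousOn_toReal_norm hA 0 self_mem_Ici).mono Ioi_subset_Ici_self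
  have hexp : Continuous fun a => Real.exp ((gammaN + C) * (t - a)) := by fun_prop
  have hle := ge_of_tendsto (hcont.tendsto.mul ((hexp.tendsto 0).mono_left nhdsWithin_le_nhds))
    (mem_of_superset (Ioo_mem_nhdsGT htpos) fun a ha =>
      h.toReal_norm_isSolution_le_of_pos hA ha.1 ha.2.le)
  rw [sub_zero, mul_comm] at hle
  rw [← ENNReal.ofReal_toReal (hA.mem t ht).2.ne, ← ENNReal.ofReal_toReal (hA.mem 0 le_rfl).2.ne,
    ← ENNReal.ofReal_mul (Real.exp_nonneg _)]
  exact ENNReal.ofReal_le_ofReal hle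

lemma tendsto_norm_sub_zero (h : IsKernelBounded Φ C) {l : Filter ℝ}
    (hA : ∀ᶠ s in l, AEStronglyMeasurable (A s) halfLine)
    (hB : ∀ᶠ s in l, AEStronglyMeasurable (B s) halfLine)
    (hlimA : Tendsto (fun s => inducedNorm Φ (A s)) l (𝓝 0))
    (hlimB : Tendsto (fun s => inducedNorm Φ (B s)) l (𝓝 0)) :
    Tendsto (fun s => inducedNorm Φ (A s - B s)) l (𝓝 0) := by
  have hlim := hlimA.add hlimB
  rw [add_zero] at hlim
  refine tendsto_of_tendsto_of_tendsto_of_le_of_le' tendsto_const_nhds hlim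
    (Eventually.of_forall fun _ => zero_le) ?_
  filter_upwards [hA, hB] with s hs hs' using h.norm_sub_le hs hs'

lemma isSolution_sub (h : IsKernelBounded Φ C) (hA : IsSolution (inducedNorm Φ) A₀ A)
    (hB : IsSolution (inducedNorm Φ) B₀ B) : IsSolution (inducedNorm Φ) (A₀ - B₀) (A - B) := by
  have hsub : ∀ {A₀ A}, IsSolution (inducedNorm Φ) A₀ A → ∀ t, 0 ≤ t → ∀ s, 0 ≤ s →
      AEStronglyMeasurable (A s - A t) halfLine :=
    fun hA t ht s hs => (hA.mem s hs).1.sub (hA.mem t ht).1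
  have hslope : ∀ {A₀ A}, IsSolution (inducedNorm Φ) A₀ A → ∀ t, 0 < t →
      ∀ᶠ s in 𝓝[≠] t, AEStronglyMeasurable ((s - t)⁻¹ • (A s - A t) - generator (A t)) halfLine :=
    fun hA t ht => mem_nhdsWithin_of_mem_nhds <| mem_of_superset (Ici_mem_nhds ht) fun s hs =>
      ((hsub hA t ht.le s hs).const_smul _).sub (h.memSpace_generator (hA.mem t ht.le)).1
  refine h.isSolution_of_slope (fun t ht => h.memSpace_sub (hA.mem t ht) (hB.mem t ht))
    (hA.init.sub hB.init) (fun t ht => ?_) fun t ht => ?_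
  · refine (h.tendsto_norm_sub_zero (mem_of_superset self_mem_nhdsWithin (hsub hA t ht))
      (mem_of_superset self_mem_nhdsWithin (hsub hB t ht)) (hA.continuous t ht)
      (hB.continuous t ht)).congr fun s => ?_
    rw [Pi.sub_apply, Pi.sub_apply, sub_sub_sub_comm]
  · refine (h.tendsto_norm_sub_zero (hslope hA t ht) (hslope hB t ht)
      (h.tendsto_norm_slope_isSolution_sub hA ht)
      (h.tendsto_norm_slope_isSolution_sub hB ht)).congr fun s => h.norm_congr ?_
    filter_upwards [h.generator_sub_ae_eq (hA.mem t ht.le) (hB.mem t ht.le)] with p hp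
    simp only [Pi.sub_apply, Pi.smul_apply, smul_eq_mul] at hp ⊢
    rw [hp]
    ring

lemma isSolution_unique (h : IsKernelBounded Φ C) (hA : IsSolution (inducedNorm Φ) A₀ A)
    (hB : IsSolution (inducedNorm Φ) A₀ B) {t : ℝ} (ht : 0 ≤ t) : A t =ᵐ[halfLine] B t := by
  have hle := h.norm_isSolution_le (h.isSolution_sub hA hB) ht
  rw [sub_self, h.norm_zero, mul_zero, nonpos_iff_eq_zero] at hle
  filter_upwards [h.ae_eq_zero ((hA.mem t ht).1.sub (hB.mem t ht).1).enorm hle] with p hp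
  exact sub_eq_zero.1 (enorm_eq_zero.1 hp)

lemma memSpace_of_isSolution (h : IsKernelBounded Φ C) (hA : IsSolution (inducedNorm Φ) A₀ A) :
    MemSpace (inducedNorm Φ) A₀ :=
  ⟨(hA.mem 0 le_rfl).1.congr hA.init, h.norm_congr hA.init ▸ (hA.mem 0 le_rfl).2⟩

lemma isSolution_ae_eq_solution (h : IsKernelBounded Φ C)
    (hA : IsSolution (inducedNorm Φ) A₀ A) {t : ℝ} (ht : 0 ≤ t) :
    A t =ᵐ[halfLine] solution A₀ t :=
  h.isSolution_unique hA (h.isSolution_solution (h.memSpace_of_isSolution hA)) ht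

end IsKernelBounded

/-- Well-posedness for initial data of arbitrary sign, nonnegativity being propagated: the variant
of `WellPosed` which does not restrict the equation to nonnegative data. -/
def SignedWellPosed (N : (ℝ → ℝ) → ℝ≥0∞) : Prop :=
  (∀ A₀ : ℝ → ℝ, MemSpace N A₀ → ∃ A : ℝ → ℝ → ℝ, IsSolution N A₀ A ∧
    (Nonneg A₀ → ∀ t, 0 ≤ t → Nonneg (A t)) ∧
      ∀ B : ℝ → ℝ → ℝ, IsSolution N A₀ B → ∀ t, 0 ≤ t → B t =ᵐ[halfLine] A t) ∧
  (∀ T : ℝ, 0 < T → ∃ C : ℝ, 0 < C ∧ ∀ (A₀ : ℝ → ℝ) (A : ℝ → ℝ → ℝ), IsSolution N A₀ A →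
    ∀ t ∈ Icc 0 T, N (A t) ≤ ENNReal.ofReal C * N A₀)

lemma SignedWellPosed.wellPosed {N : (ℝ → ℝ) → ℝ≥0∞} (h : SignedWellPosed N) : WellPosed N := by
  refine ⟨fun A₀ hA hpos => ?_, fun T hT => ?_⟩
  · obtain ⟨A, hsol, hnonneg, huniq⟩ := h.1 A₀ hA
    exact ⟨A, hsol, hnonneg hpos, huniq⟩
  · obtain ⟨C, hC, hle⟩ := h.2 T hT
    exact ⟨C, hC, fun A₀ A _ => hle A₀ A⟩

lemma IsKernelBounded.signedWellPosed {Φ : (ℝ → ℝ≥0∞) → ℝ≥0∞} {C : ℝ}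
    (h : IsKernelBounded Φ C) : SignedWellPosed (inducedNorm Φ) := by
  refine ⟨fun A₀ hA => ⟨solution A₀, h.isSolution_solution hA,
    fun hpos t ht => nonneg_solution hpos ht, fun B hB t ht => h.isSolution_ae_eq_solution hB ht⟩,
    fun T _ => ⟨Real.exp (|gammaN + C| * T), Real.exp_pos _, fun A₀ A hA t ht => ?_⟩⟩
  have hrate : (gammaN + C) * t ≤ |gammaN + C| * T :=
    mul_le_mul (le_abs_self _) ht.2 ht.1 (abs_nonneg _)
  exact (h.norm_isSolution_le hA ht.1).trans (by gcongr)

/-! ### The spaces `L^q_θ` -/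

section

variable {α : Type*} {m : MeasurableSpace α} {μ : Measure α} {q : ℝ}

lemma eLpNorm_ofReal_eq_lintegral_rpow (hq : 0 < q) (f : α → ℝ≥0∞) :
    eLpNorm f (ENNReal.ofReal q) μ = (∫⁻ x, f x ^ q ∂μ) ^ q⁻¹ := by
  rw [eLpNorm_eq_lintegral_rpow_enorm_toReal (by simpa using hq) ENNReal.ofReal_ne_top,
    ENNReal.toReal_ofReal hq.le, one_div]
  simp only [enorm_eq_self]

lemma eLpNorm_ofReal_le_iff (hq : 0 < q) {f : α → ℝ≥0∞} {a : ℝ≥0∞} :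
    eLpNorm f (ENNReal.ofReal q) μ ≤ a ↔ ∫⁻ x, f x ^ q ∂μ ≤ a ^ q := by
  rw [eLpNorm_ofReal_eq_lintegral_rpow hq, ENNReal.rpow_inv_le_iff hq]

lemma eLpNorm_ofReal_tsum_le (hq : 1 ≤ q) {ι : Type*} [Countable ι] {f : ι → α → ℝ≥0∞}
    (hf : ∀ i, AEMeasurable (f i) μ) :
    eLpNorm (fun x => ∑' i, f i x) (ENNReal.ofReal q) μ
      ≤ ∑' i, eLpNorm (f i) (ENNReal.ofReal q) μ := by
  have hq0 : 0 < q := one_pos.trans_le hq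
  have hsup : ∀ x, (∑' i, f i x) ^ q = ⨆ s : Finset ι, (∑ i ∈ s, f i x) ^ q := fun x => by
    rw [ENNReal.tsum_eq_iSup_sum]
    exact (ENNReal.orderIsoRpow q hq0).map_iSup _
  have hmono : Monotone fun (s : Finset ι) x => (∑ i ∈ s, f i x) ^ q := fun s t hst x =>
    ENNReal.rpow_le_rpow (Finset.sum_le_sum_of_subset hst) hq0.le
  have hmeas : ∀ s : Finset ι, AEMeasurable (fun x => (∑ i ∈ s, f i x) ^ q) μ := fun s =>
    (Finset.aemeasurable_fun_sum s fun i _ => hf i).pow_const q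
  rw [eLpNorm_ofReal_le_iff hq0]
  simp only [hsup]
  rw [lintegral_iSup_directed hmeas hmono.directed_le]
  refine iSup_le fun s => (eLpNorm_ofReal_le_iff hq0).1 ?_
  refine le_trans ?_ (ENNReal.sum_le_tsum s)
  simpa only [Finset.sum_fn] using eLpNorm_sum_le (fun i _ => (hf i).aestronglyMeasurable)
    (ENNReal.one_le_ofReal.2 hq) (s := s)

lemma lintegral_mul_rpow_le (hq : 1 ≤ q) {k g : α → ℝ≥0∞} (hk : AEMeasurable k μ)
    (hg : AEMeasurable g μ) :
    (∫⁻ x, k x * g x ∂μ) ^ q ≤ (∫⁻ x, k x ∂μ) ^ (q - 1) * ∫⁻ x, k x * g x ^ q ∂μ := by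
  have hq0 : 0 < q := one_pos.trans_le hq
  have hholder := eLpNorm'_le_eLpNorm'_mul_rpow_measure_univ (μ := μ.withDensity k) one_pos hq
    (hg.mono_ac (withDensity_absolutelyContinuous μ k)).aestronglyMeasurable
  simp only [eLpNorm'_eq_lintegral_enorm, enorm_eq_self, ENNReal.rpow_one, one_div_one] at hholder
  rw [lintegral_withDensity_eq_lintegral_mul₀ hk hg,
    lintegral_withDensity_eq_lintegral_mul₀ hk (hg.pow_const q),
    withDensity_apply _ MeasurableSet.univ, Measure.restrict_univ] at hholder
  refine (ENNReal.rpow_le_rpow hholder hq0.le).trans_eq ?_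
  rw [ENNReal.mul_rpow_of_nonneg _ _ hq0.le, ← ENNReal.rpow_mul, ← ENNReal.rpow_mul,
    one_div_mul_cancel hq0.ne', ENNReal.rpow_one, sub_mul, one_div_mul_cancel hq0.ne', one_mul,
    mul_comm]
  simp only [Pi.mul_apply]

end

/-- The measure `p^(2θ-1) dp` on the half line, which defines the space `L^q_θ`. -/
def weightedHalfLine (θ : ℝ) : Measure ℝ :=
  halfLine.withDensity fun p => ENNReal.ofReal (p ^ (2 * θ - 1))

lemma weightedHalfLine_absolutelyContinuous (θ : ℝ) : weightedHalfLine θ ≪ halfLine :=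
  withDensity_absolutelyContinuous _ _

lemma halfLine_absolutelyContinuous (θ : ℝ) : halfLine ≪ weightedHalfLine θ := by
  refine withDensity_absolutelyContinuous' (Measurable.aemeasurable (by fun_prop)) ?_
  filter_upwards [ae_halfLine_pos] with p hp
  exact (ENNReal.ofReal_pos.2 (Real.rpow_pos_of_pos hp _)).ne'

lemma lintegral_weightedHalfLine {θ : ℝ} {f : ℝ → ℝ≥0∞} (hf : AEMeasurable f halfLine) :
    ∫⁻ p, f p ∂weightedHalfLine θ = ∫⁻ p, f p * ENNReal.ofReal (p ^ (2 * θ - 1)) ∂halfLine := by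
  rw [weightedHalfLine,
    lintegral_withDensity_eq_lintegral_mul₀ (Measurable.aemeasurable (by fun_prop)) hf]
  exact lintegral_congr fun p => mul_comm _ _

/-- The norm of `L^q_θ` on extended nonnegative functions. -/
def normLqE (q θ : ℝ) (f : ℝ → ℝ≥0∞) : ℝ≥0∞ := eLpNorm f (ENNReal.ofReal q) (weightedHalfLine θ)

lemma normLq_eq (q θ : ℝ) : normLq q θ = inducedNorm (normLqE q θ) := by
  ext f
  exact (eLpNorm_enorm f).symm

lemma ofReal_rpow_mul_ofReal_rpow {p : ℝ} (hp : 0 < p) (r s : ℝ) :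
    ENNReal.ofReal (p ^ r) * ENNReal.ofReal (p ^ s) = ENNReal.ofReal (p ^ (r + s)) := by
  rw [← ENNReal.ofReal_mul (Real.rpow_nonneg hp.le r), ← Real.rpow_add hp]

lemma ofReal_rpow_neg_mul_cancel {p : ℝ} (hp : 0 < p) (r : ℝ) (x : ℝ≥0∞) :
    ENNReal.ofReal (p ^ (-r)) * (x * ENNReal.ofReal (p ^ r)) = x := by
  rw [mul_left_comm, ofReal_rpow_mul_ofReal_rpow hp, neg_add_cancel, Real.rpow_zero,
    ENNReal.ofReal_one, mul_one]

lemma ofReal_rpow_rpow {p : ℝ} (hp : 0 < p) (r s : ℝ) :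
    ENNReal.ofReal (p ^ r) ^ s = ENNReal.ofReal (p ^ (r * s)) := by
  rw [ENNReal.ofReal_rpow_of_pos (Real.rpow_pos_of_pos hp r), ← Real.rpow_mul hp.le]

section

variable {q c : ℝ} (hq : 1 ≤ q) (hc : -2 < c) (hc' : c < 5) {f : ℝ → ℝ≥0∞}
  (hf : AEMeasurable f halfLine)
include hq hc hc' hf

-- Jensen's inequality for the measure with density `|𝒱(p / x)| x^(-c-1)`, applied to `f(x) x^c`.
lemma absOp_rpow_le {p : ℝ} (hp : 0 < p) :
    absOp f p ^ q ≤ ENNReal.ofReal (kernelMoment c) ^ (q - 1) *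
      (ENNReal.ofReal (p ^ (-c * (q - 1))) *
        absOp (fun x => f x ^ q * ENNReal.ofReal (x ^ (c * (q - 1)))) p) := by
  set k : ℝ → ℝ≥0∞ := fun x => ‖kernelV (p / x) / x‖ₑ * ENNReal.ofReal (x ^ (-c)) with hk
  set g : ℝ → ℝ≥0∞ := fun x => f x * ENNReal.ofReal (x ^ c) with hg
  have hkm : AEMeasurable k halfLine :=
    ((measurable_kernelV_div.comp measurable_prodMk_left).enorm.mul (by fun_prop)).aemeasurable
  have hgm : AEMeasurable g halfLine := hf.mul (Measurable.aemeasurable (by fun_prop))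
  have hmean : ∫⁻ x, k x * g x ∂halfLine = absOp f p := by
    refine lintegral_congr_ae ?_
    filter_upwards [ae_halfLine_pos] with x hx
    rw [hk, hg, mul_assoc, ofReal_rpow_neg_mul_cancel hx]
  have hmass : ∫⁻ x, k x ∂halfLine
      = ENNReal.ofReal (kernelMoment c) * ENNReal.ofReal (p ^ (-c)) := by
    have heigen := absOp_rpow hp (r := -c) (by linarith) (by linarith)
    rwa [neg_neg, mul_comm, ENNReal.ofReal_mul (kernelMoment_nonneg c)] at heigen
  have hpower : ∫⁻ x, k x * g x ^ q ∂halfLine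
      = absOp (fun x => f x ^ q * ENNReal.ofReal (x ^ (c * (q - 1)))) p := by
    refine lintegral_congr_ae ?_
    filter_upwards [ae_halfLine_pos] with x hx
    rw [hk, hg, ENNReal.mul_rpow_of_nonneg _ _ (by linarith), ofReal_rpow_rpow hx, mul_assoc,
      mul_left_comm (ENNReal.ofReal (x ^ (-c))), ofReal_rpow_mul_ofReal_rpow hx,
      show -c + c * q = c * (q - 1) by ring]
  have hjensen := lintegral_mul_rpow_le hq hkm hgm
  rwa [hmean, hmass, hpower, ENNReal.mul_rpow_of_nonneg _ _ (by linarith), ofReal_rpow_rpow hp,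
    mul_assoc] at hjensen

lemma lintegral_absOp_rpow_mul_rpow_le :
    ∫⁻ p, absOp f p ^ q * ENNReal.ofReal (p ^ (c * q - 1)) ∂halfLine
      ≤ ENNReal.ofReal (kernelMoment c) ^ q *
        ∫⁻ p, f p ^ q * ENNReal.ofReal (p ^ (c * q - 1)) ∂halfLine := by
  set M := ENNReal.ofReal (kernelMoment c)
  set F : ℝ → ℝ≥0∞ := fun x => f x ^ q * ENNReal.ofReal (x ^ (c * (q - 1))) with hF
  have hFm : AEMeasurable F halfLine :=
    (hf.pow_const q).mul (Measurable.aemeasurable (by fun_prop))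
  have hMtop : M ^ (q - 1) ≠ ∞ :=
    ENNReal.rpow_ne_top_of_nonneg (by linarith) ENNReal.ofReal_ne_top
  calc ∫⁻ p, absOp f p ^ q * ENNReal.ofReal (p ^ (c * q - 1)) ∂halfLine
      ≤ ∫⁻ p, M ^ (q - 1) * (absOp F p * ENNReal.ofReal (p ^ (c - 1))) ∂halfLine := by
        refine lintegral_mono_ae ?_
        filter_upwards [ae_halfLine_pos] with p hp
        refine (mul_le_mul_left (absOp_rpow_le hq hc hc' hf hp) _).trans_eq ?_
        rw [show c - 1 = -c * (q - 1) + (c * q - 1) by ring, ← ofReal_rpow_mul_ofReal_rpow hp]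
        ring
    _ = M ^ (q - 1) * M * ∫⁻ p, F p * ENNReal.ofReal (p ^ (c - 1)) ∂halfLine := by
        rw [lintegral_const_mul' _ _ hMtop, lintegral_absOp_mul_rpow hFm hc hc', mul_assoc]
    _ = M ^ q * ∫⁻ p, f p ^ q * ENNReal.ofReal (p ^ (c * q - 1)) ∂halfLine := by
        congr 1
        · nth_rw 2 [← ENNReal.rpow_one M]
          rw [← ENNReal.rpow_add_of_nonneg _ _ (by linarith) zero_le_one, sub_add_cancel]
        · refine lintegral_congr_ae ?_
          filter_upwards [ae_halfLine_pos] with p hp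
          rw [hF, mul_assoc, ofReal_rpow_mul_ofReal_rpow hp,
            show c * (q - 1) + (c - 1) = c * q - 1 by ring]

end

section

variable {q θ : ℝ} (hq : 1 ≤ q) (hθ : θ ∈ Ioo (-q) (5 / 2 * q))
include hq hθ

lemma normLqE_absOp_le {f : ℝ → ℝ≥0∞} (hf : AEMeasurable f halfLine) :
    normLqE q θ (absOp f) ≤ ENNReal.ofReal (kernelMoment (2 * θ / q)) * normLqE q θ f := by
  have hq0 : 0 < q := one_pos.trans_le hq
  have hc : -2 < 2 * θ / q := by rw [lt_div_iff₀ hq0]; linarith [hθ.1]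
  have hc' : 2 * θ / q < 5 := by rw [div_lt_iff₀ hq0]; linarith [hθ.2]
  rw [normLqE, eLpNorm_ofReal_le_iff hq0, ENNReal.mul_rpow_of_nonneg _ _ hq0.le, normLqE,
    eLpNorm_ofReal_eq_lintegral_rpow hq0, ENNReal.rpow_inv_rpow hq0.ne',
    lintegral_weightedHalfLine ((measurable_absOp hf).pow_const q).aemeasurable,
    lintegral_weightedHalfLine (hf.pow_const q)]
  simpa only [div_mul_cancel₀ _ hq0.ne'] using lintegral_absOp_rpow_mul_rpow_le hq hc hc' hf

lemma isKernelBounded_normLqE : IsKernelBounded (normLqE q θ) (kernelMoment (2 * θ / q)) where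
  nonneg := kernelMoment_nonneg _
  mono hfg := eLpNorm_mono_enorm_ae ((weightedHalfLine_absolutelyContinuous θ).ae_le hfg)
  const_mul_le _ _ := eLpNorm_le_nnreal_smul_eLpNorm_of_ae_le_mul' (ae_of_all _ fun _ => le_rfl) _
  tsum_le _ hf :=
    eLpNorm_ofReal_tsum_le hq fun i => (hf i).mono_ac (weightedHalfLine_absolutelyContinuous θ)
  ae_eq_zero hf h0 := (halfLine_absolutelyContinuous θ).ae_le <| (eLpNorm_eq_zero_iff
    (hf.mono_ac (weightedHalfLine_absolutelyContinuous θ)).aestronglyMeasurable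
    (ENNReal.ofReal_pos.2 (one_pos.trans_le hq)).ne').1 h0
  absOp_le := normLqE_absOp_le hq hθ

end

/-! ### The spaces `𝒴_{a,b}` -/

/-- The norm of `𝒴_{a,b}` on extended nonnegative functions. -/
def normYE (a b : ℝ) (f : ℝ → ℝ≥0∞) : ℝ≥0∞ :=
  eLpNorm (fun p => ENNReal.ofReal (p ^ (-2 * a)) * f p) ∞ (volume.restrict (Ioo 0 1)) +
    eLpNorm (fun p => ENNReal.ofReal (p ^ (-2 * b)) * f p) ∞ (volume.restrict (Ioi 1))

lemma normY_eq (a b : ℝ) : normY a b = inducedNorm (normYE a b) := by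
  ext f
  refine congrArg₂ (· + ·) (eLpNorm_congr_enorm_ae ?_) (eLpNorm_congr_enorm_ae ?_)
  · filter_upwards [ae_restrict_mem measurableSet_Ioo] with p hp
    rw [mul_comm, enorm_mul_rpow hp.1, mul_comm, enorm_eq_self]
  · filter_upwards [ae_restrict_mem measurableSet_Ioi] with p hp
    rw [mul_comm, enorm_mul_rpow (one_pos.trans hp), mul_comm, enorm_eq_self]

lemma eLpNorm_top_tsum_le {α ι : Type*} [Countable ι] {m : MeasurableSpace α} {μ : Measure α}
    (f : ι → α → ℝ≥0∞) : eLpNorm (fun x => ∑' i, f i x) ∞ μ ≤ ∑' i, eLpNorm (f i) ∞ μ := by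
  simp only [eLpNorm_exponent_top]
  refine eLpNormEssSup_le_of_ae_enorm_bound ?_
  filter_upwards [ae_all_iff.2 fun i => ae_le_eLpNormEssSup (f := f i) (μ := μ)] with x hx
  exact ENNReal.tsum_le_tsum hx

lemma ae_halfLine_iff {P : ℝ → Prop} : (∀ᵐ p ∂halfLine, P p) ↔
    (∀ᵐ p ∂(volume.restrict (Ioo (0 : ℝ) 1)), P p) ∧
      ∀ᵐ p ∂(volume.restrict (Ioi (1 : ℝ))), P p := by
  rw [halfLine, ← Ioc_union_Ioi_eq_Ioi zero_le_one, ae_restrict_union_iff,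
    Measure.restrict_congr_set Ioo_ae_eq_Ioc]

lemma ofReal_rpow_neg_mul_le_iff {p : ℝ} (hp : 0 < p) (c : ℝ) {x s : ℝ≥0∞} :
    ENNReal.ofReal (p ^ (-2 * c)) * x ≤ s ↔ x ≤ s * ENNReal.ofReal (p ^ (2 * c)) := by
  rw [neg_mul, Real.rpow_neg hp.le, ENNReal.ofReal_inv_of_pos (Real.rpow_pos_of_pos hp _),
    mul_comm, ← div_eq_mul_inv, ENNReal.div_le_iff
      (ENNReal.ofReal_pos.2 (Real.rpow_pos_of_pos hp _)).ne' ENNReal.ofReal_ne_top]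

section

variable {a b : ℝ} {f : ℝ → ℝ≥0∞}

lemma normYE_le {s t : ℝ≥0∞}
    (hs : ∀ᵐ p ∂halfLine, p < 1 → f p ≤ s * ENNReal.ofReal (p ^ (2 * a)))
    (ht : ∀ᵐ p ∂halfLine, 1 < p → f p ≤ t * ENNReal.ofReal (p ^ (2 * b))) :
    normYE a b f ≤ s + t := by
  simp only [normYE, eLpNorm_exponent_top]
  refine add_le_add (eLpNormEssSup_le_of_ae_enorm_bound ?_)
    (eLpNormEssSup_le_of_ae_enorm_bound ?_)
  · filter_upwards [(ae_halfLine_iff.1 hs).1, ae_restrict_mem measurableSet_Ioo] with p hle hp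
    exact (ofReal_rpow_neg_mul_le_iff hp.1 a).2 (hle hp.2)
  · filter_upwards [(ae_halfLine_iff.1 ht).2, ae_restrict_mem measurableSet_Ioi] with p hle hp
    exact (ofReal_rpow_neg_mul_le_iff (one_pos.trans hp) b).2 (hle hp)

lemma ae_le_normYE (a b : ℝ) (f : ℝ → ℝ≥0∞) : ∀ᵐ p ∂halfLine,
    (p < 1 → f p ≤ normYE a b f * ENNReal.ofReal (p ^ (2 * a))) ∧
      (1 < p → f p ≤ normYE a b f * ENNReal.ofReal (p ^ (2 * b))) := by
  simp only [normYE, eLpNorm_exponent_top]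
  rw [ae_halfLine_iff]
  constructor
  · filter_upwards [ae_restrict_mem measurableSet_Ioo, ae_le_eLpNormEssSup
      (f := fun p => ENNReal.ofReal (p ^ (-2 * a)) * f p)] with p hp hle
    exact ⟨fun _ => (ofReal_rpow_neg_mul_le_iff hp.1 a).1 (hle.trans le_self_add),
      fun hp' => absurd hp' hp.2.not_gt⟩
  · filter_upwards [ae_restrict_mem measurableSet_Ioi, ae_le_eLpNormEssSup
      (f := fun p => ENNReal.ofReal (p ^ (-2 * b)) * f p)] with p hp hle
    exact ⟨fun hp' => absurd hp' (lt_asymm hp),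
      fun _ => (ofReal_rpow_neg_mul_le_iff (one_pos.trans hp) b).1 (hle.trans le_add_self)⟩

lemma ae_le_normYE_mul_add (f : ℝ → ℝ≥0∞) {d e : ℝ}
    (hd : ∀ p : ℝ, 0 < p → p < 1 → p ^ (2 * a) ≤ p ^ d + p ^ e)
    (he : ∀ p : ℝ, 1 < p → p ^ (2 * b) ≤ p ^ d + p ^ e) :
    ∀ᵐ p ∂halfLine, f p ≤ normYE a b f * (ENNReal.ofReal (p ^ d) + ENNReal.ofReal (p ^ e)) := by
  filter_upwards [ae_le_normYE a b f, ae_halfLine_pos, ae_halfLine_ne 1] with p hle hp hp1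
  rw [← ENNReal.ofReal_add (Real.rpow_nonneg hp.le _) (Real.rpow_nonneg hp.le _)]
  rcases lt_or_gt_of_ne hp1 with hlt | hgt
  · exact (hle.1 hlt).trans (by gcongr; exact hd p hp hlt)
  · exact (hle.2 hgt).trans (by gcongr; exact he p hgt)

lemma absOp_le_of_le_add_rpow {s : ℝ≥0∞} {p d e : ℝ} (hp : 0 < p) (hd : -5 < d) (hd' : d < 2)
    (he : -5 < e) (he' : e < 2) (hed : p ^ e ≤ p ^ d)
    (hf : ∀ᵐ q ∂halfLine, f q ≤ s * (ENNReal.ofReal (q ^ d) + ENNReal.ofReal (q ^ e))) :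
    absOp f p ≤ ENNReal.ofReal (kernelMoment (-d) + kernelMoment (-e)) * s *
      ENNReal.ofReal (p ^ d) := by
  have hm : ∀ r : ℝ, Measurable fun q => ‖kernelV (p / q) / q‖ₑ * ENNReal.ofReal (q ^ r) :=
    fun r => (measurable_kernelV_div.comp measurable_prodMk_left).enorm.mul (by fun_prop)
  have hsum : Measurable fun q => ‖kernelV (p / q) / q‖ₑ * ENNReal.ofReal (q ^ d) +
      ‖kernelV (p / q) / q‖ₑ * ENNReal.ofReal (q ^ e) := (hm d).add (hm e)
  calc absOp f p
      ≤ ∫⁻ q, s * (‖kernelV (p / q) / q‖ₑ * ENNReal.ofReal (q ^ d) +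
          ‖kernelV (p / q) / q‖ₑ * ENNReal.ofReal (q ^ e)) ∂halfLine := by
        refine lintegral_mono_ae ?_
        filter_upwards [hf] with q hq
        rw [← mul_add, mul_left_comm]
        gcongr
    _ = s * (absOp (fun q => ENNReal.ofReal (q ^ d)) p +
          absOp (fun q => ENNReal.ofReal (q ^ e)) p) := by
        rw [lintegral_const_mul _ hsum, lintegral_add_left (hm d), absOp, absOp]
    _ ≤ s * (ENNReal.ofReal (p ^ d * kernelMoment (-d)) +
          ENNReal.ofReal (p ^ d * kernelMoment (-e))) := by
        rw [absOp_rpow hp hd hd', absOp_rpow hp he he']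
        gcongr
        exact kernelMoment_nonneg _
    _ = ENNReal.ofReal (kernelMoment (-d) + kernelMoment (-e)) * s * ENNReal.ofReal (p ^ d) := by
        rw [ENNReal.ofReal_mul (Real.rpow_nonneg hp.le d),
          ENNReal.ofReal_mul (Real.rpow_nonneg hp.le d),
          ENNReal.ofReal_add (kernelMoment_nonneg _) (kernelMoment_nonneg _)]
        ring

end

section

variable {a b : ℝ} (ha : a ∈ Ioo (-(5 / 2) : ℝ) 1) (hb : b ∈ Ioo (-(5 / 2) : ℝ) 1)
include ha hb

-- On `(0, 1)` the function is compared with `p^(2a) + p^(2 max a b)`, whose first term dominates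
-- there, and on `(1, ∞)` with `p^(2b) + p^(2 min a b)`; both sums are majorants on all of `(0, ∞)`.
lemma normYE_absOp_le (f : ℝ → ℝ≥0∞) : normYE a b (absOp f) ≤
    ENNReal.ofReal ((kernelMoment (-(2 * a)) + kernelMoment (-(2 * max a b))) +
      (kernelMoment (-(2 * b)) + kernelMoment (-(2 * min a b)))) * normYE a b f := by
  obtain ⟨ha, ha'⟩ := ha
  obtain ⟨hb, hb'⟩ := hb
  have hmax : max a b < 1 := max_lt ha' hb'
  have hmin : -(5 / 2) < min a b := lt_min ha hb
  have hamax := le_max_left a b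
  have hbmax := le_max_right a b
  have hamin := min_le_left a b
  have hbmin := min_le_right a b
  have hnear : ∀ᵐ p ∂halfLine, f p ≤ normYE a b f *
      (ENNReal.ofReal (p ^ (2 * a)) + ENNReal.ofReal (p ^ (2 * max a b))) :=
    ae_le_normYE_mul_add f
      (fun p hp _ => le_add_of_nonneg_right (Real.rpow_nonneg hp.le _))
      (fun p hp => (Real.rpow_le_rpow_of_exponent_le hp.le (by linarith)).trans
        (le_add_of_nonneg_left (Real.rpow_nonneg (one_pos.trans hp).le _)))
  have hfar : ∀ᵐ p ∂halfLine, f p ≤ normYE a b f *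
      (ENNReal.ofReal (p ^ (2 * b)) + ENNReal.ofReal (p ^ (2 * min a b))) :=
    ae_le_normYE_mul_add f
      (fun p hp hp1 => (Real.rpow_le_rpow_of_exponent_ge hp hp1.le (by linarith)).trans
        (le_add_of_nonneg_left (Real.rpow_nonneg hp.le _)))
      (fun p hp => le_add_of_nonneg_right (Real.rpow_nonneg (one_pos.trans hp).le _))
  rw [ENNReal.ofReal_add (add_nonneg (kernelMoment_nonneg _) (kernelMoment_nonneg _))
    (add_nonneg (kernelMoment_nonneg _) (kernelMoment_nonneg _)), add_mul]
  refine normYE_le ?_ ?_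
  · filter_upwards [ae_halfLine_pos] with p hp hp1
    exact absOp_le_of_le_add_rpow hp (by linarith) (by linarith) (by linarith) (by linarith)
      (Real.rpow_le_rpow_of_exponent_ge hp hp1.le (by linarith)) hnear
  · filter_upwards [ae_halfLine_pos] with p hp hp1
    exact absOp_le_of_le_add_rpow hp (by linarith) (by linarith) (by linarith) (by linarith)
      (Real.rpow_le_rpow_of_exponent_le hp1.le (by linarith)) hfar

lemma isKernelBounded_normYE : IsKernelBounded (normYE a b)
    ((kernelMoment (-(2 * a)) + kernelMoment (-(2 * max a b))) +
      (kernelMoment (-(2 * b)) + kernelMoment (-(2 * min a b)))) where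
  nonneg := add_nonneg (add_nonneg (kernelMoment_nonneg _) (kernelMoment_nonneg _))
    (add_nonneg (kernelMoment_nonneg _) (kernelMoment_nonneg _))
  mono hfg := by
    obtain ⟨hnear, hfar⟩ := ae_halfLine_iff.1 hfg
    exact add_le_add (eLpNorm_mono_enorm_ae (hnear.mono fun p hp => mul_le_mul_right hp _))
      (eLpNorm_mono_enorm_ae (hfar.mono fun p hp => mul_le_mul_right hp _))
  const_mul_le c f := by
    rw [normYE, normYE, mul_add]
    simp only [mul_left_comm _ (c : ℝ≥0∞)]
    exact add_le_add
      (eLpNorm_le_nnreal_smul_eLpNorm_of_ae_le_mul' (ae_of_all _ fun _ => le_rfl) _)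
      (eLpNorm_le_nnreal_smul_eLpNorm_of_ae_le_mul' (ae_of_all _ fun _ => le_rfl) _)
  tsum_le f _ := by
    simp only [normYE, ← ENNReal.tsum_mul_left]
    rw [ENNReal.tsum_add]
    exact add_le_add (eLpNorm_top_tsum_le _) (eLpNorm_top_tsum_le _)
  ae_eq_zero _ h0 := by
    filter_upwards [ae_le_normYE a b _, ae_halfLine_ne 1] with p hp hp1
    rw [h0, zero_mul, zero_mul, nonpos_iff_eq_zero] at hp
    exact (lt_or_gt_of_ne hp1).elim hp.1 hp.2
  absOp_le _ := normYE_absOp_le ha hb _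

end

/-! ### Moments of solutions -/

section

variable {c : ℝ}

lemma normLqE_one {f : ℝ → ℝ≥0∞} (hf : AEMeasurable f halfLine) :
    normLqE 1 (c / 2) f = ∫⁻ p, f p * ENNReal.ofReal (p ^ (c - 1)) ∂halfLine := by
  rw [normLqE, ENNReal.ofReal_one, eLpNorm_one_eq_lintegral_enorm]
  simp only [enorm_eq_self]
  rw [lintegral_weightedHalfLine hf, mul_div_cancel₀ c two_ne_zero]

lemma memSpace_normLqE_one_iff {f : ℝ → ℝ} (hf : AEStronglyMeasurable f halfLine) :
    MemSpace (inducedNorm (normLqE 1 (c / 2))) f ↔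
      Integrable (fun p => f p * p ^ (c - 1)) halfLine := by
  rw [integrable_mul_rpow_iff hf, ← normLqE_one hf.enorm]
  exact and_iff_right hf

lemma inducedNorm_normLqE_one {f : ℝ → ℝ} (hf : AEStronglyMeasurable f halfLine)
    (hi : Integrable (fun p => f p * p ^ (c - 1)) halfLine) :
    inducedNorm (normLqE 1 (c / 2)) f =
      ENNReal.ofReal (∫ p, |f p| * p ^ (c - 1) ∂halfLine) := by
  have habs : ∀ᵐ p ∂halfLine, ‖f p * p ^ (c - 1)‖ = |f p| * p ^ (c - 1) := by
    filter_upwards [ae_halfLine_pos] with p hp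
    rw [Real.norm_eq_abs, abs_mul, abs_of_pos (Real.rpow_pos_of_pos hp _)]
  rw [inducedNorm, normLqE_one hf.enorm, ← integral_congr_ae habs,
    ofReal_integral_norm_eq_lintegral_enorm hi]
  refine lintegral_congr_ae ?_
  filter_upwards [ae_halfLine_pos] with p hp using (enorm_mul_rpow hp _ _).symm

lemma aestronglyMeasurable_mul_iterate_mul_rpow {f : ℝ → ℝ}
    (hf : AEStronglyMeasurable f halfLine) (d : ℕ → ℝ) (n : ℕ) :
    AEStronglyMeasurable (fun p => d n * kernelOp^[n] f p * p ^ (c - 1)) halfLine :=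
  ((aestronglyMeasurable_iterate hf n).const_mul _).mul
    (Measurable.aestronglyMeasurable (by fun_prop))

end

section

variable {c : ℝ} (hc : -2 < c) (hc' : c < 5)
include hc hc'

lemma isKernelBounded_normLqE_one : IsKernelBounded (normLqE 1 (c / 2)) (kernelMoment c) := by
  have h := isKernelBounded_normLqE (q := 1) (θ := c / 2) le_rfl ⟨by linarith, by linarith⟩
  rwa [div_one, mul_div_cancel₀ c two_ne_zero] at h

variable {f : ℝ → ℝ} (hf : AEStronglyMeasurable f halfLine)
  (hi : Integrable (fun p => f p * p ^ (c - 1)) halfLine)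
include hf hi

lemma integrable_iterate_mul_rpow (n : ℕ) :
    Integrable (fun p => kernelOp^[n] f p * p ^ (c - 1)) halfLine := by
  induction n with
  | zero => exact hi
  | succ n ih =>
    rw [Function.iterate_succ_apply']
    exact integrable_kernelOp_mul_rpow (aestronglyMeasurable_iterate hf n) hc hc' ih

lemma integral_iterate_mul_rpow (n : ℕ) :
    ∫ p, kernelOp^[n] f p * p ^ (c - 1) ∂halfLine
      = kernelMoment c ^ n * ∫ p, f p * p ^ (c - 1) ∂halfLine := by
  induction n with
  | zero => simp
  | succ n ih =>
    rw [Function.iterate_succ_apply', integral_kernelOp_mul_rpow (aestronglyMeasurable_iterate hf n)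
      hc hc' (integrable_iterate_mul_rpow hc hc' hf hi n), ih, pow_succ', mul_assoc]

lemma integrable_solution_mul_rpow (t : ℝ) :
    Integrable (fun p => solution f t p * p ^ (c - 1)) halfLine := by
  have hmem := (isKernelBounded_normLqE_one hc hc').memSpace_solution
    ((memSpace_normLqE_one_iff hf).2 hi) t
  exact (memSpace_normLqE_one_iff hmem.1).1 hmem

lemma tsum_lintegral_enorm_solCoef_mul_lt_top (t : ℝ) :
    ∑' n, ∫⁻ p, ‖solCoef t n * kernelOp^[n] f p * p ^ (c - 1)‖ₑ ∂halfLine < ∞ := by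
  have hlt := (isKernelBounded_normLqE_one hc hc').tsum_enorm_lt_top
    ((memSpace_normLqE_one_iff hf).2 hi) (summable_abs_solCoef_mul_pow t (kernelMoment c))
  rw [normLqE_one (aemeasurable_tsum_enorm hf _)] at hlt
  rw [← lintegral_tsum fun n =>
    (aestronglyMeasurable_mul_iterate_mul_rpow hf (solCoef t) n).enorm]
  refine (lintegral_congr_ae ?_).trans_lt hlt
  filter_upwards [ae_halfLine_pos] with p hp
  rw [← ENNReal.tsum_mul_right]
  exact tsum_congr fun n => enorm_mul_rpow hp _ _

lemma integral_solution_mul_rpow (t : ℝ) :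
    ∫ p, solution f t p * p ^ (c - 1) ∂halfLine
      = Real.exp ((gammaN + kernelMoment c) * t) * ∫ p, f p * p ^ (c - 1) ∂halfLine := by
  calc ∫ p, solution f t p * p ^ (c - 1) ∂halfLine
      = ∫ p, ∑' n, solCoef t n * kernelOp^[n] f p * p ^ (c - 1) ∂halfLine := by
        simp only [solution, opSeries, tsum_mul_right]
    _ = ∑' n, ∫ p, solCoef t n * kernelOp^[n] f p * p ^ (c - 1) ∂halfLine :=
        integral_tsum (aestronglyMeasurable_mul_iterate_mul_rpow hf (solCoef t))
          (tsum_lintegral_enorm_solCoef_mul_lt_top hc hc' hf hi t).ne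
    _ = ∑' n, solCoef t n * kernelMoment c ^ n * ∫ p, f p * p ^ (c - 1) ∂halfLine := by
        simp only [mul_assoc, integral_const_mul, integral_iterate_mul_rpow hc hc' hf hi]
    _ = Real.exp ((gammaN + kernelMoment c) * t) * ∫ p, f p * p ^ (c - 1) ∂halfLine := by
        rw [tsum_mul_right, (hasSum_solCoef t (kernelMoment c)).tsum_eq]

lemma integral_abs_solution_mul_rpow_le {t : ℝ} (ht : 0 ≤ t) :
    ∫ p, |solution f t p| * p ^ (c - 1) ∂halfLine
      ≤ Real.exp ((gammaN + kernelMoment c) * t) * ∫ p, |f p| * p ^ (c - 1) ∂halfLine := by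
  have h := isKernelBounded_normLqE_one hc hc'
  have hmem := (memSpace_normLqE_one_iff hf).2 hi
  have hle := h.norm_isSolution_le (h.isSolution_solution hmem) ht
  rw [inducedNorm_normLqE_one (h.memSpace_solution hmem t).1
    (integrable_solution_mul_rpow hc hc' hf hi t), inducedNorm_normLqE_one hf hi,
    ← ENNReal.ofReal_mul (Real.exp_nonneg _)] at hle
  refine (ENNReal.ofReal_le_ofReal_iff (mul_nonneg (Real.exp_nonneg _) ?_)).1 hle
  refine integral_nonneg_of_ae ?_
  filter_upwards [ae_halfLine_pos] with p hp
  exact mul_nonneg (abs_nonneg _) (Real.rpow_nonneg hp.le _)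

end

/-- A solution in some space on which the integral operator is bounded. Every solution in one of
the spaces `L^q_θ` or `𝒴_{a,b}` is of this kind. -/
def IsSolutionInKernelBoundedSpace (A₀ : ℝ → ℝ) (A : ℝ → ℝ → ℝ) : Prop :=
  ∃ Φ C, IsKernelBounded Φ C ∧ IsSolution (inducedNorm Φ) A₀ A

lemma IsSolutionInSomeSpace.isSolutionInKernelBoundedSpace {A₀ : ℝ → ℝ} {A : ℝ → ℝ → ℝ}
    (hA : IsSolutionInSomeSpace A₀ A) : IsSolutionInKernelBoundedSpace A₀ A := by
  rcases hA with ⟨q, θ, hq, ⟨hθ, hθ'⟩, hA⟩ | ⟨a, b, ⟨hb, hb', ha, ha'⟩, hA⟩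
  · rw [normLq_eq] at hA
    exact ⟨_, _, isKernelBounded_normLqE hq ⟨by linarith, by linarith⟩, hA⟩
  · rw [normY_eq] at hA
    exact ⟨_, _, isKernelBounded_normYE ⟨by linarith, ha'⟩ ⟨hb, by linarith⟩, hA⟩

lemma rpow_three_sub_one (p : ℝ) : p ^ ((3 : ℝ) - 1) = p ^ 2 := by
  rw [show (3 : ℝ) - 1 = 2 by norm_num, Real.rpow_ofNat]

namespace IsSolutionInKernelBoundedSpace

variable {A₀ : ℝ → ℝ} {A : ℝ → ℝ → ℝ}

lemma ae_eq_solution (hA : IsSolutionInKernelBoundedSpace A₀ A) {t : ℝ} (ht : 0 ≤ t) :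
    A t =ᵐ[halfLine] solution A₀ t := by
  obtain ⟨Φ, C, h, hA⟩ := hA
  exact h.isSolution_ae_eq_solution hA ht

lemma aestronglyMeasurable_init (hA : IsSolutionInKernelBoundedSpace A₀ A) :
    AEStronglyMeasurable A₀ halfLine := by
  obtain ⟨Φ, C, h, hA⟩ := hA
  exact (h.memSpace_of_isSolution hA).1

section

variable (hA : IsSolutionInKernelBoundedSpace A₀ A) {c t : ℝ} (hc : -2 < c) (hc' : c < 5)
  (hi : Integrable (fun p => A₀ p * p ^ (c - 1)) halfLine) (ht : 0 ≤ t)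
include hA hc hc' hi ht

lemma integrable_mul_rpow : Integrable (fun p => A t p * p ^ (c - 1)) halfLine :=
  (integrable_solution_mul_rpow hc hc' hA.aestronglyMeasurable_init hi t).congr
    ((hA.ae_eq_solution ht).symm.mul .rfl)

lemma integral_mul_rpow : ∫ p, A t p * p ^ (c - 1) ∂halfLine =
    Real.exp ((gammaN + kernelMoment c) * t) * ∫ p, A₀ p * p ^ (c - 1) ∂halfLine :=
  (integral_congr_ae ((hA.ae_eq_solution ht).mul .rfl)).trans
    (integral_solution_mul_rpow hc hc' hA.aestronglyMeasurable_init hi t)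

end

section

variable (hA : IsSolutionInKernelBoundedSpace A₀ A) (hi : Integrable A₀ halfLine) {t : ℝ}
  (ht : 0 ≤ t)
include hA hi ht

lemma integrable : Integrable (A t) halfLine := by
  simpa using hA.integrable_mul_rpow (c := 1) (by norm_num) (by norm_num) (by simpa using hi) ht

lemma integral_eq : ∫ p, A t p ∂halfLine = ∫ p, A₀ p ∂halfLine := by
  simpa [gammaN_eq_neg_kernelMoment] using
    hA.integral_mul_rpow (c := 1) (by norm_num) (by norm_num) (by simpa using hi) ht

end

section

variable (hA : IsSolutionInKernelBoundedSpace A₀ A)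
  (hi : Integrable (fun p => A₀ p * p ^ 2) halfLine) {t : ℝ} (ht : 0 ≤ t)
include hA hi ht

lemma integrable_mul_sq : Integrable (fun p => A t p * p ^ 2) halfLine := by
  simp only [← rpow_three_sub_one] at hi ⊢
  exact hA.integrable_mul_rpow (by norm_num) (by norm_num) hi ht

lemma integral_mul_sq : ∫ p, A t p * p ^ 2 ∂halfLine =
    Real.exp ((kernelMoment 3 - kernelMoment 1) * t) * ∫ p, A₀ p * p ^ 2 ∂halfLine := by
  simp only [← rpow_three_sub_one] at hi ⊢
  rw [hA.integral_mul_rpow (by norm_num) (by norm_num) hi ht, gammaN_eq_neg_kernelMoment,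
    neg_add_eq_sub]

end

end IsSolutionInKernelBoundedSpace

/-! ### The explicit bound in `L^q_0` -/

lemma normLq_one_zero_kernelV : normLq 1 0 kernelV = ENNReal.ofReal (kernelMoment 0) := by
  have hone := normLqE_one (c := 0) measurable_kernelV.enorm.aemeasurable
  rw [zero_div] at hone
  rw [normLq_eq, inducedNorm, hone, ← lintegral_enorm_kernelV_mul_rpow (by norm_num) (by norm_num)]
  refine lintegral_congr_ae ?_
  filter_upwards [ae_halfLine_pos] with p hp using (enorm_mul_rpow hp _ _).symm

lemma memSpace_normLq_one_zero_kernelV : MemSpace (normLq 1 0) kernelV :=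
  ⟨measurable_kernelV.aestronglyMeasurable, normLq_one_zero_kernelV ▸ ENNReal.ofReal_lt_top⟩

lemma exp_mul_le_one_add {K t : ℝ} (hK : 1 ≤ K) (ht : 0 ≤ t) :
    Real.exp (K * t) ≤ 1 + K * (Real.exp (K * t) - 1) := by
  have hexp : 1 ≤ Real.exp (K * t) := Real.one_le_exp (by positivity)
  nlinarith

lemma normLq_zero_isSolution_le {q : ℝ} (hq : 1 ≤ q) {A₀ : ℝ → ℝ} {A : ℝ → ℝ → ℝ}
    (hA : IsSolution (normLq q 0) A₀ A) {t : ℝ} (ht : 0 ≤ t) :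
    normLq q 0 (A t) ≤ ENNReal.ofReal (Real.exp (gammaN * t) *
      (1 + (normLq 1 0 kernelV).toReal *
        (Real.exp ((normLq 1 0 kernelV).toReal * t) - 1))) * normLq q 0 A₀ := by
  have h := isKernelBounded_normLqE hq (θ := 0) ⟨by linarith, by linarith⟩
  rw [mul_zero, zero_div] at h
  rw [normLq_one_zero_kernelV, ENNReal.toReal_ofReal (kernelMoment_nonneg 0)]
  rw [normLq_eq] at hA ⊢
  refine (h.norm_isSolution_le hA ht).trans ?_
  rw [add_mul, Real.exp_add]
  gcongr
  exact exp_mul_le_one_add one_le_kernelMoment_zero ht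

/-! ### Long time behaviour -/

lemma setLIntegral_mul_rpow_lt_top {f : ℝ → ℝ≥0∞} {s : ℝ≥0∞} {S : Set ℝ} {r c : ℝ} (hs : s ≠ ∞)
    (hS : MeasurableSet S) (hpos : S ⊆ Ioi 0) (hint : IntegrableOn (fun p => p ^ (r + c)) S)
    (hf : ∀ᵐ p ∂(volume.restrict S), f p ≤ s * ENNReal.ofReal (p ^ r)) :
    ∫⁻ p in S, f p * ENNReal.ofReal (p ^ c) < ∞ := by
  calc ∫⁻ p in S, f p * ENNReal.ofReal (p ^ c)
      ≤ ∫⁻ p in S, s * ‖p ^ (r + c)‖ₑ := by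
        refine lintegral_mono_ae ?_
        filter_upwards [hf, ae_restrict_mem hS] with p hp hpS
        have hp0 : 0 < p := hpos hpS
        rw [Real.enorm_of_nonneg (Real.rpow_nonneg hp0.le _), ← ofReal_rpow_mul_ofReal_rpow hp0,
          ← mul_assoc]
        gcongr
    _ = s * ∫⁻ p in S, ‖p ^ (r + c)‖ₑ := lintegral_const_mul' _ _ hs
    _ < ∞ := ENNReal.mul_lt_top hs.lt_top hint.2

lemma integrable_of_memSpace_normY {a b : ℝ} (ha : -(1 / 2) < a) (hb : b < -(1 / 2)) {f : ℝ → ℝ}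
    (hf : MemSpace (normY a b) f) : Integrable f halfLine := by
  rw [normY_eq] at hf
  obtain ⟨hnear, hfar⟩ := ae_halfLine_iff.1 (ae_le_normYE a b fun p => ‖f p‖ₑ)
  have hi : IntegrableOn (fun p : ℝ => p ^ (2 * a + 0)) (Ioo 0 1) := by
    rw [← intervalIntegrable_iff_integrableOn_Ioo_of_le zero_le_one]
    exact intervalIntegral.intervalIntegrable_rpow' (by linarith)
  have hi' : IntegrableOn (fun p : ℝ => p ^ (2 * b + 0)) (Ioi 1) :=
    integrableOn_Ioi_rpow_of_lt (by linarith) one_pos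
  have hmoment : Integrable (fun p => f p * p ^ (0 : ℝ)) halfLine := by
    rw [integrable_mul_rpow_iff hf.1, lintegral_halfLine_eq_add]
    refine ENNReal.add_lt_top.2 ⟨setLIntegral_mul_rpow_lt_top hf.2.ne measurableSet_Ioo
      (fun p hp => hp.1) hi ?_, setLIntegral_mul_rpow_lt_top hf.2.ne measurableSet_Ioi
      (Ioi_subset_Ioi zero_le_one) hi' ?_⟩
    · filter_upwards [hnear, ae_restrict_mem measurableSet_Ioo] with p hle hp using hle.1 hp.2
    · filter_upwards [hfar, ae_restrict_mem measurableSet_Ioi] with p hle hp using hle.2 hp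
  simpa only [Real.rpow_zero, mul_one] using hmoment

lemma exists_abs_sub_le_add_mul_rpow {φ : ℝ → ℝ} (hφ : ContinuousWithinAt φ (Ici 0) 0) {M : ℝ}
    (hM : ∀ p, 0 ≤ p → |φ p| ≤ M) {ε : ℝ} (hε : 0 < ε) :
    ∃ K, 0 ≤ K ∧ ∀ p, 0 < p → |φ p - φ 0| ≤ ε + K * p ^ (1 / 2 : ℝ) := by
  obtain ⟨δ, hδ, hclose⟩ := Metric.continuousWithinAt_iff.1 hφ ε hε
  have hM0 : 0 ≤ M := (abs_nonneg _).trans (hM 0 le_rfl)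
  have hδ0 : 0 < δ ^ (1 / 2 : ℝ) := Real.rpow_pos_of_pos hδ _
  refine ⟨(M + M) / δ ^ (1 / 2 : ℝ), by positivity, fun p hp => ?_⟩
  rcases lt_or_ge p δ with hlt | hge
  · have hnear : |φ p - φ 0| < ε := hclose hp.le (by rwa [Real.dist_eq, sub_zero, abs_of_pos hp])
    exact hnear.le.trans (le_add_of_nonneg_right (by positivity))
  · refine ((abs_sub _ _).trans (add_le_add (hM p hp.le) (hM 0 le_rfl))).trans
      (le_add_of_nonneg_of_le hε.le ?_)
    rw [div_mul_eq_mul_div, le_div_iff₀ hδ0]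
    gcongr

lemma tendsto_exp_mul_atTop_nhds_zero {l : ℝ} (hl : l < 0) :
    Tendsto (fun t => Real.exp (l * t)) atTop (𝓝 0) :=
  Real.tendsto_exp_atBot.comp (tendsto_id.const_mul_atTop_of_neg hl)

lemma tendsto_zero_of_abs_le_mul_add {α : Type*} {l : Filter α} {F : α → ℝ} {I : ℝ} (hI : 0 ≤ I)
    (h : ∀ ε, 0 < ε → ∃ G : α → ℝ, Tendsto G l (𝓝 0) ∧ ∀ᶠ t in l, |F t| ≤ ε * I + G t) :
    Tendsto F l (𝓝 0) := by
  refine Metric.tendsto_nhds.2 fun δ hδ => ?_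
  obtain ⟨G, hG, hle⟩ := h (δ / (I + 1)) (by positivity)
  have hlt : δ / (I + 1) * I + 0 < δ := by
    rw [add_zero, div_mul_eq_mul_div, div_lt_iff₀ (by positivity)]
    nlinarith
  filter_upwards [hle, (hG.const_add _).eventually_lt_const hlt] with t hFt hGt
  rw [Real.dist_eq, sub_zero]
  exact hFt.trans_lt hGt

section

variable {f : ℝ → ℝ} (hf : Integrable f halfLine)
include hf

lemma integrable_solution (t : ℝ) : Integrable (solution f t) halfLine := by
  simpa using integrable_solution_mul_rpow (c := 1) (by norm_num) (by norm_num) hf.1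
    (by simpa using hf) t

lemma integral_abs_solution_le {t : ℝ} (ht : 0 ≤ t) :
    ∫ p, |solution f t p| ∂halfLine ≤ ∫ p, |f p| ∂halfLine := by
  simpa [gammaN_eq_neg_kernelMoment] using
    integral_abs_solution_mul_rpow_le (c := 1) (by norm_num) (by norm_num) hf.1
      (by simpa using hf) ht

lemma abs_integral_mul_le {ψ : ℝ → ℝ} {B : ℝ} (hψ : ∀ p, 0 < p → |ψ p| ≤ B) :
    |∫ p, f p * ψ p ∂halfLine| ≤ B * ∫ p, |f p| ∂halfLine := by
  rw [← integral_const_mul, ← Real.norm_eq_abs]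
  refine norm_integral_le_of_norm_le (hf.abs.const_mul B) ?_
  filter_upwards [ae_halfLine_pos] with p hp
  rw [Real.norm_eq_abs, abs_mul, mul_comm]
  exact mul_le_mul_of_nonneg_right (hψ p hp) (abs_nonneg _)

lemma abs_integral_mul_le_add {r : ℝ} (hr : Integrable (fun p => f p * p ^ r) halfLine)
    {ψ : ℝ → ℝ} {B K : ℝ} (hψ : ∀ p, 0 < p → |ψ p| ≤ B + K * p ^ r) :
    |∫ p, f p * ψ p ∂halfLine| ≤
      B * ∫ p, |f p| ∂halfLine + K * ∫ p, |f p| * p ^ r ∂halfLine := by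
  have hr' : Integrable (fun p => |f p| * p ^ r) halfLine := by
    refine hr.abs.congr ?_
    filter_upwards [ae_halfLine_pos] with p hp
    rw [abs_mul, abs_of_pos (Real.rpow_pos_of_pos hp r)]
  rw [← integral_const_mul, ← integral_const_mul, ← Real.norm_eq_abs,
    ← integral_add (hf.abs.const_mul B) (hr'.const_mul K)]
  refine norm_integral_le_of_norm_le ((hf.abs.const_mul B).add (hr'.const_mul K)) ?_
  filter_upwards [ae_halfLine_pos] with p hp
  rw [Real.norm_eq_abs, abs_mul]
  calc |f p| * |ψ p| ≤ |f p| * (B + K * p ^ r) :=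
        mul_le_mul_of_nonneg_left (hψ p hp) (abs_nonneg _)
    _ = B * |f p| + K * (|f p| * p ^ r) := by ring

end

lemma solution_sub_ae_eq {f g : ℝ → ℝ} (hf : Integrable f halfLine) (hg : Integrable g halfLine)
    {t : ℝ} (ht : 0 ≤ t) :
    solution f t - solution g t =ᵐ[halfLine] solution (f - g) t := by
  have h := isKernelBounded_normLqE_one (c := 1) (by norm_num) (by norm_num)
  exact h.isSolution_ae_eq_solution (h.isSolution_sub
    (h.isSolution_solution ((memSpace_normLqE_one_iff hf.1).2 (by simpa using hf)))
    (h.isSolution_solution ((memSpace_normLqE_one_iff hg.1).2 (by simpa using hg)))) ht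

lemma exists_integrable_half_moment_integral_abs_sub_le {f : ℝ → ℝ} (hf : Integrable f halfLine)
    {ε : ℝ} (hε : 0 < ε) : ∃ g, Integrable g halfLine ∧
      Integrable (fun p => g p * p ^ (1 / 2 : ℝ)) halfLine ∧ ∫ p, |f p - g p| ∂halfLine ≤ ε := by
  rw [halfLine] at *
  obtain ⟨g, hsupp, hle, hcont, hg⟩ := hf.exists_hasCompactSupport_integral_sub_le hε
  refine ⟨g, hg, ?_, hle⟩
  exact (hcont.mul (Real.continuous_rpow_const (by norm_num))).integrable_of_hasCompactSupport
    hsupp.mul_right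

section

variable {φ : ℝ → ℝ} (hφ : ContinuousOn φ (Ici 0)) {M : ℝ} (hM : ∀ p, 0 ≤ p → |φ p| ≤ M)
include hφ hM

lemma integrable_mul_of_continuousOn {f : ℝ → ℝ} (hf : Integrable f halfLine) :
    Integrable (fun p => f p * φ p) halfLine := by
  refine hf.mul_bdd (c := M)
    ((hφ.mono Ioi_subset_Ici_self).aestronglyMeasurable measurableSet_Ioi) ?_
  filter_upwards [ae_halfLine_pos] with p hp using hM p hp.le

lemma integral_solution_sub_mul {f g : ℝ → ℝ} (hf : Integrable f halfLine)
    (hg : Integrable g halfLine) {t : ℝ} (ht : 0 ≤ t) :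
    ∫ p, solution (f - g) t p * φ p ∂halfLine =
      ∫ p, solution f t p * φ p ∂halfLine - ∫ p, solution g t p * φ p ∂halfLine := by
  rw [← integral_sub (integrable_mul_of_continuousOn hφ hM (integrable_solution hf t))
    (integrable_mul_of_continuousOn hφ hM (integrable_solution hg t))]
  refine integral_congr_ae ?_
  filter_upwards [solution_sub_ae_eq hf hg ht] with p hp
  rw [← hp, Pi.sub_apply, sub_mul]

-- The moment of order `1 / 2` decays, so no mass stays away from the origin.
lemma tendsto_integral_solution_mul_sub_of_half_moment {f : ℝ → ℝ} (hf : Integrable f halfLine)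
    (hhalf : Integrable (fun p => f p * p ^ (1 / 2 : ℝ)) halfLine) :
    Tendsto (fun t => ∫ p, solution f t p * (φ p - φ 0) ∂halfLine) atTop (𝓝 0) := by
  rw [show (1 / 2 : ℝ) = 3 / 2 - 1 by norm_num] at hhalf
  have hrate : gammaN + kernelMoment (3 / 2) < 0 := by
    rw [gammaN_eq_neg_kernelMoment]
    linarith [kernelMoment_three_halves_lt_one]
  refine tendsto_zero_of_abs_le_mul_add (I := ∫ p, |f p| ∂halfLine)
    (integral_nonneg fun _ => abs_nonneg _) fun ε hε => ?_
  obtain ⟨K, hK, hle⟩ := exists_abs_sub_le_add_mul_rpow (hφ 0 self_mem_Ici) hM hε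
  rw [show (1 / 2 : ℝ) = 3 / 2 - 1 by norm_num] at hle
  refine ⟨_, by simpa using ((tendsto_exp_mul_atTop_nhds_zero hrate).mul_const
    (∫ p, |f p| * p ^ (3 / 2 - 1 : ℝ) ∂halfLine)).const_mul K, ?_⟩
  filter_upwards [eventually_ge_atTop 0] with t ht
  refine (abs_integral_mul_le_add (integrable_solution hf t)
    (integrable_solution_mul_rpow (by norm_num) (by norm_num) hf.1 hhalf t) hle).trans ?_
  exact add_le_add (mul_le_mul_of_nonneg_left (integral_abs_solution_le hf ht) hε.le)
    (mul_le_mul_of_nonneg_left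
      (integral_abs_solution_mul_rpow_le (by norm_num) (by norm_num) hf.1 hhalf ht) hK)

lemma tendsto_integral_solution_mul_sub {f : ℝ → ℝ} (hf : Integrable f halfLine) :
    Tendsto (fun t => ∫ p, solution f t p * (φ p - φ 0) ∂halfLine) atTop (𝓝 0) := by
  have hψ : ContinuousOn (fun p => φ p - φ 0) (Ici 0) := hφ.sub continuousOn_const
  have hψM : ∀ p, 0 ≤ p → |φ p - φ 0| ≤ M + M := fun p hp =>
    (abs_sub _ _).trans (add_le_add (hM p hp) (hM 0 le_rfl))
  have hM0 : 0 ≤ M := (abs_nonneg _).trans (hM 0 le_rfl)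
  refine tendsto_zero_of_abs_le_mul_add (I := M + M) (by positivity) fun ε hε => ?_
  obtain ⟨g, hg, hhalf, hle⟩ := exists_integrable_half_moment_integral_abs_sub_le hf hε
  refine ⟨_, by simpa using
    (tendsto_integral_solution_mul_sub_of_half_moment hφ hM hg hhalf).abs, ?_⟩
  filter_upwards [eventually_ge_atTop 0] with t ht
  have hdiff : |∫ p, solution (f - g) t p * (φ p - φ 0) ∂halfLine| ≤ ε * (M + M) :=
    calc |∫ p, solution (f - g) t p * (φ p - φ 0) ∂halfLine|
        ≤ (M + M) * ∫ p, |solution (f - g) t p| ∂halfLine :=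
          abs_integral_mul_le (integrable_solution (hf.sub hg) t) fun p hp => hψM p hp.le
      _ ≤ (M + M) * ε := mul_le_mul_of_nonneg_left
          ((integral_abs_solution_le (hf.sub hg) ht).trans hle) (by positivity)
      _ = ε * (M + M) := mul_comm _ _
  rw [integral_solution_sub_mul hψ hψM hf hg ht] at hdiff
  linarith [abs_sub_abs_le_abs_sub (∫ p, solution f t p * (φ p - φ 0) ∂halfLine)
    (∫ p, solution g t p * (φ p - φ 0) ∂halfLine)]

end

namespace IsSolutionInKernelBoundedSpace

variable {A₀ : ℝ → ℝ} {A : ℝ → ℝ → ℝ} (hA : IsSolutionInKernelBoundedSpace A₀ A)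
  (hi : Integrable A₀ halfLine) {φ : ℝ → ℝ} (hφ : ContinuousOn φ (Ici 0)) {M : ℝ}
  (hM : ∀ p, 0 ≤ p → |φ p| ≤ M)
include hA hi hφ hM

lemma tendsto_integral_mul :
    Tendsto (fun t => ∫ p, A t p * φ p ∂halfLine) atTop (𝓝 (φ 0 * ∫ p, A₀ p ∂halfLine)) := by
  have hlim := (tendsto_integral_solution_mul_sub hφ hM hi).add_const (φ 0 * ∫ p, A₀ p ∂halfLine)
  rw [zero_add] at hlim
  refine hlim.congr' ?_
  filter_upwards [eventually_ge_atTop 0] with t ht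
  have hcongr : ∫ p, solution A₀ t p * (φ p - φ 0) ∂halfLine =
      ∫ p, A t p * (φ p - φ 0) ∂halfLine :=
    integral_congr_ae ((hA.ae_eq_solution ht).symm.mul .rfl)
  have hint := hA.integrable hi ht
  rw [hcongr]
  simp only [mul_sub]
  rw [integral_sub (integrable_mul_of_continuousOn hφ hM hint) (hint.mul_const _),
    integral_mul_const, hA.integral_eq hi ht, mul_comm (φ 0), sub_add_cancel]

end IsSolutionInKernelBoundedSpace

lemma integrable_init_of_isSolution_normY {a b : ℝ} (ha : a ∈ Ioo (-(1 / 2) : ℝ) 1)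
    (hb : b ∈ Ioo (-(5 / 2) : ℝ) (-(1 / 2))) {A₀ : ℝ → ℝ} {A : ℝ → ℝ → ℝ}
    (hA : IsSolution (normY a b) A₀ A) : Integrable A₀ halfLine := by
  refine integrable_of_memSpace_normY ha.1 hb.2 ?_
  rw [normY_eq] at hA ⊢
  exact (isKernelBounded_normYE ⟨by linarith [ha.1], ha.2⟩
    ⟨hb.1, by linarith [hb.2]⟩).memSpace_of_isSolution hA

end

end LinearWKE

theorem theorem2_general :
    (∀ q θ : ℝ, 1 ≤ q → θ ∈ Ioo (-q) (5 / 2 * q) → SignedWellPosed (normLq q θ)) ∧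
    (MemSpace (normLq 1 0) kernelV ∧
      ∀ q : ℝ, 1 ≤ q → ∀ (A₀ : ℝ → ℝ) (A : ℝ → ℝ → ℝ),
        IsSolution (normLq q 0) A₀ A → ∀ t : ℝ, 0 ≤ t →
          normLq q 0 (A t) ≤
            ENNReal.ofReal (Real.exp (gammaN * t) *
              (1 + (normLq 1 0 kernelV).toReal *
                (Real.exp ((normLq 1 0 kernelV).toReal * t) - 1))) * normLq q 0 A₀) ∧
    (∀ a b : ℝ, a ∈ Ioo (-(5 / 2) : ℝ) 1 → b ∈ Ioo (-(5 / 2) : ℝ) 1 →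
      SignedWellPosed (normY a b)) ∧
    (∀ (A₀ : ℝ → ℝ) (A : ℝ → ℝ → ℝ), IsSolutionInKernelBoundedSpace A₀ A →
      Integrable A₀ halfLine → ∀ t : ℝ, 0 ≤ t → Integrable (A t) halfLine ∧
        ∫ p, A t p ∂halfLine = ∫ p, A₀ p ∂halfLine) ∧
    (∃ κ : ℝ, 0 < κ ∧
      ∀ (A₀ : ℝ → ℝ) (A : ℝ → ℝ → ℝ), IsSolutionInKernelBoundedSpace A₀ A →
        Integrable (fun p => A₀ p * p ^ 2) halfLine →
        ∀ t : ℝ, 0 ≤ t → Integrable (fun p => A t p * p ^ 2) halfLine ∧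
          ∫ p, A t p * p ^ 2 ∂halfLine =
            Real.exp (κ * t) * ∫ p, A₀ p * p ^ 2 ∂halfLine) ∧
    (∀ (A₀ : ℝ → ℝ) (A : ℝ → ℝ → ℝ), IsSolutionInKernelBoundedSpace A₀ A →
      Integrable A₀ halfLine →
      ∀ φ : ℝ → ℝ, ContinuousOn φ (Ici 0) → (∃ M : ℝ, ∀ p, 0 ≤ p → |φ p| ≤ M) →
        (∀ t : ℝ, 0 ≤ t → Integrable (fun p => A t p * φ p) halfLine) ∧
        Tendsto (fun t : ℝ => ∫ p, A t p * φ p ∂halfLine) atTop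
          (𝓝 (φ 0 * ∫ p, A₀ p ∂halfLine))) := by
  refine ⟨fun q θ hq hθ => ?_, ⟨memSpace_normLq_one_zero_kernelV, fun q hq A₀ A hA t ht =>
    normLq_zero_isSolution_le hq hA ht⟩, fun a b ha hb => ?_, fun A₀ A hA hi t ht =>
    ⟨hA.integrable hi ht, hA.integral_eq hi ht⟩, ⟨kernelMoment 3 - kernelMoment 1,
    sub_pos.2 kernelMoment_one_lt_three, fun A₀ A hA hi t ht => ⟨hA.integrable_mul_sq hi ht,
    hA.integral_mul_sq hi ht⟩⟩, fun A₀ A hA hi φ hφ ⟨M, hM⟩ => ⟨fun t ht =>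
    integrable_mul_of_continuousOn hφ hM (hA.integrable hi ht), hA.tendsto_integral_mul hi hφ hM⟩⟩
  · rw [normLq_eq]
    exact (isKernelBounded_normLqE hq hθ).signedWellPosed
  · rw [normY_eq]
    exact (isKernelBounded_normYE ha hb).signedWellPosed

theorem theorem2 :
    -- well-posedness in the spaces `L^q_θ`
    (∀ q θ : ℝ, 1 ≤ q → θ ∈ Ioo (-1 : ℝ) (5 / 2) → WellPosed (normLq q θ)) ∧
    -- the explicit exponential bound for `θ = 0`
    (MemSpace (normLq 1 0) kernelV ∧
      ∀ q : ℝ, 1 ≤ q → ∀ (A₀ : ℝ → ℝ) (A : ℝ → ℝ → ℝ), Nonneg A₀ →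
        IsSolution (normLq q 0) A₀ A → ∀ t : ℝ, 0 ≤ t →
          normLq q 0 (A t) ≤
            ENNReal.ofReal (Real.exp (gammaN * t) *
              (1 + (normLq 1 0 kernelV).toReal *
                (Real.exp ((normLq 1 0 kernelV).toReal * t) - 1))) * normLq q 0 A₀) ∧
    -- well-posedness in the spaces `𝒴_{a,b}`
    (∀ a b : ℝ, AdmissibleY a b → WellPosed (normY a b)) ∧
    -- conservation of the wave action
    (∀ (A₀ : ℝ → ℝ) (A : ℝ → ℝ → ℝ), IsSolutionInSomeSpace A₀ A → Integrable A₀ halfLine →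
      ∀ t : ℝ, 0 ≤ t → Integrable (A t) halfLine ∧
        ∫ p, A t p ∂halfLine = ∫ p, A₀ p ∂halfLine) ∧
    -- exponential growth of the energy
    (∃ κ : ℝ, 0 < κ ∧
      ∀ (A₀ : ℝ → ℝ) (A : ℝ → ℝ → ℝ), IsSolutionInSomeSpace A₀ A →
        Integrable (fun p => A₀ p * p ^ 2) halfLine →
        ∀ t : ℝ, 0 ≤ t → Integrable (fun p => A t p * p ^ 2) halfLine ∧
          ∫ p, A t p * p ^ 2 ∂halfLine =
            Real.exp (κ * t) * ∫ p, A₀ p * p ^ 2 ∂halfLine) ∧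
    -- long time behaviour
    (∀ a b : ℝ, AdmissibleY a b → ∀ (A₀ : ℝ → ℝ) (A : ℝ → ℝ → ℝ), Nonneg A₀ →
      IsSolution (normY a b) A₀ A →
      Integrable A₀ halfLine ∧
      ∀ φ : ℝ → ℝ, ContinuousOn φ (Ici 0) → (∃ M : ℝ, ∀ p, 0 ≤ p → |φ p| ≤ M) →
        (∀ t : ℝ, 0 ≤ t → Integrable (fun p => A t p * φ p) halfLine) ∧
        Tendsto (fun t : ℝ => ∫ p, A t p * φ p ∂halfLine) atTop
          (𝓝 (φ 0 * ∫ p, A₀ p ∂halfLine))) := by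
  obtain ⟨hLq, ⟨hV, hexp⟩, hY, hwave, ⟨κ, hκ, henergy⟩, hlim⟩ := theorem2_general
  refine ⟨fun q θ hq hθ => (hLq q θ hq ⟨by linarith [hθ.1], by linarith [hθ.2]⟩).wellPosed,
    ⟨hV, fun q hq A₀ A _ => hexp q hq A₀ A⟩,
    fun a b ⟨hb, hb', ha, ha'⟩ =>
      (hY a b ⟨by linarith, ha'⟩ ⟨hb, by linarith⟩).wellPosed,
    fun A₀ A hA => hwave A₀ A hA.isSolutionInKernelBoundedSpace,
    ⟨κ, hκ, fun A₀ A hA => henergy A₀ A hA.isSolutionInKernelBoundedSpace⟩,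
    fun a b hab A₀ A _ hA => ?_⟩
  have hsol : IsSolutionInSomeSpace A₀ A := Or.inr ⟨a, b, hab, hA⟩
  obtain ⟨hb, hb', ha, ha'⟩ := hab
  have hi : Integrable A₀ halfLine :=
    integrable_init_of_isSolution_normY ⟨by linarith, ha'⟩ ⟨hb, by linarith⟩ hA
  exact ⟨hi, hlim A₀ A hsol.isSolutionInKernelBoundedSpace hi⟩
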